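/- Conventions: sets and functions are Borel, measures are positive and finite (Hausdorff and Lebesgue measure excepted), $n\ge 0$, $\mathrm{Gr}(\mathbb{R}^n)$ is the set of all linear subspaces of $\mathbb{R}^n$ with the gap metric, and $\mu$ is supported on a Borel set $E$ if $\mu(\mathbb{R}^n\setminus E)=0$. For $k\ge 1$ a Borel set $E\subset\mathbb{R}^n$ is $k$-rectifiable if $\mathscr{H}^k(E)<\infty$ and $E$ is covered, up to an $\mathscr{H}^k$-null set, by countably many $k$-dimensional surfaces (embedded submanifolds) of class $C^1$. Its approximate tangent space $\mathrm{Tan}(E,x)$ is characterized, up to $\mathscr{H}^k$-null sets, by $\mathrm{Tan}(E,x)=\mathrm{Tan}(S,x)$ for $\mathscr{H}^k$-a.e. $x\in E\cap S$, for every $k$-dimensional surface $S$ of class $C^1$. A set $E$ is purely unrectifiable if $\mathscr{H}^1(E\cap S)=0$ for every $1$-rectifiable set $S$. Let $I$ be a locally compact, separable metric space with a finite measure $dt$. A family $\{\mu_t : t\in I\}$ of measures on $\mathbb{R}^n$ is called integrable if $t\mapsto\mu_t(B)$ is Borel for every Borel set $B$ and $\int_I\mu_t(\mathbb{R}^n)\,dt<\infty$;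 then $\int_I\mu_t\,dt$ is the measure $B\mapsto\int_I\mu_t(B)\,dt$. Given a measure $\mu$ on $\mathbb{R}^n$, let $\mathscr{F}_\mu$ be the class of all integrable families $\{\mu_t: t\in[0,1]\}$ ($dt$ being Lebesgue measure) such that each $\mu_t$ is the restriction of $\mathscr{H}^1$ to a $1$-rectifiable set $E_t$ and $\int_{[0,1]}\mu_t\,dt\ll\mu$. Let $\mathscr{G}_\mu$ be the class of all Borel maps $V:\mathbb{R}^n\to\mathrm{Gr}(\mathbb{R}^n)$ such that for every $\{\mu_t\}\in\mathscr{F}_\mu$ one has $\mathrm{Tan}(E_t,x)\subset V(x)$ for $\mu_t$-a.e. $x$ and a.e. $t$. The decomposability bundle $x\mapsto V(\mu,x)$ is the minimal element of $\mathscr{G}_\mu$, i.e. the element, unique up to $\mu$-null sets, such that $V(\mu,x)\subset V'(x)$ for $\mu$-a.e. $x$, for every $V'\in\mathscr{G}_\mu$. **Proposition.** Let $\mu,\mu'$ be measures on $\mathbb{R}^n$. Then: (i) (strong locality) if $\mu'\ll\mu$ then $V(\mu',x)=V(\mu,x)$ for $\mu'$-a.e. $x$; more generally, if $1_E\,\mu'\ll\mu$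 for some Borel set $E$, then $V(\mu',x)=V(\mu,x)$ for $\mu'$-a.e. $x\in E$; (ii) if $\mu$ is supported on a $k$-dimensional surface $S$ of class $C^1$, then $V(\mu,x)\subset\mathrm{Tan}(S,x)$ for $\mu$-a.e. $x$; (iii) if $k\ge 1$ and $\mu\ll 1_E\,\mathscr{H}^k$ where $E$ is a $k$-rectifiable set, then $V(\mu,x)=\mathrm{Tan}(E,x)$ for $\mu$-a.e. $x$; in particular, if $\mu\ll\mathscr{L}^n$ then $V(\mu,x)=\mathbb{R}^n$ for $\mu$-a.e. $x$; (iv) $V(\mu,x)=\{0\}$ for $\mu$-a.e. $x$ if and only if $\mu$ is supported on a purely unrectifiable (Borel) set $E$. Moreover, let $\{\nu_s: s\in I\}$ be an integrable family of measures on $\mathbb{R}^n$, where $I$ is any locally compact, separable metric space endowed with a finite measure $ds$. Then: (v) if $\int_I\nu_s\,ds\ll\mu$, then $V(\nu_s,x)\subset V(\mu,x)$ for $\nu_s$-a.e. $x$ and a.e. $s$; (vi) if $k\ge 1$, $\mu\ll\int_I\nu_s\,ds$ and, for a.e. $s$, $\nu_s=1_{E_s}\,\mathscr{H}^k$ with $E_s$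 a $k$-rectifiable set, then $V(\mu,x)$ has dimension at least $k$ for $\mu$-a.e. $x$. -/

import Mathlib

open MeasureTheory Set Filter Topology
open scoped ENNReal

/-- A map `V` from `ℝⁿ` to the set `Gr(ℝⁿ)` of all linear subspaces of `ℝⁿ` is Borel. The distance
of `Gr(ℝⁿ)` is the gap distance `d(V, W) = ‖P_V - P_W‖`, where `P_V` is the orthogonal projection
onto `V` (equivalently, the Hausdorff distance of the closed unit balls of `V` and `W`), so `V` is
Borel if and only if `x ↦ P_{V(x)}` is Borel with values in the space of linear operators. -/
def IsBorelBundle {n : ℕ} (V : EuclideanSpace ℝ (Fin n) → Submodule ℝ (EuclideanSpace ℝ (Fin n))) :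
    Prop :=
  Measurable fun x => (V x).starProjection

theorem isBorelBundle_iff {n : ℕ}
    {V : EuclideanSpace ℝ (Fin n) → Submodule ℝ (EuclideanSpace ℝ (Fin n))} :
    IsBorelBundle V ↔ ∀ v, Measurable fun x => (V x).starProjection v := by
  constructor
  · intro h v
    exact (ContinuousLinearMap.measurable_apply v).comp h
  · intro h
    let b := EuclideanSpace.basisFun (Fin n) ℝ
    have key : ∀ x, (V x).starProjection =
        ∑ i, (innerSL ℝ (b i)).smulRight ((V x).starProjection (b i)) := by
      intro x
      ext1 v
      conv_lhs => rw [← b.sum_repr' v]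
      simp [map_sum]
    have hc : ∀ i, Continuous fun w : EuclideanSpace ℝ (Fin n) =>
        (innerSL ℝ (b i)).smulRight w := fun i =>
      (ContinuousLinearMap.smulRightL ℝ _ _ (innerSL ℝ (b i))).continuous
    unfold IsBorelBundle
    rw [funext key]
    exact Finset.measurable_sum _ fun i _ => (hc i).measurable.comp (h _)

theorem IsBorelBundle.inf {n : ℕ}
    {V W : EuclideanSpace ℝ (Fin n) → Submodule ℝ (EuclideanSpace ℝ (Fin n))}
    (hV : IsBorelBundle V) (hW : IsBorelBundle W) : IsBorelBundle fun x => V x ⊓ W x := by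
  rw [isBorelBundle_iff]
  intro v
  let f : EuclideanSpace ℝ (Fin n) → (EuclideanSpace ℝ (Fin n) →L[ℝ] EuclideanSpace ℝ (Fin n)) :=
    fun x => (1 / 2 : ℝ) • ((V x).starProjection + (W x).starProjection)
  have hf : Measurable f := Measurable.const_smul (Measurable.add hV hW) (1 / 2 : ℝ)
  have hnorm : ∀ x, ‖f x‖ ≤ 1 := by
    intro x
    have h1 := (V x).starProjection_norm_le
    have h2 := (W x).starProjection_norm_le
    have h3 := norm_add_le (V x).starProjection (W x).starProjection
    simp only [f, norm_smul]
    norm_num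
    linarith
  have hfix : ∀ x, (f x).eqLocus (1 : EuclideanSpace ℝ (Fin n) →L[ℝ] EuclideanSpace ℝ (Fin n))
      = V x ⊓ W x := by
    intro x
    ext u
    constructor
    · intro hu
      have hu' : (1 / 2 : ℝ) • ((V x).starProjection u + (W x).starProjection u) = u := hu
      have h1 := (V x).norm_starProjection_apply_le u
      have h2 := (W x).norm_starProjection_apply_le u
      have h3 : 2 * ‖u‖ ≤ ‖(V x).starProjection u‖ + ‖(W x).starProjection u‖ := by
        have h4 := norm_add_le ((V x).starProjection u) ((W x).starProjection u)
        have h5 : ‖u‖ = 1 / 2 * ‖(V x).starProjection u + (W x).starProjection u‖ := by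
          conv_lhs => rw [← hu', norm_smul]
          norm_num
        linarith
      exact ⟨((V x).mem_iff_norm_starProjection u).2 (by linarith),
        ((W x).mem_iff_norm_starProjection u).2 (by linarith)⟩
    · rintro ⟨h1, h2⟩
      change (1 / 2 : ℝ) • ((V x).starProjection u + (W x).starProjection u) = u
      rw [Submodule.starProjection_eq_self_iff.2 h1, Submodule.starProjection_eq_self_iff.2 h2,
        ← two_smul ℝ, smul_smul]
      norm_num
  have hlim : ∀ x, Tendsto (fun k : ℕ => birkhoffAverage ℝ (f x) _root_.id k v) atTop
      (𝓝 ((V x ⊓ W x).starProjection v)) := by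
    intro x
    have := (f x).tendsto_birkhoffAverage_orthogonalProjection (hnorm x) v
    have hcongr : ∀ A B : Submodule ℝ (EuclideanSpace ℝ (Fin n)), A = B →
        A.starProjection v = B.starProjection v := by
      rintro A _ rfl
      rfl
    rw [← hcongr _ _ (hfix x)]
    exact this
  refine measurable_of_tendsto_metrizable (f := fun (k : ℕ) x =>
    birkhoffAverage ℝ (f x) _root_.id k v) (fun k => ?_) (tendsto_pi_nhds.2 hlim)
  have hit : ∀ j : ℕ, Measurable fun x => (f x)^[j] v := by
    intro j
    induction j with
    | zero => exact measurable_const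
    | succ j ih =>
      simp_rw [Function.iterate_succ_apply']
      exact (isBoundedBilinearMap_apply.continuous.measurable).comp (hf.prodMk ih)
  simp only [birkhoffAverage, birkhoffSum, id]
  exact Measurable.const_smul (Finset.measurable_sum (Finset.range k) fun j _ => hit j) (k : ℝ)⁻¹

theorem IsBorelBundle.iInf {n : ℕ}
    {V : ℕ → EuclideanSpace ℝ (Fin n) → Submodule ℝ (EuclideanSpace ℝ (Fin n))}
    (hV : ∀ i, IsBorelBundle (V i)) : IsBorelBundle fun x => ⨅ i, V i x := by
  let W : ℕ → EuclideanSpace ℝ (Fin n) → Submodule ℝ (EuclideanSpace ℝ (Fin n)) :=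
    fun m => Nat.rec (V 0) (fun m U x => U x ⊓ V (m + 1) x) m
  have hW : ∀ m, IsBorelBundle (W m) := by
    intro m
    induction m with
    | zero => exact hV 0
    | succ m ih => exact ih.inf (hV (m + 1))
  have hWs : ∀ m x, W (m + 1) x = W m x ⊓ V (m + 1) x := fun m x => rfl
  have anti : ∀ x, Antitone fun m => W m x := fun x =>
    antitone_nat_of_succ_le fun m => by rw [hWs]; exact inf_le_left
  have hWV : ∀ m x, W m x ≤ V m x := by
    intro m x
    cases m with
    | zero => exact le_rfl
    | succ m => rw [hWs]; exact inf_le_right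
  have hle : ∀ m x, ⨅ i, V i x ≤ W m x := by
    intro m x
    induction m with
    | zero => exact iInf_le _ 0
    | succ m ih => rw [hWs]; exact le_inf ih (iInf_le _ _)
  refine measurable_of_tendsto_metrizable (fun m => hW m) (tendsto_pi_nhds.2 fun x => ?_)
  obtain ⟨N, hN⟩ := IsArtinian.monotone_stabilizes
    (⟨fun m => OrderDual.toDual (W m x), fun i j h => anti x h⟩ :
      ℕ →o (Submodule ℝ (EuclideanSpace ℝ (Fin n)))ᵒᵈ)
  have hN' : ∀ m, N ≤ m → W N x = W m x := fun m hm => hN m hm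
  have hEq : ∀ m, N ≤ m → W m x = ⨅ i, V i x := by
    intro m hm
    refine le_antisymm (le_iInf fun i => ?_) (hle m x)
    rcases le_total i m with h | h
    · exact (anti x h).trans (hWV i x)
    · rw [← hN' m hm, hN' i (hm.trans h)]; exact hWV i x
  refine tendsto_const_nhds.congr' ?_
  filter_upwards [eventually_ge_atTop N] with m hm
  simp only [hEq m hm]

theorem IsBorelBundle.measurable_finrank {n : ℕ}
    {V : EuclideanSpace ℝ (Fin n) → Submodule ℝ (EuclideanSpace ℝ (Fin n))}
    (hV : IsBorelBundle V) : Measurable fun x => (Module.finrank ℝ (V x) : ℝ≥0∞) := by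
  have h : ∀ x, (Module.finrank ℝ (V x) : ℝ≥0∞) = ENNReal.ofReal
      (∑ i, inner ℝ (EuclideanSpace.basisFun (Fin n) ℝ i)
        ((V x).starProjection (EuclideanSpace.basisFun (Fin n) ℝ i))) := by
    intro x
    have hp : LinearMap.IsProj (V x) ((V x).starProjection : EuclideanSpace ℝ (Fin n) →ₗ[ℝ] _) :=
      ⟨fun u => Submodule.starProjection_apply_mem _ _,
        fun u hu => Submodule.starProjection_eq_self_iff.2 hu⟩
    have h2 := LinearMap.trace_eq_sum_inner
      ((V x).starProjection : EuclideanSpace ℝ (Fin n) →ₗ[ℝ] EuclideanSpace ℝ (Fin n))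
      (EuclideanSpace.basisFun (Fin n) ℝ)
    rw [hp.trace] at h2
    simp only [ContinuousLinearMap.coe_coe] at h2
    rw [← h2, ENNReal.ofReal_natCast]
  simp_rw [h]
  refine ENNReal.measurable_ofReal.comp (Finset.measurable_sum _ fun i _ => ?_)
  exact (measurable_const (a := EuclideanSpace.basisFun (Fin n) ℝ i)).inner (isBorelBundle_iff.1 hV _)

/-- A nonempty family of Borel bundles which is closed under countable intersections has an element
which is minimal up to `μ`-null sets. -/
theorem exists_minimal_bundle {n : ℕ} (μ : Measure (EuclideanSpace ℝ (Fin n))) [IsFiniteMeasure μ]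
    (G : Set (EuclideanSpace ℝ (Fin n) → Submodule ℝ (EuclideanSpace ℝ (Fin n))))
    (hG : ∀ V ∈ G, IsBorelBundle V) (hne : G.Nonempty)
    (hinf : ∀ V : ℕ → EuclideanSpace ℝ (Fin n) → Submodule ℝ (EuclideanSpace ℝ (Fin n)),
      (∀ i, V i ∈ G) → (fun x => ⨅ i, V i x) ∈ G) :
    ∃ V ∈ G, ∀ V' ∈ G, ∀ᵐ x ∂μ, V x ≤ V' x := by
  let Φ : (EuclideanSpace ℝ (Fin n) → Submodule ℝ (EuclideanSpace ℝ (Fin n))) → ℝ≥0∞ :=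
    fun V => ∫⁻ x, (Module.finrank ℝ (V x) : ℝ≥0∞) ∂μ
  obtain ⟨u, -, hu, huG⟩ := exists_seq_tendsto_sInf (hne.image Φ) (OrderBot.bddBelow _)
  choose V hVG hVu using huG
  have hmem := hinf V hVG
  set U := fun x => ⨅ i, V i x with hU
  have hmono : ∀ A B : Submodule ℝ (EuclideanSpace ℝ (Fin n)), A ≤ B →
      (Module.finrank ℝ A : ℝ≥0∞) ≤ Module.finrank ℝ B := fun A B h => by
    exact_mod_cast Submodule.finrank_mono h
  have hUle : Φ U ≤ sInf (Φ '' G) := by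
    refine ge_of_tendsto' hu fun i => ?_
    rw [← hVu]
    exact lintegral_mono fun x => hmono _ _ (iInf_le _ i)
  refine ⟨U, hmem, fun V' hV' => ?_⟩
  have h2 : (fun x => U x ⊓ V' x) ∈ G := by
    have := hinf (fun i => if i = 0 then U else V') (fun i => by split_ifs <;> assumption)
    convert this using 1
    ext1 x
    refine le_antisymm (le_iInf fun i => ?_) (le_inf ?_ ?_)
    · by_cases h : i = 0
      · simp [h]
      · simp [h]
    · exact (iInf_le _ 0).trans (by simp)
    · exact (iInf_le _ 1).trans (by simp)
  have hfin : Φ (fun x => U x ⊓ V' x) ≠ ∞ := by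
    have : Φ (fun x => U x ⊓ V' x) ≤ ∫⁻ _, (n : ℝ≥0∞) ∂μ := lintegral_mono fun x => by
      have := Submodule.finrank_le (U x ⊓ V' x)
      rw [finrank_euclideanSpace_fin] at this
      simpa using this
    refine (this.trans_lt ?_).ne
    rw [lintegral_const]
    exact ENNReal.mul_lt_top (ENNReal.natCast_lt_top n) (measure_lt_top μ _)
  have hae := ae_eq_of_ae_le_of_lintegral_le
    (f := fun x => (Module.finrank ℝ (U x ⊓ V' x : Submodule ℝ _) : ℝ≥0∞))
    (g := fun x => (Module.finrank ℝ (U x) : ℝ≥0∞)) (μ := μ)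
    (Eventually.of_forall fun x => hmono _ _ inf_le_left) hfin
    (hG U hmem).measurable_finrank.aemeasurable (hUle.trans (sInf_le ⟨_, h2, rfl⟩))
  filter_upwards [hae] with x hx
  have : U x ⊓ V' x = U x := Submodule.eq_of_le_of_finrank_eq inf_le_left (by exact_mod_cast hx)
  exact inf_eq_left.1 this

/-- `S` is a `k`-dimensional surface (embedded submanifold, without boundary) of class `C¹` in `ℝⁿ`:
around each of its points, a local `C¹`-diffeomorphism of `ℝⁿ` maps `S` to a `k`-dimensional
linear subspace. -/
def IsC1Surface {n : ℕ} (k : ℕ) (S : Set (EuclideanSpace ℝ (Fin n))) : Prop :=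
  ∀ x ∈ S, ∃ (φ : OpenPartialHomeomorph (EuclideanSpace ℝ (Fin n)) (EuclideanSpace ℝ (Fin n)))
    (W : Submodule ℝ (EuclideanSpace ℝ (Fin n))),
    x ∈ φ.source ∧ Module.finrank ℝ W = k ∧
    ContDiffOn ℝ 1 φ φ.source ∧ ContDiffOn ℝ 1 φ.symm φ.target ∧
    ∀ y ∈ φ.source, y ∈ S ↔ φ y ∈ W

/-- The tangent space `Tan(S, x)` of a surface `S` at `x ∈ S`: the linear span of the tangent cone,
that is, of all limits of `c_j • d_j` with `d_j → 0`, `x + d_j ∈ S` and real `c_j`. (For a surface of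
class `C¹` the tangent cone is already a linear subspace.) -/
noncomputable def tanSpace {n : ℕ} (S : Set (EuclideanSpace ℝ (Fin n)))
    (x : EuclideanSpace ℝ (Fin n)) : Submodule ℝ (EuclideanSpace ℝ (Fin n)) :=
  Submodule.span ℝ (tangentConeAt ℝ S x)

/-- At almost every point of an arbitrary set, every vector is tangent to the set. -/
theorem ae_tangentConeAt_eq_univ {F : Type*} [NormedAddCommGroup F] [NormedSpace ℝ F]
    [FiniteDimensional ℝ F] [MeasurableSpace F] [BorelSpace F] (m : Measure F)
    [m.IsAddHaarMeasure] (B : Set F) :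
    m {x ∈ B | tangentConeAt ℝ B x ≠ univ} = 0 := by
  have h0 := Besicovitch.ae_tendsto_measure_inter_div m B
  have h1 : ∀ᵐ x ∂m.restrict B, tangentConeAt ℝ B x = univ := by
    filter_upwards [h0] with x hx
    refine eq_univ_of_forall fun v => ?_
    have key : ∀ j : ℕ, ∃ d : F, ∃ c : ℝ, ‖d‖ ≤ 1 / (j + 1) ∧ x + d ∈ B ∧
        ‖c • d - v‖ ≤ 1 / (j + 1) := by
      intro j
      have hj : (0 : ℝ) < 1 / (j + 1) := Nat.one_div_pos_of_nat
      have ev := Measure.eventually_nonempty_inter_smul_of_density_one m B x hx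
        (Metric.closedBall v (1 / (j + 1))) Metric.isClosed_closedBall.measurableSet
        (Metric.measure_closedBall_pos m v hj).ne'
      have hsm : (0 : ℝ) < 1 / (j + 1) / (‖v‖ + 1) := by positivity
      have ev2 : ∀ᶠ r in 𝓝[>] (0 : ℝ), r ∈ Ioo (0 : ℝ) (1 / (j + 1) / (‖v‖ + 1)) :=
        Ioo_mem_nhdsGT hsm
      obtain ⟨r, ⟨y, hyB, hy⟩, hr0, hr1⟩ := (ev.and ev2).exists
      obtain ⟨x', rfl, z, ⟨a, ha, rfl⟩, rfl⟩ := hy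
      rw [mem_closedBall_iff_norm] at ha
      have ha1 : ‖a‖ ≤ ‖v‖ + 1 := by
        have : ‖a‖ ≤ ‖v‖ + ‖a - v‖ := by simpa using norm_add_le v (a - v)
        have : (1 : ℝ) / (j + 1) ≤ 1 := by
          rw [div_le_one (by positivity)]; linarith [Nat.cast_nonneg (α := ℝ) j]
        linarith
      refine ⟨r • a, r⁻¹, ?_, hyB, ?_⟩
      · rw [norm_smul, Real.norm_of_nonneg hr0.le]
        calc r * ‖a‖ ≤ (1 / (j + 1) / (‖v‖ + 1)) * (‖v‖ + 1) := by gcongr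
          _ = 1 / (j + 1) := by field_simp
      · simpa [smul_smul, inv_mul_cancel₀ hr0.ne'] using ha
    choose d c hd hdB hcd using key
    have lim0 : Tendsto (fun j : ℕ => (1 : ℝ) / (j + 1)) atTop (𝓝 0) :=
      tendsto_one_div_add_atTop_nhds_zero_nat
    refine mem_tangentConeAt_of_seq atTop c d (squeeze_zero_norm hd lim0)
      (Eventually.of_forall hdB) ?_
    rw [tendsto_iff_norm_sub_tendsto_zero]
    exact squeeze_zero (fun _ => norm_nonneg _) hcd lim0
  refine le_antisymm ?_ zero_le
  calc m {x ∈ B | tangentConeAt ℝ B x ≠ univ} ≤ m ({x | tangentConeAt ℝ B x ≠ univ} ∩ B) :=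
        measure_mono fun x hx => ⟨hx.2, hx.1⟩
    _ ≤ m.restrict B {x | tangentConeAt ℝ B x ≠ univ} := Measure.le_restrict_apply _ _
    _ = 0 := h1

theorem IsC1Surface.finrank_tanSpace_le {n k : ℕ} {S : Set (EuclideanSpace ℝ (Fin n))}
    (hS : IsC1Surface k S) {x : EuclideanSpace ℝ (Fin n)} (hx : x ∈ S) :
    Module.finrank ℝ (tanSpace S x) ≤ k := by
  obtain ⟨φ, W, hxs, rfl, h1, h2, h3⟩ := hS x hx
  have hd : HasFDerivAt φ (fderiv ℝ φ x) x :=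
    ((h1.contDiffAt (φ.open_source.mem_nhds hxs)).differentiableAt one_ne_zero).hasFDerivAt
  have hd' : HasFDerivAt φ.symm (fderiv ℝ φ.symm (φ x)) (φ x) :=
    ((h2.contDiffAt (φ.open_target.mem_nhds (φ.map_source hxs))).differentiableAt
      one_ne_zero).hasFDerivAt
  have hcomp : (fderiv ℝ φ.symm (φ x)).comp (fderiv ℝ φ x) = ContinuousLinearMap.id ℝ _ := by
    refine (hd'.comp x hd).unique ((hasFDerivAt_id x).congr_of_eventuallyEq ?_)
    filter_upwards [φ.open_source.mem_nhds hxs] with y hy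
    exact φ.left_inv hy
  have hinj : Function.Injective (fderiv ℝ φ x) := by
    refine Function.LeftInverse.injective (g := fderiv ℝ φ.symm (φ x)) fun v => ?_
    exact congrArg (fun L => L v) hcomp
  have hmap : ∀ v ∈ tangentConeAt ℝ S x, fderiv ℝ φ x v ∈ W := by
    intro v hv
    rw [← tangentConeAt_inter_nhds (φ.open_source.mem_nhds hxs)] at hv
    have hd2 := ((Wᗮ.starProjection.hasFDerivAt (x := φ x)).comp x hd).hasFDerivWithinAt
      (s := S ∩ φ.source)
    have h4 := hd2.mapsTo_tangent_cone hv
    have h5 : (Wᗮ.starProjection ∘ φ) '' (S ∩ φ.source) ⊆ {0} := by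
      rintro _ ⟨y, ⟨hyS, hys⟩, rfl⟩
      have := (h3 y hys).1 hyS
      have h0 : Wᗮ.starProjection (φ y) = 0 :=
        Submodule.starProjection_orthogonal_apply_eq_zero this
      exact h0
    have h6 := tangentConeAt_mono h5 h4
    have h7 : ¬ AccPt ((Wᗮ.starProjection ∘ φ) x) (𝓟 ({0} : Set (EuclideanSpace ℝ (Fin n)))) := by
      intro h
      rw [accPt_iff_nhds] at h
      obtain ⟨y, ⟨-, hy⟩, hne⟩ := h univ univ_mem
      refine hne (hy.trans ?_)
      exact (h5 ⟨x, ⟨hx, hxs⟩, rfl⟩).symm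
    have h8 := tangentConeAt_subset_zero h7 h6
    have h9 : Wᗮ.starProjection (fderiv ℝ φ x v) = 0 := h8
    have h10 : fderiv ℝ φ x v ∈ Wᗮᗮ := by
      rw [← Submodule.starProjection_apply_eq_zero_iff]; exact h9
    rwa [Submodule.orthogonal_orthogonal] at h10
  have hle : (tanSpace S x).map (fderiv ℝ φ x : EuclideanSpace ℝ (Fin n) →ₗ[ℝ] EuclideanSpace ℝ (Fin n)) ≤ W := by
    rw [tanSpace, Submodule.map_span, Submodule.span_le]
    rintro _ ⟨v, hv, rfl⟩
    exact hmap v hv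
  calc Module.finrank ℝ (tanSpace S x)
      = Module.finrank ℝ ((tanSpace S x).map
          (fderiv ℝ φ x : EuclideanSpace ℝ (Fin n) →ₗ[ℝ] EuclideanSpace ℝ (Fin n))) :=
        (Submodule.equivMapOfInjective _ hinj _).finrank_eq
    _ ≤ _ := Submodule.finrank_mono hle

/-- Two `k`-dimensional surfaces have the same tangent space at `ℋᵏ`-a.e. common point. -/
theorem IsC1Surface.ae_tanSpace_eq {n k : ℕ} {S T : Set (EuclideanSpace ℝ (Fin n))}
    (hS : IsC1Surface k S) (hT : IsC1Surface k T) :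
    ∀ᵐ x ∂(μH[k] : Measure (EuclideanSpace ℝ (Fin n))), x ∈ S → x ∈ T →
      tanSpace S x = tanSpace T x := by
  rw [ae_iff]
  set Z := {x | ¬ (x ∈ S → x ∈ T → tanSpace S x = tanSpace T x)} with hZ
  have hZS : ∀ z ∈ Z, z ∈ S ∧ z ∈ T ∧ tanSpace S z ≠ tanSpace T z := by
    intro z hz
    simp only [hZ, mem_ofPred_eq, not_forall] at hz
    obtain ⟨a, b, c⟩ := hz
    exact ⟨a, b, c⟩
  refine measure_null_of_locally_null _ fun x hx => ?_
  obtain ⟨φ, W, hxs, hk, h1, h2, h3⟩ := hS x (hZS x hx).1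
  obtain ⟨K, t, ht, hlip⟩ := (h2.contDiffAt
    (φ.open_target.mem_nhds (φ.map_source hxs))).exists_lipschitzOnWith
  -- the part of `S ∩ T` seen in the chart
  let B : Set W := {w | (w : EuclideanSpace ℝ (Fin n)) ∈ φ.target ∧ φ.symm w ∈ S ∩ T}
  let N : Set W := {w ∈ B | tangentConeAt ℝ B w ≠ univ}
  have hN : (μH[k] : Measure W) N = 0 := by
    rw [← hk]
    exact ae_tangentConeAt_eq_univ _ B
  have hgood : ∀ z ∈ Z, z ∈ φ.source → ∃ w ∈ N, (w : EuclideanSpace ℝ (Fin n)) = φ z := by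
    intro z hz hzs
    obtain ⟨hzS, hzT, hne⟩ := hZS z hz
    refine ⟨⟨φ z, (h3 z hzs).1 hzS⟩, ⟨⟨φ.map_source hzs, ?_⟩, fun huniv => hne ?_⟩, rfl⟩
    · change φ.symm (φ z) ∈ S ∩ T
      rw [φ.left_inv hzs]; exact ⟨hzS, hzT⟩
    have hd : HasFDerivAt φ (fderiv ℝ φ z) z :=
      ((h1.contDiffAt (φ.open_source.mem_nhds hzs)).differentiableAt one_ne_zero).hasFDerivAt
    have hd' : HasFDerivAt φ.symm (fderiv ℝ φ.symm (φ z)) (φ z) :=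
      ((h2.contDiffAt (φ.open_target.mem_nhds (φ.map_source hzs))).differentiableAt
        one_ne_zero).hasFDerivAt
    have hd'' : HasFDerivAt φ (fderiv ℝ φ z) (φ.symm (φ z)) := by rwa [φ.left_inv hzs]
    have hcomp : (fderiv ℝ φ z).comp (fderiv ℝ φ.symm (φ z)) = ContinuousLinearMap.id ℝ _ := by
      refine (hd''.comp (φ z) hd').unique ((hasFDerivAt_id _).congr_of_eventuallyEq ?_)
      filter_upwards [φ.open_target.mem_nhds (φ.map_source hzs)] with y hy
      exact φ.right_inv hy
    have hinj : Function.Injective (fderiv ℝ φ.symm (φ z)) := by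
      refine Function.LeftInverse.injective (g := fderiv ℝ φ z) fun v => ?_
      exact congrArg (fun L => L v) hcomp
    let w : W := ⟨φ z, (h3 z hzs).1 hzS⟩
    have hdw : HasFDerivWithinAt (φ.symm ∘ W.subtypeL)
        ((fderiv ℝ φ.symm (φ z)).comp W.subtypeL) B w :=
      (HasFDerivAt.comp w (g := φ.symm) (f := W.subtypeL) hd' W.subtypeL.hasFDerivAt).hasFDerivWithinAt
    have himg : (φ.symm ∘ W.subtypeL) '' B ⊆ S ∩ T := by
      rintro _ ⟨b, hb, rfl⟩
      exact hb.2
    have hbase : (φ.symm ∘ W.subtypeL) w = z := φ.left_inv hzs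
    have hcone : ∀ v : W, fderiv ℝ φ.symm (φ z) v ∈ tangentConeAt ℝ (S ∩ T) z := by
      intro v
      have := hdw.mapsTo_tangent_cone (show v ∈ tangentConeAt ℝ B w from by rw [huniv]; trivial)
      rw [hbase] at this
      exact tangentConeAt_mono himg this
    let R := W.map (fderiv ℝ φ.symm (φ z) : EuclideanSpace ℝ (Fin n) →ₗ[ℝ] EuclideanSpace ℝ (Fin n))
    have hR : Module.finrank ℝ R = k := by
      rw [← hk]; exact ((Submodule.equivMapOfInjective _ hinj _).finrank_eq).symm
    have hRle : ∀ A : Set (EuclideanSpace ℝ (Fin n)), S ∩ T ⊆ A → R ≤ tanSpace A z := by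
      rintro A hA _ ⟨v, hv, rfl⟩
      exact Submodule.subset_span (tangentConeAt_mono hA (hcone ⟨v, hv⟩))
    have e1 : R = tanSpace S z := Submodule.eq_of_le_of_finrank_le (hRle S inter_subset_left)
      (by rw [hR]; exact hS.finrank_tanSpace_le hzS)
    have e2 : R = tanSpace T z := Submodule.eq_of_le_of_finrank_le (hRle T inter_subset_right)
      (by rw [hR]; exact hT.finrank_tanSpace_le hzT)
    exact e1.symm.trans e2
  refine ⟨Z ∩ (φ.source ∩ φ ⁻¹' t), ?_, ?_⟩
  · refine inter_mem_nhdsWithin _ (inter_mem (φ.open_source.mem_nhds hxs) ?_)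
    exact (φ.continuousAt hxs).preimage_mem_nhds ht
  · have hsub : Z ∩ (φ.source ∩ φ ⁻¹' t) ⊆ φ.symm '' (((↑) : W → _) '' N ∩ t) := by
      rintro z ⟨hz, hzs, hzt⟩
      obtain ⟨w, hw, hwz⟩ := hgood z hz hzs
      exact ⟨φ z, ⟨⟨w, hw, hwz⟩, hzt⟩, φ.left_inv hzs⟩
    refine measure_mono_null hsub ?_
    have hl := (hlip.mono (inter_subset_right (s := ((↑) : W → _) '' N))).hausdorffMeasure_image_le
      (Nat.cast_nonneg k)
    refine le_antisymm (hl.trans ?_) zero_le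
    have : (μH[k] : Measure (EuclideanSpace ℝ (Fin n))) (((↑) : W → _) '' N) = 0 := by
      have hiso : Isometry ((↑) : W → EuclideanSpace ℝ (Fin n)) := isometry_subtype_coe
      rw [hiso.hausdorffMeasure_image (Or.inl (Nat.cast_nonneg k)), hN]
    rw [measure_mono_null inter_subset_left this, mul_zero]

/-- `E` is `k`-rectifiable: it is Borel, has finite `ℋᵏ` measure, and is covered, up to an `ℋᵏ`-null
set, by countably many `k`-dimensional surfaces of class `C¹`. (`μH[k]` is the Hausdorff measure
without the usual normalizing constant; the constant plays no role below.) -/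
def IsRectifiable {n : ℕ} (k : ℕ) (E : Set (EuclideanSpace ℝ (Fin n))) : Prop :=
  MeasurableSet E ∧ (μH[k] : Measure (EuclideanSpace ℝ (Fin n))) E < ∞ ∧
    ∃ S : ℕ → Set (EuclideanSpace ℝ (Fin n)), (∀ i, IsC1Surface k (S i)) ∧
      (μH[k] : Measure (EuclideanSpace ℝ (Fin n))) (E \ ⋃ i, S i) = 0

/-- `T` is an (approximate) tangent bundle of the `k`-rectifiable set `E`: for every `k`-dimensional
surface `S` of class `C¹`, one has `T(x) = Tan(S, x)` for `ℋᵏ`-a.e. `x ∈ E ∩ S`. -/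
def IsTangentBundle {n : ℕ} (k : ℕ) (E : Set (EuclideanSpace ℝ (Fin n)))
    (T : EuclideanSpace ℝ (Fin n) → Submodule ℝ (EuclideanSpace ℝ (Fin n))) : Prop :=
  ∀ S : Set (EuclideanSpace ℝ (Fin n)), IsC1Surface k S →
    ∀ᵐ x ∂(μH[k] : Measure (EuclideanSpace ℝ (Fin n))), x ∈ E → x ∈ S → T x = tanSpace S x

theorem IsRectifiable.exists_isTangentBundle {n k : ℕ} {E : Set (EuclideanSpace ℝ (Fin n))}
    (hE : IsRectifiable k E) : ∃ T, IsTangentBundle k E T := by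
  classical
  obtain ⟨-, -, S, hS, hnull⟩ := hE
  refine ⟨fun x => if h : ∃ i, x ∈ S i then tanSpace (S (Nat.find h)) x else ⊥, fun U hU => ?_⟩
  have h1 : ∀ᵐ x ∂(μH[k] : Measure (EuclideanSpace ℝ (Fin n))), x ∉ E \ ⋃ i, S i :=
    measure_eq_zero_iff_ae_notMem.1 hnull
  have h2 := ae_all_iff.2 fun i => (hS i).ae_tanSpace_eq hU
  filter_upwards [h1, h2] with x hx1 hx2 hxE hxU
  have h : ∃ i, x ∈ S i := by
    by_contra hcon
    exact hx1 ⟨hxE, by simpa using hcon⟩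
  rw [dif_pos h]
  exact hx2 _ (Nat.find_spec h) hxU

/-- The tangent bundle is unique up to `ℋᵏ`-null sets. -/
theorem IsTangentBundle.ae_unique {n k : ℕ} {E : Set (EuclideanSpace ℝ (Fin n))}
    (hE : IsRectifiable k E)
    {T T' : EuclideanSpace ℝ (Fin n) → Submodule ℝ (EuclideanSpace ℝ (Fin n))}
    (hT : IsTangentBundle k E T) (hT' : IsTangentBundle k E T') :
    ∀ᵐ x ∂(μH[k] : Measure (EuclideanSpace ℝ (Fin n))), x ∈ E → T x = T' x := by
  obtain ⟨-, -, S, hS, hnull⟩ := hE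
  have h1 : ∀ᵐ x ∂(μH[k] : Measure (EuclideanSpace ℝ (Fin n))), x ∉ E \ ⋃ i, S i :=
    measure_eq_zero_iff_ae_notMem.1 hnull
  filter_upwards [h1, ae_all_iff.2 fun i => hT _ (hS i), ae_all_iff.2 fun i => hT' _ (hS i)]
    with x hx1 hx2 hx3 hxE
  have h : ∃ i, x ∈ S i := by
    by_contra hcon
    exact hx1 ⟨hxE, by simpa using hcon⟩
  obtain ⟨i, hi⟩ := h
  rw [hx2 i hxE hi, hx3 i hxE hi]

/-- The approximate tangent space `Tan(E, x)` of a `k`-rectifiable set `E`, which is determined for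
`ℋᵏ`-a.e. `x ∈ E`. -/
noncomputable def approxTan {n k : ℕ} {E : Set (EuclideanSpace ℝ (Fin n))}
    (hE : IsRectifiable k E) :
    EuclideanSpace ℝ (Fin n) → Submodule ℝ (EuclideanSpace ℝ (Fin n)) :=
  hE.exists_isTangentBundle.choose

theorem isTangentBundle_approxTan {n k : ℕ} {E : Set (EuclideanSpace ℝ (Fin n))}
    (hE : IsRectifiable k E) : IsTangentBundle k E (approxTan hE) :=
  hE.exists_isTangentBundle.choose_spec

/-- `E` is purely (`1`-)unrectifiable: it meets every `1`-rectifiable set in an `ℋ¹`-null set. -/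
def IsPurelyUnrectifiable {n : ℕ} (E : Set (EuclideanSpace ℝ (Fin n))) : Prop :=
  ∀ S : Set (EuclideanSpace ℝ (Fin n)), IsRectifiable 1 S →
    (μH[1] : Measure (EuclideanSpace ℝ (Fin n))) (E ∩ S) = 0

/-- The family of measures `μ_t = ℋ¹` restricted to `F t`, indexed by `t ∈ [0, 1]`, belongs to the
class `ℱ_μ`: each `F t` is `1`-rectifiable, `t ↦ μ_t(B)` is Borel for every Borel set `B` (this is
measurability for the `σ`-algebra that Mathlib puts on spaces of measures), `∫ μ_t(ℝⁿ) dt` is finite,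
and the measure `∫ μ_t dt`, that is `B ↦ ∫ μ_t(B) dt`, is absolutely continuous with respect to
`μ`. -/
structure IsDecompFamily {n : ℕ} (μ : Measure (EuclideanSpace ℝ (Fin n)))
    (F : unitInterval → Set (EuclideanSpace ℝ (Fin n))) : Prop where
  rect : ∀ t, IsRectifiable 1 (F t)
  meas : Measurable fun t => (μH[1] : Measure (EuclideanSpace ℝ (Fin n))).restrict (F t)
  finite_mass : ∫⁻ t : unitInterval, (μH[1] : Measure (EuclideanSpace ℝ (Fin n))) (F t) < ∞
  ac : (volume : Measure unitInterval).bind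
    (fun t => (μH[1] : Measure (EuclideanSpace ℝ (Fin n))).restrict (F t)) ≪ μ

/-- The class `𝒢_μ` of all Borel bundles which contain, for every family in `ℱ_μ`, the tangent lines
`Tan(F t, x)` for a.e. `t` and `ℋ¹`-a.e. `x ∈ F t`. -/
def compatibleBundles {n : ℕ} (μ : Measure (EuclideanSpace ℝ (Fin n))) :
    Set (EuclideanSpace ℝ (Fin n) → Submodule ℝ (EuclideanSpace ℝ (Fin n))) :=
  {V | IsBorelBundle V ∧
    ∀ (F : unitInterval → Set (EuclideanSpace ℝ (Fin n))) (hF : IsDecompFamily μ F),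
      ∀ᵐ t : unitInterval, ∀ᵐ x ∂(μH[1] : Measure (EuclideanSpace ℝ (Fin n))).restrict (F t),
        approxTan (hF.rect t) x ≤ V x}

theorem exists_minimal_compatibleBundle {n : ℕ} (μ : Measure (EuclideanSpace ℝ (Fin n)))
    [IsFiniteMeasure μ] :
    ∃ V ∈ compatibleBundles μ, ∀ V' ∈ compatibleBundles μ, ∀ᵐ x ∂μ, V x ≤ V' x := by
  refine exists_minimal_bundle μ _ (fun V hV => hV.1)
    ⟨fun _ => ⊤, measurable_const (a := (⊤ : Submodule ℝ (EuclideanSpace ℝ (Fin n))).starProjection), fun F hF => ?_⟩ fun V hV => ?_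
  · exact Eventually.of_forall fun t => Eventually.of_forall fun x => le_top
  · refine ⟨IsBorelBundle.iInf fun i => (hV i).1, fun F hF => ?_⟩
    filter_upwards [ae_all_iff.2 fun i => (hV i).2 F hF] with t ht
    filter_upwards [ae_all_iff.2 ht] with x hx
    exact le_iInf hx

/-- The decomposability bundle `x ↦ V(μ, x)` of a finite measure `μ` on `ℝⁿ`: the minimal element of
`𝒢_μ`, which is unique up to `μ`-null sets. -/
noncomputable def decompBundle {n : ℕ} (μ : Measure (EuclideanSpace ℝ (Fin n)))
    [IsFiniteMeasure μ] : EuclideanSpace ℝ (Fin n) → Submodule ℝ (EuclideanSpace ℝ (Fin n)) :=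
  (exists_minimal_compatibleBundle μ).choose

theorem decompBundle_mem {n : ℕ} (μ : Measure (EuclideanSpace ℝ (Fin n))) [IsFiniteMeasure μ] :
    decompBundle μ ∈ compatibleBundles μ :=
  (exists_minimal_compatibleBundle μ).choose_spec.1

theorem decompBundle_ae_le {n : ℕ} (μ : Measure (EuclideanSpace ℝ (Fin n))) [IsFiniteMeasure μ]
    {V : EuclideanSpace ℝ (Fin n) → Submodule ℝ (EuclideanSpace ℝ (Fin n))}
    (hV : V ∈ compatibleBundles μ) : ∀ᵐ x ∂μ, decompBundle μ x ≤ V x :=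
  (exists_minimal_compatibleBundle μ).choose_spec.2 V hV

/-! ### Operations on Borel bundles. -/

section Bundles

variable {n : ℕ}

/-! The proof replaces the class `𝒢_μ` by a test on single curves. A Borel bundle `V` passes the
test off a Borel set `N` (`ContainsCurveTangents N V`) if every `C¹` curve `ψ` satisfies `ψ'(t) ∈
V(ψ(t))` for almost every `t` with `ψ(t) ∉ N`. The central fact is that `V` belongs to `𝒢_μ` if and
only if it passes the test off some `μ`-null set. The test mentions `μ` only through the null set,
so it passes at once to measures with more null sets.

Sufficiency (`ContainsCurveTangents.mem_compatibleBundles`): straighten a surface by a chart and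
apply Fubini on parallel lines. The tangent space of a `k`-dimensional surface is then contained in
`V` at `ℋᵏ`-a.e. point off `N`. The same holds for `k`-rectifiable sets, and a family in `ℱ_μ` does
not charge `N`.

Necessity (`exists_containsCurveTangents`): a family in `ℱ_μ` controls only almost every one of its
members, whereas `N` must serve all curves at once. For a vector `e` and `δ < ‖e‖`, the curves with
difference quotients within `δ` of `e` form a compact set (`isCompact_slopeCurves`). Let `A` be the
set where the distance from `e` to `V(x)` exceeds `δ`. Any average of these curves is singular to
`μ` on `A`: otherwise its absolutely continuous part would give a family in `ℱ_μ` whose tangents lie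
both in `V` and within `δ` of `e`. Rainwater's lemma, a minimax argument, then yields one Borel set
that carries `μ` on `A` and is null for every curve; its complement in `A` is `μ`-null. Countably
many `e`, `δ` and radii suffice. Membership in `ℱ_μ` requires Lipschitz curves to be covered by `C¹`
surfaces (Whitney extension in one variable) and `ℋ¹` on a curve to depend measurably on the curve.

Each assertion on decomposability bundles now follows by testing a suitable bundle: a gluing of two
bundles for locality, the tangent bundle of a surface for the upper bound, the zero bundle for
unrectifiability. The lower bounds apply Fubini to `V(μ, ·)` itself. -/

theorem IsBorelBundle.orthogonal
    {V : EuclideanSpace ℝ (Fin n) → Submodule ℝ (EuclideanSpace ℝ (Fin n))}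
    (hV : IsBorelBundle V) : IsBorelBundle fun x => (V x)ᗮ := by
  rw [isBorelBundle_iff] at hV ⊢
  intro v
  have h : ∀ x, (V x)ᗮ.starProjection v = v - (V x).starProjection v := fun x => by
    rw [Submodule.starProjection_orthogonal_val]
  simp_rw [h]
  exact measurable_const.sub (hV v)

theorem isBorelBundle_const (V : Submodule ℝ (EuclideanSpace ℝ (Fin n))) :
    IsBorelBundle fun _ => V :=
  measurable_const (a := V.starProjection)

theorem IsBorelBundle.ite {V W : EuclideanSpace ℝ (Fin n) → Submodule ℝ (EuclideanSpace ℝ (Fin n))}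
    (hV : IsBorelBundle V) (hW : IsBorelBundle W) {A : Set (EuclideanSpace ℝ (Fin n))}
    (hA : MeasurableSet A) [DecidablePred (· ∈ A)] :
    IsBorelBundle fun x => if x ∈ A then V x else W x := by
  have : (fun x => (if x ∈ A then V x else W x).starProjection) =
      fun x => if x ∈ A then (V x).starProjection else (W x).starProjection := by
    funext x
    split_ifs <;> rfl
  unfold IsBorelBundle
  rw [this]
  exact Measurable.ite hA hV hW

theorem isBorelBundle_span_singleton {u : EuclideanSpace ℝ (Fin n) → EuclideanSpace ℝ (Fin n)}
    (hu : Measurable u) : IsBorelBundle fun x => Submodule.span ℝ {u x} := by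
  rw [isBorelBundle_iff]
  intro v
  simp_rw [Submodule.starProjection_singleton]
  exact ((hu.inner measurable_const).div (hu.norm.pow_const 2)).smul hu

/-- The kernels of a Borel field of linear maps form a Borel bundle. -/
theorem isBorelBundle_ker
    {B : EuclideanSpace ℝ (Fin n) → EuclideanSpace ℝ (Fin n) →L[ℝ] EuclideanSpace ℝ (Fin n)}
    (hB : Measurable B) : IsBorelBundle fun x => LinearMap.ker (B x : EuclideanSpace ℝ (Fin n) →ₗ[ℝ] EuclideanSpace ℝ (Fin n)) := by
  classical
  let b := EuclideanSpace.basisFun (Fin n) ℝ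
  -- `IsBorelBundle.iInf` takes sequences, so the basis is padded with zeros; the orthogonal
  -- complement of `0` is everything and does not affect the intersection.
  let c : ℕ → EuclideanSpace ℝ (Fin n) := fun i => if h : i < n then b ⟨i, h⟩ else 0
  have h : ∀ x, LinearMap.ker (B x : EuclideanSpace ℝ (Fin n) →ₗ[ℝ] EuclideanSpace ℝ (Fin n)) =
      ⨅ i : ℕ, (Submodule.span ℝ {ContinuousLinearMap.adjoint (B x) (c i)})ᗮ := by
    intro x
    ext v
    simp only [LinearMap.mem_ker, ContinuousLinearMap.coe_coe, Submodule.mem_iInf,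
      Submodule.mem_orthogonal_singleton_iff_inner_right,
      ContinuousLinearMap.adjoint_inner_left]
    constructor
    · intro hv i
      rw [hv, inner_zero_right]
    · intro hv
      rw [← b.sum_repr' (B x v)]
      refine Finset.sum_eq_zero fun i _ => ?_
      have := hv i
      simp only [c, i.2, dif_pos, Fin.eta] at this
      rw [this, zero_smul]
  simp_rw [h]
  refine IsBorelBundle.iInf fun i => (isBorelBundle_span_singleton ?_).orthogonal
  have h2 : Measurable fun x => ContinuousLinearMap.adjoint (B x) :=
    (ContinuousLinearMap.adjoint (𝕜 := ℝ) (E := EuclideanSpace ℝ (Fin n)) (F := EuclideanSpace ℝ (Fin n))).continuous.measurable.comp hB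
  exact (ContinuousLinearMap.measurable_apply (c i)).comp h2

/-- The set of points where a Borel vector field is tangent to a Borel bundle is Borel. -/
theorem IsBorelBundle.measurableSet_mem {X : Type*} [MeasurableSpace X]
    {V : EuclideanSpace ℝ (Fin n) → Submodule ℝ (EuclideanSpace ℝ (Fin n))}
    (hV : IsBorelBundle V) {p v : X → EuclideanSpace ℝ (Fin n)} (hp : Measurable p)
    (hv : Measurable v) : MeasurableSet {x | v x ∈ V (p x)} := by
  have : {x | v x ∈ V (p x)} = {x | (V (p x)).starProjection (v x) = v x} := by
    ext x
    exact Submodule.starProjection_eq_self_iff.symm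
  rw [this]
  refine measurableSet_eq_fun ?_ hv
  exact (isBoundedBilinearMap_apply.continuous.measurable).comp ((hV.comp hp).prodMk hv)

end Bundles

/-! ### Tangency at almost every parameter, and surfaces in charts. -/

/-- At almost every point where a map takes values in `S`, the range of its derivative is tangent to
`S`. -/
theorem ae_hasFDerivAt_mem_tangentConeAt {F G : Type*} [NormedAddCommGroup F] [NormedSpace ℝ F]
    [FiniteDimensional ℝ F] [MeasurableSpace F] [BorelSpace F] (m : Measure F)
    [m.IsAddHaarMeasure] [NormedAddCommGroup G] [NormedSpace ℝ G] (f : F → G) (S : Set G) :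
    ∀ᵐ y ∂m, f y ∈ S → ∀ f' : F →L[ℝ] G, HasFDerivAt f f' y →
      ∀ v, f' v ∈ tangentConeAt ℝ S (f y) := by
  have h0 := ae_tangentConeAt_eq_univ m (f ⁻¹' S)
  filter_upwards [measure_eq_zero_iff_ae_notMem.1 h0] with y hy hyS f' hf' v
  have huniv : tangentConeAt ℝ (f ⁻¹' S) y = univ := by
    by_contra hne
    exact hy ⟨hyS, hne⟩
  have := hf'.hasFDerivWithinAt.mapsTo_tangent_cone (s := f ⁻¹' S)
    (show v ∈ tangentConeAt ℝ (f ⁻¹' S) y by rw [huniv]; trivial)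
  exact tangentConeAt_mono (image_preimage_subset f S) this

/-- No regularity of `S` is needed, so this serves both for the surfaces that cover a Lipschitz
curve and for a `C¹` curve that meets a surface in an arbitrary way. -/
theorem ae_deriv_mem_tangentConeAt {G : Type*} [NormedAddCommGroup G] [NormedSpace ℝ G]
    (f : ℝ → G) (S : Set G) :
    ∀ᵐ t : ℝ, f t ∈ S → DifferentiableAt ℝ f t → deriv f t ∈ tangentConeAt ℝ S (f t) := by
  filter_upwards [ae_hasFDerivAt_mem_tangentConeAt volume f S] with t ht hS hd
  simpa using ht hS _ hd.hasFDerivAt 1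

section Charts

variable {n : ℕ} {φ : OpenPartialHomeomorph (EuclideanSpace ℝ (Fin n)) (EuclideanSpace ℝ (Fin n))}
  {x : EuclideanSpace ℝ (Fin n)}

theorem hasFDerivAt_chart (h1 : ContDiffOn ℝ 1 φ φ.source) (hx : x ∈ φ.source) :
    HasFDerivAt φ (fderiv ℝ φ x) x :=
  ((h1.contDiffAt (φ.open_source.mem_nhds hx)).differentiableAt one_ne_zero).hasFDerivAt

theorem hasFDerivAt_chart_symm (h2 : ContDiffOn ℝ 1 φ.symm φ.target)
    {y : EuclideanSpace ℝ (Fin n)} (hy : y ∈ φ.target) :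
    HasFDerivAt φ.symm (fderiv ℝ φ.symm y) y :=
  ((h2.contDiffAt (φ.open_target.mem_nhds hy)).differentiableAt one_ne_zero).hasFDerivAt

theorem fderiv_chart_symm_apply_fderiv (h1 : ContDiffOn ℝ 1 φ φ.source)
    (h2 : ContDiffOn ℝ 1 φ.symm φ.target) (hx : x ∈ φ.source) (v : EuclideanSpace ℝ (Fin n)) :
    fderiv ℝ φ.symm (φ x) (fderiv ℝ φ x v) = v := by
  have hcomp : (fderiv ℝ φ.symm (φ x)).comp (fderiv ℝ φ x) = ContinuousLinearMap.id ℝ _ := by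
    refine ((hasFDerivAt_chart_symm h2 (φ.map_source hx)).comp x (hasFDerivAt_chart h1 hx)).unique
      ((hasFDerivAt_id x).congr_of_eventuallyEq ?_)
    filter_upwards [φ.open_source.mem_nhds hx] with y hy
    exact φ.left_inv hy
  exact congrArg (fun L => L v) hcomp

theorem fderiv_chart_apply_fderiv_symm (h1 : ContDiffOn ℝ 1 φ φ.source)
    (h2 : ContDiffOn ℝ 1 φ.symm φ.target) (hx : x ∈ φ.source) (v : EuclideanSpace ℝ (Fin n)) :
    fderiv ℝ φ x (fderiv ℝ φ.symm (φ x) v) = v := by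
  have h := fderiv_chart_symm_apply_fderiv (φ := φ.symm) (x := φ x) h2 (by simpa using h1)
    (φ.map_source hx) v
  simpa [φ.left_inv hx] using h

/-- In a chart which straightens the surface `S` to the subspace `W`, the tangent space of `S` is the
preimage of `W` under the derivative of the chart. -/
theorem IsC1Surface.tanSpace_eq {k : ℕ} {S : Set (EuclideanSpace ℝ (Fin n))}
    (hS : IsC1Surface k S) {W : Submodule ℝ (EuclideanSpace ℝ (Fin n))}
    (hW : Module.finrank ℝ W = k) (h1 : ContDiffOn ℝ 1 φ φ.source)
    (h2 : ContDiffOn ℝ 1 φ.symm φ.target) (h3 : ∀ y ∈ φ.source, y ∈ S ↔ φ y ∈ W)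
    (hx : x ∈ φ.source) (hxS : x ∈ S) :
    tanSpace S x = W.comap (fderiv ℝ φ x : EuclideanSpace ℝ (Fin n) →ₗ[ℝ] EuclideanSpace ℝ (Fin n))
      ∧ Module.finrank ℝ (tanSpace S x) = k := by
  let e : EuclideanSpace ℝ (Fin n) ≃ₗ[ℝ] EuclideanSpace ℝ (Fin n) :=
    LinearEquiv.ofLinearMap (fderiv ℝ φ x : EuclideanSpace ℝ (Fin n) →ₗ[ℝ] EuclideanSpace ℝ (Fin n))
      (fderiv ℝ φ.symm (φ x) : EuclideanSpace ℝ (Fin n) →ₗ[ℝ] EuclideanSpace ℝ (Fin n))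
      (LinearMap.ext fun v => fderiv_chart_apply_fderiv_symm h1 h2 hx v)
      (LinearMap.ext fun v => fderiv_chart_symm_apply_fderiv h1 h2 hx v)
  set R := W.comap (fderiv ℝ φ x : EuclideanSpace ℝ (Fin n) →ₗ[ℝ] EuclideanSpace ℝ (Fin n)) with hR
  have hRk : Module.finrank ℝ R = k := by
    have : R = W.map (e.symm : EuclideanSpace ℝ (Fin n) →ₗ[ℝ] EuclideanSpace ℝ (Fin n)) :=
      (Submodule.map_equiv_eq_comap_symm e.symm W).symm
    rw [this, LinearEquiv.finrank_map_eq, hW]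
  have hle : R ≤ tanSpace S x := by
    intro v hv
    refine Submodule.subset_span ?_
    -- This curve runs in `S` near `0` with velocity `v`, since the chart turns it into a segment in
    -- `W`. The opposite inclusion comes from the bound on the dimension.
    let f : ℝ → EuclideanSpace ℝ (Fin n) := fun s => φ.symm (φ x + s • fderiv ℝ φ x v)
    have hd : HasDerivAt f v 0 := by
      have hl : HasDerivAt (fun s : ℝ => φ x + s • fderiv ℝ φ x v) (fderiv ℝ φ x v) 0 := by
        simpa using ((hasDerivAt_id (0 : ℝ)).smul_const (fderiv ℝ φ x v)).const_add (φ x)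
      have := HasFDerivAt.comp_hasDerivAt (f := fun s : ℝ => φ x + s • fderiv ℝ φ x v) (0 : ℝ)
        (l := φ.symm) (by simpa using hasFDerivAt_chart_symm h2 (φ.map_source hx)) hl
      rw [fderiv_chart_symm_apply_fderiv h1 h2 hx] at this
      exact this
    have hf0 : f 0 = x := by simp [f, φ.left_inv hx]
    have hev : f ⁻¹' S ∈ 𝓝 (0 : ℝ) := by
      have hc : ContinuousAt (fun s : ℝ => φ x + s • fderiv ℝ φ x v) 0 := by fun_prop
      have := hc.preimage_mem_nhds (t := φ.target)
        (by simpa using φ.open_target.mem_nhds (φ.map_source hx))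
      filter_upwards [this] with s hs
      change φ.symm _ ∈ S
      rw [h3 _ (φ.map_target hs), φ.right_inv hs]
      exact W.add_mem ((h3 x hx).1 hxS) (W.smul_mem s hv)
    have h4 := hd.hasFDerivAt.hasFDerivWithinAt.mapsTo_tangent_cone (s := f ⁻¹' S)
      (show (1 : ℝ) ∈ tangentConeAt ℝ (f ⁻¹' S) 0 by
        rw [← univ_inter (f ⁻¹' S), tangentConeAt_inter_nhds hev, tangentConeAt_univ]; trivial)
    rw [hf0] at h4
    simpa using tangentConeAt_mono (image_preimage_subset f S) h4
  have heq := Submodule.eq_of_le_of_finrank_le hle (by rw [hRk]; exact hS.finrank_tanSpace_le hxS)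
  exact ⟨heq.symm, heq ▸ hRk⟩

theorem IsC1Surface.finrank_tanSpace {k : ℕ} {S : Set (EuclideanSpace ℝ (Fin n))}
    (hS : IsC1Surface k S) (hxS : x ∈ S) : Module.finrank ℝ (tanSpace S x) = k := by
  obtain ⟨φ, W, hx, hW, h1, h2, h3⟩ := hS x hxS
  exact (hS.tanSpace_eq hW h1 h2 h3 hx hxS).2

end Charts

/-! ### The test on curves, and how it extends to rectifiable sets. -/

/-- Off the set `N`, the bundle `V` contains almost every tangent vector of every curve of class
`C¹`. -/
def ContainsCurveTangents {n : ℕ} (N : Set (EuclideanSpace ℝ (Fin n)))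
    (V : EuclideanSpace ℝ (Fin n) → Submodule ℝ (EuclideanSpace ℝ (Fin n))) : Prop :=
  ∀ (ψ : ℝ → EuclideanSpace ℝ (Fin n)) (O : Set ℝ), IsOpen O → ContDiffOn ℝ 1 ψ O →
    ∀ᵐ t : ℝ, t ∈ O → ψ t ∉ N → deriv ψ t ∈ V (ψ t)

section CurveTangents

variable {n : ℕ} {N : Set (EuclideanSpace ℝ (Fin n))}
  {V : EuclideanSpace ℝ (Fin n) → Submodule ℝ (EuclideanSpace ℝ (Fin n))}

/-- In a straightened surface, Fubini's theorem on parallel lines shows that almost every tangent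
vector with a given direction belongs to the bundle. -/
theorem ContainsCurveTangents.ae_chart (h : ContainsCurveTangents N V) (hV : IsBorelBundle V)
    (hN : MeasurableSet N)
    {φ : OpenPartialHomeomorph (EuclideanSpace ℝ (Fin n)) (EuclideanSpace ℝ (Fin n))}
    (h2 : ContDiffOn ℝ 1 φ.symm φ.target) (W : Submodule ℝ (EuclideanSpace ℝ (Fin n))) (w : W)
    (m : Measure W) [m.IsAddHaarMeasure] :
    ∀ᵐ y : W ∂m, (y : EuclideanSpace ℝ (Fin n)) ∈ φ.target → φ.symm y ∉ N →
      fderiv ℝ φ.symm y w ∈ V (φ.symm y) := by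
  classical
  -- A Borel extension of `φ.symm` to the whole space, which makes the exceptional set measurable
  -- for Fubini.
  let p : EuclideanSpace ℝ (Fin n) → EuclideanSpace ℝ (Fin n) :=
    φ.target.piecewise φ.symm fun _ => 0
  have hp : Measurable p := by
    refine (ContinuousOn.measurable_piecewise φ.continuousOn_symm continuousOn_const
      φ.open_target.measurableSet)
  have hpe : ∀ y ∈ φ.target, p y = φ.symm y := fun y hy => piecewise_eq_of_mem _ _ _ hy
  let s : Set W := {y | (y : EuclideanSpace ℝ (Fin n)) ∈ φ.target → p y ∉ N →
      fderiv ℝ φ.symm y w ∈ V (p y)}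
  have hs : MeasurableSet s := by
    have e1 : MeasurableSet {y : W | (y : EuclideanSpace ℝ (Fin n)) ∈ φ.target} :=
      measurable_subtype_coe φ.open_target.measurableSet
    have e2 : MeasurableSet {y : W | p y ∈ N} := (hp.comp measurable_subtype_coe) hN
    have e3 : MeasurableSet {y : W | fderiv ℝ φ.symm y w ∈ V (p y)} :=
      hV.measurableSet_mem (hp.comp measurable_subtype_coe)
        ((measurable_fderiv_apply_const ℝ φ.symm _).comp measurable_subtype_coe)
    have : s = {y : W | (y : EuclideanSpace ℝ (Fin n)) ∈ φ.target}ᶜ ∪ ({y : W | p y ∈ N} ∪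
        {y : W | fderiv ℝ φ.symm y w ∈ V (p y)}) := by
      ext y
      simp only [s, mem_ofPred_eq, mem_union, mem_compl_iff]
      tauto
    rw [this]
    exact e1.compl.union (e2.union e3)
  have key : ∀ᵐ y ∂m, y ∈ s := by
    refine ae_mem_of_ae_add_linearMap_mem (LinearMap.toSpanSingleton ℝ W w) volume m hs
      fun y => ?_
    -- Each line parallel to `w` becomes a `C¹` curve, to which the test applies.
    let ψ : ℝ → EuclideanSpace ℝ (Fin n) := fun t => φ.symm (y + t • w)
    let l : ℝ → EuclideanSpace ℝ (Fin n) := fun t => y + t • w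
    have hl : ContDiff ℝ 1 l := contDiff_const.add (contDiff_id.smul contDiff_const)
    have hψ := h ψ (l ⁻¹' φ.target) (φ.open_target.preimage hl.continuous)
      (h2.comp hl.contDiffOn fun t ht => ht)
    filter_upwards [hψ] with t ht
    have hcoe : ((y + LinearMap.toSpanSingleton ℝ W w t : W) : EuclideanSpace ℝ (Fin n)) = l t := by
      simp [l]
    change ((y + LinearMap.toSpanSingleton ℝ W w t : W) : EuclideanSpace ℝ (Fin n)) ∈ φ.target → _
    rw [hcoe]
    intro hlt hlN
    rw [hpe _ hlt] at hlN ⊢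
    have hd : HasDerivAt ψ (fderiv ℝ φ.symm (l t) w) t := by
      have hl' : HasDerivAt l (w : EuclideanSpace ℝ (Fin n)) t := by
        simpa [l] using ((hasDerivAt_id t).smul_const (w : EuclideanSpace ℝ (Fin n))).const_add
          (y : EuclideanSpace ℝ (Fin n))
      exact (hasFDerivAt_chart_symm h2 hlt).comp_hasDerivAt t hl'
    have := ht hlt hlN
    rw [hd.deriv] at this
    exact this
  filter_upwards [key] with y hy hyt hyN
  have := hy hyt
  rw [hpe _ hyt] at this
  exact this hyN

/-- The image, under the inverse of a `C¹` chart, of a null subset of a `k`-dimensional subspace is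
`ℋᵏ`-null. -/
theorem hausdorffMeasure_chart_symm_image_eq_zero
    {φ : OpenPartialHomeomorph (EuclideanSpace ℝ (Fin n)) (EuclideanSpace ℝ (Fin n))}
    (h2 : ContDiffOn ℝ 1 φ.symm φ.target) (W : Submodule ℝ (EuclideanSpace ℝ (Fin n))) {d : ℝ}
    (hd : 0 ≤ d) {A : Set W} (hA : (μH[d] : Measure W) A = 0)
    (hAt : ∀ y ∈ A, (y : EuclideanSpace ℝ (Fin n)) ∈ φ.target) :
    (μH[d] : Measure (EuclideanSpace ℝ (Fin n))) ((fun y : W => φ.symm y) '' A) = 0 := by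
  refine measure_null_of_locally_null _ ?_
  rintro _ ⟨y, hy, rfl⟩
  have hyt := hAt y hy
  obtain ⟨K, t, ht, hlip⟩ := (h2.contDiffAt (φ.open_target.mem_nhds hyt)).exists_lipschitzOnWith
  refine ⟨((fun y : W => φ.symm y) '' A) ∩ (φ.source ∩ φ ⁻¹' t), ?_, ?_⟩
  · refine inter_mem_nhdsWithin _ (inter_mem (φ.open_source.mem_nhds (φ.map_target hyt)) ?_)
    exact (φ.continuousAt (φ.map_target hyt)).preimage_mem_nhds (by rwa [φ.right_inv hyt])
  · have hsub : ((fun y : W => φ.symm y) '' A) ∩ (φ.source ∩ φ ⁻¹' t) ⊆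
        φ.symm '' (((↑) : W → _) '' A ∩ t) := by
      rintro _ ⟨⟨z, hz, rfl⟩, -, hzt⟩
      rw [mem_preimage, φ.right_inv (hAt z hz)] at hzt
      exact ⟨z, ⟨⟨z, hz, rfl⟩, hzt⟩, rfl⟩
    refine measure_mono_null hsub ?_
    refine le_antisymm (((hlip.mono inter_subset_right).hausdorffMeasure_image_le hd).trans ?_)
      zero_le
    have : (μH[d] : Measure (EuclideanSpace ℝ (Fin n))) (((↑) : W → _) '' A) = 0 := by
      have hiso : Isometry ((↑) : W → EuclideanSpace ℝ (Fin n)) := isometry_subtype_coe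
      rw [hiso.hausdorffMeasure_image (Or.inl hd), hA]
    rw [measure_mono_null inter_subset_left this, mul_zero]

/-- Fubini is applied once for each vector of a basis of the straightened surface, so only finitely
many null sets arise, and the images of the basis vectors span the tangent space. This is how
information on curves reaches surfaces of every dimension `k`. -/
theorem ContainsCurveTangents.ae_tanSpace_le (h : ContainsCurveTangents N V)
    (hV : IsBorelBundle V) (hN : MeasurableSet N) {k : ℕ} {S : Set (EuclideanSpace ℝ (Fin n))}
    (hS : IsC1Surface k S) :
    ∀ᵐ x ∂(μH[k] : Measure (EuclideanSpace ℝ (Fin n))), x ∈ S → x ∉ N → tanSpace S x ≤ V x := by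
  rw [ae_iff]
  refine measure_null_of_locally_null _ fun x hx => ?_
  simp only [mem_ofPred_eq, not_forall] at hx
  obtain ⟨hxS, -, -⟩ := hx
  obtain ⟨φ, W, hxs, hk, h1, h2, h3⟩ := hS x hxS
  refine ⟨{x | ¬ (x ∈ S → x ∉ N → tanSpace S x ≤ V x)} ∩ φ.source,
    inter_mem_nhdsWithin _ (φ.open_source.mem_nhds hxs), ?_⟩
  let b := Module.finBasis ℝ W
  have hae : ∀ᵐ y : W ∂(μH[k] : Measure W), ∀ i, (y : EuclideanSpace ℝ (Fin n)) ∈ φ.target →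
      φ.symm y ∉ N → fderiv ℝ φ.symm y (b i : EuclideanSpace ℝ (Fin n)) ∈ V (φ.symm y) := by
    rw [← hk]
    exact ae_all_iff.2 fun i => h.ae_chart hV hN h2 W (b i) _
  let A : Set W := {y | (y : EuclideanSpace ℝ (Fin n)) ∈ φ.target ∧
    ¬ ∀ i, (y : EuclideanSpace ℝ (Fin n)) ∈ φ.target →
      φ.symm y ∉ N → fderiv ℝ φ.symm y (b i : EuclideanSpace ℝ (Fin n)) ∈ V (φ.symm y)}
  have hA : (μH[k] : Measure W) A = 0 := measure_mono_null (fun y hy => hy.2) (ae_iff.1 hae)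
  refine measure_mono_null ?_
    (hausdorffMeasure_chart_symm_image_eq_zero h2 W (Nat.cast_nonneg k) hA fun y hy => hy.1)
  rintro z ⟨hz, hzs⟩
  simp only [mem_ofPred_eq, not_forall] at hz
  obtain ⟨hzS, hzN, hz⟩ := hz
  have hzW : φ z ∈ W := (h3 z hzs).1 hzS
  refine ⟨⟨φ z, hzW⟩, ⟨φ.map_source hzs, fun hall => hz ?_⟩, φ.left_inv hzs⟩
  rw [(hS.tanSpace_eq hk h1 h2 h3 hzs hzS).1]
  intro v hv
  have hle : W.map (fderiv ℝ φ.symm (φ z) : EuclideanSpace ℝ (Fin n) →ₗ[ℝ] EuclideanSpace ℝ (Fin n))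
      ≤ V z := by
    have hspan : W = Submodule.span ℝ (range fun i => (b i : EuclideanSpace ℝ (Fin n))) := by
      have := congrArg (Submodule.map W.subtype) b.span_eq
      rw [Submodule.map_span, ← range_comp, Submodule.map_top, Submodule.range_subtype] at this
      exact this.symm
    rw [hspan, Submodule.map_span, Submodule.span_le]
    rintro _ ⟨_, ⟨i, rfl⟩, rfl⟩
    have := hall i (φ.map_source hzs)
    simp only [φ.left_inv hzs] at this
    exact this hzN
  rw [← fderiv_chart_symm_apply_fderiv h1 h2 hzs v]
  exact hle ⟨_, hv, rfl⟩

theorem IsRectifiable.ae_exists_mem_surface {k : ℕ} {E : Set (EuclideanSpace ℝ (Fin n))}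
    (hE : IsRectifiable k E) :
    ∃ S : ℕ → Set (EuclideanSpace ℝ (Fin n)), (∀ i, IsC1Surface k (S i)) ∧
      ∀ᵐ x ∂(μH[k] : Measure (EuclideanSpace ℝ (Fin n))), x ∈ E →
        ∃ i, x ∈ S i ∧ approxTan hE x = tanSpace (S i) x := by
  obtain ⟨S, hS, hnull⟩ := hE.2.2
  refine ⟨S, hS, ?_⟩
  have h1 : ∀ᵐ x ∂(μH[k] : Measure (EuclideanSpace ℝ (Fin n))), x ∉ E \ ⋃ i, S i :=
    measure_eq_zero_iff_ae_notMem.1 hnull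
  filter_upwards [h1, ae_all_iff.2 fun i => isTangentBundle_approxTan hE _ (hS i)] with x hx1 hx2 hxE
  have h : ∃ i, x ∈ S i := by
    by_contra hcon
    exact hx1 ⟨hxE, by simpa using hcon⟩
  obtain ⟨i, hi⟩ := h
  exact ⟨i, hi, hx2 i hxE hi⟩

theorem IsRectifiable.ae_finrank_approxTan {k : ℕ} {E : Set (EuclideanSpace ℝ (Fin n))}
    (hE : IsRectifiable k E) :
    ∀ᵐ x ∂(μH[k] : Measure (EuclideanSpace ℝ (Fin n))), x ∈ E →
      Module.finrank ℝ (approxTan hE x) = k := by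
  obtain ⟨S, hS, h⟩ := hE.ae_exists_mem_surface
  filter_upwards [h] with x hx hxE
  obtain ⟨i, hi, hi2⟩ := hx hxE
  rw [hi2, (hS i).finrank_tanSpace hi]

theorem ContainsCurveTangents.ae_approxTan_le (h : ContainsCurveTangents N V)
    (hV : IsBorelBundle V) (hN : MeasurableSet N) {k : ℕ} {E : Set (EuclideanSpace ℝ (Fin n))}
    (hE : IsRectifiable k E) :
    ∀ᵐ x ∂(μH[k] : Measure (EuclideanSpace ℝ (Fin n))), x ∈ E → x ∉ N → approxTan hE x ≤ V x := by
  obtain ⟨S, hS, hES⟩ := hE.ae_exists_mem_surface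
  filter_upwards [hES, ae_all_iff.2 fun i => h.ae_tanSpace_le hV hN (hS i)] with x hx1 hx2 hxE hxN
  obtain ⟨i, hi, hi2⟩ := hx1 hxE
  rw [hi2]
  exact hx2 i hi hxN

/-- The only use made of absolute continuity: almost every member of the family ignores a given
`μ`-null set. -/
theorem IsDecompFamily.ae_ae_notMem {μ : Measure (EuclideanSpace ℝ (Fin n))}
    {F : unitInterval → Set (EuclideanSpace ℝ (Fin n))} (hF : IsDecompFamily μ F)
    (hμN : μ N = 0) :
    ∀ᵐ t : unitInterval, ∀ᵐ x ∂(μH[1] : Measure (EuclideanSpace ℝ (Fin n))).restrict (F t),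
      x ∉ N := by
  have h0 := hF.ac hμN
  have h1 : ∀ᵐ t : unitInterval, (μH[1] : Measure (EuclideanSpace ℝ (Fin n))).restrict (F t) N = 0 :=
    Measure.ae_ae_of_ae_bind hF.meas.aemeasurable (measure_eq_zero_iff_ae_notMem.1 h0) |>.mono
      fun t ht => measure_eq_zero_iff_ae_notMem.2 ht
  filter_upwards [h1] with t ht
  exact measure_eq_zero_iff_ae_notMem.1 ht

/-- A Borel bundle which contains, off a `μ`-null set, almost every tangent vector of every curve
belongs to `𝒢_μ`. -/
theorem ContainsCurveTangents.mem_compatibleBundles (h : ContainsCurveTangents N V)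
    (hV : IsBorelBundle V) (hN : MeasurableSet N) {μ : Measure (EuclideanSpace ℝ (Fin n))}
    (hμN : μ N = 0) : V ∈ compatibleBundles μ := by
  refine ⟨hV, fun F hF => ?_⟩
  filter_upwards [hF.ae_ae_notMem hμN] with t ht
  have h1 := h.ae_approxTan_le hV hN (hF.rect t)
  rw [Nat.cast_one] at h1
  filter_upwards [ht, ae_restrict_of_ae h1, ae_restrict_mem (hF.rect t).1] with x hx1 hx2 hx3
  exact hx2 hx3 hx1

end CurveTangents

/-! ### Rainwater's lemma. -/

/-- A positive functional on the continuous functions on a compact space is the integral with respect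
to a finite measure. -/
theorem exists_measure_integral_eq_of_nonneg {K : Type*} [TopologicalSpace K] [CompactSpace K]
    [T2Space K] [MeasurableSpace K] [BorelSpace K] (Λ : C(K, ℝ) →ₗ[ℝ] ℝ)
    (hΛ : ∀ h : C(K, ℝ), 0 ≤ h → 0 ≤ Λ h) :
    ∃ P : Measure K, IsFiniteMeasure P ∧ ∀ h : C(K, ℝ), ∫ g, h g ∂P = Λ h := by
  let Λ₀ : CompactlySupportedContinuousMap K ℝ →ₗ[ℝ] ℝ :=
    { toFun := fun f => Λ f
      map_add' := fun f g => Λ.map_add f g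
      map_smul' := fun c f => Λ.map_smul c f }
  let Λ' : CompactlySupportedContinuousMap K ℝ →ₚ[ℝ] ℝ :=
    PositiveLinearMap.mk₀ Λ₀ fun f hf => hΛ f hf
  refine ⟨RealRMK.rieszMeasure Λ', inferInstance, fun h => ?_⟩
  exact RealRMK.integral_rieszMeasure Λ' (CompactlySupportedContinuousMap.continuousMapEquiv h)

/-- Two mutually singular finite measures on a metric space are separated by continuous functions. -/
theorem MeasureTheory.Measure.MutuallySingular.exists_continuous {X : Type*} [MetricSpace X] [MeasurableSpace X]
    [BorelSpace X] {σ μ : Measure X} [IsFiniteMeasure σ] [IsFiniteMeasure μ] (h : σ ⟂ₘ μ)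
    {η : ℝ} (hη : 0 < η) :
    ∃ (f : X → ℝ) (U : Set X), Continuous f ∧ (∀ x, f x ∈ Icc (0 : ℝ) 1) ∧ MeasurableSet U ∧
      (∀ x ∉ U, f x = 0) ∧ σ U < ENNReal.ofReal η ∧ ∫ x, (1 - f x) ∂μ < η := by
  obtain ⟨s, hs, h1, h2⟩ := h
  -- `s` is `σ`-null and carries `μ`. The function will be `1` on a closed `C ⊆ s` holding most of
  -- `μ`, and `0` off an open `U ⊇ C` with small `σ`-measure.
  obtain ⟨C, hCs, hC, hCμ⟩ := hs.exists_isClosed_sdiff_lt (μ := μ) (measure_ne_top _ _)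
    (ε := ENNReal.ofReal (η / 2)) (by simpa using hη)
  obtain ⟨U, hCU, hU, hUσ⟩ := C.exists_isOpen_lt_of_lt (μ := σ) (ENNReal.ofReal η) (by
    rw [measure_mono_null hCs h1]; simpa using hη)
  obtain ⟨f, hf0, hf1, hf⟩ := exists_continuous_zero_one_of_isClosed (s := Uᶜ) (t := C)
    hU.isClosed_compl hC (disjoint_compl_left_iff_subset.2 hCU)
  refine ⟨f, U, f.continuous, hf, hU.measurableSet, fun x hx => hf0 hx, hUσ, ?_⟩
  have hCc : μ.real Cᶜ ≤ η / 2 := by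
    refine ENNReal.toReal_le_of_le_ofReal (by positivity) ?_
    calc μ Cᶜ ≤ μ (s \ C ∪ sᶜ) := measure_mono fun x hx => by
          by_cases hxs : x ∈ s
          · exact Or.inl ⟨hxs, hx⟩
          · exact Or.inr hxs
      _ ≤ μ (s \ C) + μ sᶜ := measure_union_le _ _
      _ ≤ _ := by rw [h2, add_zero]; exact hCμ.le
  calc ∫ x, (1 - f x) ∂μ ≤ ∫ x, Cᶜ.indicator 1 x ∂μ := by
        refine integral_mono_of_nonneg (Eventually.of_forall fun x => by
          simpa using (hf x).2) ((integrable_const (1 : ℝ)).indicator hC.measurableSet.compl)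
          (Eventually.of_forall fun x => ?_)
        by_cases hx : x ∈ C
        · simp [hx, hf1 hx]
        · simpa [hx] using (hf x).1
    _ = μ.real Cᶜ := integral_indicator_one hC.measurableSet.compl
    _ < η := by linarith

section Rainwater

variable {K X : Type*} [TopologicalSpace K] [CompactSpace K] [T2Space K] [MeasurableSpace K]
  [BorelSpace K] [MetricSpace X] [MeasurableSpace X] [BorelSpace X]
  {κ : K → Measure X} [∀ g, IsProbabilityMeasure (κ g)] {μ : Measure X} [IsFiniteMeasure μ]

theorem integrable_of_continuous_of_mem_Icc (ν : Measure X) [IsFiniteMeasure ν] {f : X → ℝ}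
    (hf : Continuous f) (hf1 : ∀ x, f x ∈ Icc (0 : ℝ) 1) : Integrable f ν :=
  Integrable.of_bound hf.measurable.aestronglyMeasurable 1
    (Eventually.of_forall fun x => by
      rw [Real.norm_of_nonneg (hf1 x).1]; exact (hf1 x).2)

/-- The minimax argument of Rainwater's lemma. -/
theorem exists_continuous_forall_integral_lt (hκm : Measurable κ)
    (hκ : ∀ f : X → ℝ, Continuous f → (∀ x, f x ∈ Icc (0 : ℝ) 1) →
      Continuous fun g => ∫ x, f x ∂κ g)
    (h : ∀ P : Measure K, IsFiniteMeasure P → P.bind κ ⟂ₘ μ) {ε : ℝ} (hε : 0 < ε) :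
    ∃ f : X → ℝ, Continuous f ∧ (∀ x, f x ∈ Icc (0 : ℝ) 1) ∧
      ∀ g, ∫ x, f x ∂κ g + ∫ x, (1 - f x) ∂μ < ε := by
  by_contra! hcon
  -- If no `f` works, the open convex set `A` is disjoint from the convex set `B` of all candidates.
  -- A separating functional is a measure `P`, and `f` adapted to the single average `P.bind κ`
  -- contradicts the separation.
  let A : Set C(K, ℝ) := {φ | ∀ g, φ g < ε}
  let B : Set C(K, ℝ) := {φ | ∃ f : X → ℝ, Continuous f ∧ (∀ x, f x ∈ Icc (0 : ℝ) 1) ∧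
      ∀ g, φ g = ∫ x, f x ∂κ g + ∫ x, (1 - f x) ∂μ}
  have hint : ∀ (ν : Measure X) [IsFiniteMeasure ν] (f : X → ℝ), Continuous f →
      (∀ x, f x ∈ Icc (0 : ℝ) 1) → Integrable f ν := fun ν _ f hf hf1 =>
    integrable_of_continuous_of_mem_Icc ν hf hf1
  have hmkB : ∀ f : X → ℝ, Continuous f → (∀ x, f x ∈ Icc (0 : ℝ) 1) →
      ∃ φ ∈ B, ∀ g, φ g = ∫ x, f x ∂κ g + ∫ x, (1 - f x) ∂μ := fun f hf hf1 =>
    ⟨⟨fun g => ∫ x, f x ∂κ g + ∫ x, (1 - f x) ∂μ, (hκ f hf hf1).add continuous_const⟩,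
      ⟨f, hf, hf1, fun g => rfl⟩, fun g => rfl⟩
  have hAconv : Convex ℝ A := by
    intro φ hφ ψ hψ a b ha hb hab g
    exact (convex_Iio ε) (hφ g) (hψ g) ha hb hab
  have hAopen : IsOpen A := by
    have := ContinuousMap.isOpen_setOfPred_mapsTo (X := K) (Y := ℝ) isCompact_univ (isOpen_Iio (a := ε))
    convert this using 1
    ext φ
    simp [A, MapsTo]
  have hBconv : Convex ℝ B := by
    rintro φ ⟨f, hf, hf1, hφ⟩ ψ ⟨f', hf', hf1', hψ⟩ a b ha hb hab
    refine ⟨fun x => a * f x + b * f' x, (hf.const_mul a).add (hf'.const_mul b),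
      fun x => convex_Icc (0 : ℝ) 1 (hf1 x) (hf1' x) ha hb hab, fun g => ?_⟩
    have e1 := hint (κ g) f hf hf1
    have e2 := hint (κ g) f' hf' hf1'
    have e3 : Integrable (fun x => 1 - f x) μ := (integrable_const 1).sub (hint μ f hf hf1)
    have e4 : Integrable (fun x => 1 - f' x) μ := (integrable_const 1).sub (hint μ f' hf' hf1')
    have e5 : ∫ x, (1 - (a * f x + b * f' x)) ∂μ =
        a * ∫ x, (1 - f x) ∂μ + b * ∫ x, (1 - f' x) ∂μ := by
      rw [← integral_const_mul, ← integral_const_mul, ← integral_add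
        (e3.const_mul a) (e4.const_mul b)]
      congr 1
      funext x
      linear_combination (-1 : ℝ) * hab
    rw [e5, integral_add (e1.const_mul a) (e2.const_mul b), integral_const_mul, integral_const_mul]
    change a * φ g + b * ψ g = _
    rw [hφ, hψ]
    ring
  have hdisj : Disjoint A B := by
    rw [Set.disjoint_left]
    rintro φ hφ ⟨f, hf, hf1, hφf⟩
    obtain ⟨g, hg⟩ := hcon f hf hf1
    exact absurd (hφ g) (by rw [hφf]; exact not_lt.2 hg)
  obtain ⟨Λ, u, hΛA, hΛB⟩ := geometric_hahn_banach_open hAconv hAopen hBconv hdisj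
  -- `A` contains `-cφ` for every `c ≥ 0` and `φ ≥ 0`; a negative value of `Λ φ` would make `Λ`
  -- unbounded above on `A`.
  have hpos : ∀ φ : C(K, ℝ), 0 ≤ φ → 0 ≤ Λ φ := by
    intro φ hφ
    by_contra! hneg
    have hu : ∀ c : ℝ, 0 ≤ c → -(c * Λ φ) < u := by
      intro c hc
      have := hΛA (-(c • φ)) (fun g => by
        have h1 : 0 ≤ φ g := hφ g
        have : (-(c • φ)) g = -(c * φ g) := rfl
        rw [this]
        nlinarith [mul_nonneg hc h1])
      simpa using this
    have h0 := hu 0 le_rfl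
    simp only [zero_mul, neg_zero] at h0
    have h1 := hu (u / (-Λ φ)) (div_nonneg h0.le (by linarith))
    rw [div_mul_eq_mul_div, div_neg, neg_neg, mul_div_assoc, div_self hneg.ne, mul_one] at h1
    exact lt_irrefl _ h1
  obtain ⟨P, hP, hPΛ⟩ := exists_measure_integral_eq_of_nonneg (Λ : C(K, ℝ) →ₗ[ℝ] ℝ) hpos
  have hPΛ : ∀ φ : C(K, ℝ), ∫ g, φ g ∂P = Λ φ := hPΛ
  set p := P.real univ with hp
  have hΛc : ∀ c : ℝ, Λ (ContinuousMap.const K c) = p * c := by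
    intro c
    rw [← hPΛ]
    simp [hp]
  -- Constants below `ε` belong to `A`, and `Λ` of a constant is `p` times it.
  have hpε : p * ε ≤ u := by
    have h1 : ∀ c < ε, p * c < u := fun c hc => by
      rw [← hΛc]
      exact hΛA _ fun g => hc
    refine le_of_forall_pos_lt_add fun δ hδ => ?_
    have hp0 : 0 ≤ p := measureReal_nonneg
    have h2 := h1 (ε - δ / (p + 1)) (by linarith [div_pos hδ (show 0 < p + 1 by linarith)])
    have h3 : p * (δ / (p + 1)) ≤ δ := by
      rw [← mul_div_assoc, div_le_iff₀ (by linarith)]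
      nlinarith
    linarith [mul_sub p ε (δ / (p + 1))]
  have hu : 0 < u := by
    have := hΛA 0 (fun g => hε)
    simpa using this
  have hp0 : 0 < p := by
    refine lt_of_le_of_ne measureReal_nonneg fun h0 => ?_
    obtain ⟨φ, hφB, -⟩ := hmkB (fun _ => 0) continuous_const (fun _ => ⟨le_rfl, zero_le_one⟩)
    have hP0 : P = 0 := by
      rw [← Measure.measure_univ_eq_zero, ← measureReal_eq_zero_iff]
      exact h0.symm
    have := hΛB φ hφB
    rw [← hPΛ, hP0, integral_zero_measure] at this
    linarith
  have hfin : IsFiniteMeasure (P.bind κ) := by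
    constructor
    rw [Measure.bind_apply .univ hκm.aemeasurable]
    simp
  -- With this `η`, the integral of the candidate against `P` is at most `η + pη = pε/2`, below the
  -- bound `u ≥ pε` that holds on `B`.
  obtain ⟨f, U, hf, hf1, hU, hfU, hUσ, hfμ⟩ := (h P hP).exists_continuous
    (η := p * ε / (2 * (p + 1))) (by positivity)
  obtain ⟨φ, hφB, hφ⟩ := hmkB f hf hf1
  have hle := hΛB φ hφB
  rw [← hPΛ] at hle
  have hφint : Integrable φ P := by
    obtain ⟨C, hC⟩ := (isCompact_range φ.continuous).isBounded.exists_norm_le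
    exact Integrable.of_bound φ.continuous.measurable.aestronglyMeasurable C
      (Eventually.of_forall fun g => hC _ ⟨g, rfl⟩)
  rw [Measure.bind_apply hU hκm.aemeasurable] at hUσ
  have hUm : Measurable fun g => κ g U := (Measure.measurable_coe hU).comp hκm
  have hUint : Integrable (fun g => (κ g).real U) P :=
    integrable_toReal_of_lintegral_ne_top hUm.aemeasurable (hUσ.trans ENNReal.ofReal_lt_top).ne
  have hφle : ∀ g, φ g ≤ (κ g).real U + p * ε / (2 * (p + 1)) := by
    intro g
    rw [hφ]
    refine add_le_add ?_ hfμ.le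
    rw [← integral_indicator_one hU]
    refine integral_mono (hint _ f hf hf1) ((integrable_const (1 : ℝ)).indicator hU) fun x => ?_
    by_cases hx : x ∈ U
    · simpa [hx] using (hf1 x).2
    · simp [hx, hfU x hx]
  have h1 : ∫ g, φ g ∂P ≤ ∫ g, (κ g).real U ∂P + p * (p * ε / (2 * (p + 1))) := by
    calc ∫ g, φ g ∂P ≤ ∫ g, ((κ g).real U + p * ε / (2 * (p + 1))) ∂P :=
          integral_mono hφint (hUint.add (integrable_const _)) hφle
      _ = _ := by
          rw [integral_add hUint (integrable_const _), integral_const, smul_eq_mul]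
  have h2 : ∫ g, (κ g).real U ∂P < p * ε / (2 * (p + 1)) := by
    have : ∫ g, (κ g).real U ∂P = (∫⁻ g, κ g U ∂P).toReal :=
      integral_toReal hUm.aemeasurable (Eventually.of_forall fun g => measure_lt_top _ _)
    rw [this]
    exact ENNReal.toReal_lt_of_lt_ofReal hUσ
  have h3 : p * ε / (2 * (p + 1)) + p * (p * ε / (2 * (p + 1))) = p * ε / 2 := by
    field_simp
    ring
  have h4 : 0 < p * ε := by positivity
  linarith

/-- **Rainwater's lemma**: if a finite measure `μ` is singular with respect to all averages of a
compact family of probability measures, then it is carried by a single Borel set which is null for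
all members of the family. -/
theorem exists_measurableSet_forall_eq_zero_of_mutuallySingular (hκm : Measurable κ)
    (hκ : ∀ f : X → ℝ, Continuous f → (∀ x, f x ∈ Icc (0 : ℝ) 1) →
      Continuous fun g => ∫ x, f x ∂κ g)
    (h : ∀ P : Measure K, IsFiniteMeasure P → P.bind κ ⟂ₘ μ) :
    ∃ E, MeasurableSet E ∧ μ Eᶜ = 0 ∧ ∀ g, κ g E = 0 := by
  -- A point `g₀` of `K` is needed below to read off the bound on `∫ (1 - f j) dμ`.
  rcases isEmpty_or_nonempty K with hK | ⟨⟨g₀⟩⟩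
  · exact ⟨univ, .univ, by simp, fun g => hK.elim g⟩
  choose f hf hf1 hfε using fun j : ℕ =>
    exists_continuous_forall_integral_lt hκm hκ h (ε := (1 / 2) ^ j) (by positivity)
  have hsum : ∀ (ν : Measure X) [IsFiniteMeasure ν] (u : ℕ → X → ℝ), (∀ j, Continuous (u j)) →
      (∀ j x, u j x ∈ Icc (0 : ℝ) 1) → (∀ j, ∫ x, u j x ∂ν ≤ (1 / 2) ^ j) →
      ∀ᵐ x ∂ν, Tendsto (fun j => u j x) atTop (𝓝 0) := by
    intro ν _ u hu hu1 hui
    have hlin : ∫⁻ x, ∑' j, ENNReal.ofReal (u j x) ∂ν ≠ ∞ := by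
      rw [lintegral_tsum fun j => (hu j).measurable.ennreal_ofReal.aemeasurable]
      have hle : ∀ j, ∫⁻ x, ENNReal.ofReal (u j x) ∂ν ≤ ENNReal.ofReal ((1 / 2) ^ j) := by
        intro j
        rw [← ofReal_integral_eq_lintegral_ofReal
          (integrable_of_continuous_of_mem_Icc ν (hu j) (hu1 j))
          (Eventually.of_forall fun x => (hu1 j x).1)]
        exact ENNReal.ofReal_le_ofReal (hui j)
      refine ne_top_of_le_ne_top ?_ (ENNReal.tsum_le_tsum hle)
      rw [← ENNReal.ofReal_tsum_of_nonneg (fun j => by positivity) summable_geometric_two]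
      exact ENNReal.ofReal_ne_top
    have hae := ae_lt_top (Measurable.tsum fun j =>
      (hu j).measurable.ennreal_ofReal) hlin
    filter_upwards [hae] with x hx
    have h1 := ENNReal.tendsto_atTop_zero_of_tsum_ne_top hx.ne
    have h2 := (ENNReal.tendsto_toReal ENNReal.zero_ne_top).comp h1
    refine h2.congr fun j => ?_
    simp [ENNReal.toReal_ofReal (hu1 j x).1]
  have hnn1 : ∀ j, 0 ≤ ∫ x, (1 - f j x) ∂μ := fun j =>
    integral_nonneg fun x => sub_nonneg.2 (hf1 j x).2
  have hnn2 : ∀ j g, 0 ≤ ∫ x, f j x ∂κ g := fun j g => integral_nonneg fun x => (hf1 j x).1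
  -- The errors `2⁻ʲ` are summable, so `f j → 1` almost everywhere for `μ` and `f j → 0` almost
  -- everywhere for each `κ g`.
  refine ⟨{x | Tendsto (fun j => f j x) atTop (𝓝 1)},
    measurableSet_tendsto _ fun j => (hf j).measurable, ?_, fun g => ?_⟩
  · have := hsum μ (fun j x => 1 - f j x) (fun j => continuous_const.sub (hf j))
      (fun j x => ⟨sub_nonneg.2 (hf1 j x).2, by linarith [(hf1 j x).1]⟩)
      (fun j => by linarith [hfε j g₀, hnn2 j g₀])
    filter_upwards [this] with x hx
    have := hx.const_sub 1
    simpa using this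
  · rw [measure_eq_zero_iff_ae_notMem]
    filter_upwards [hsum (κ g) f hf hf1 (fun j => by linarith [hfε j g, hnn1 j])] with x hx hx1
    exact zero_ne_one (tendsto_nhds_unique hx hx1)

end Rainwater

/-! ### Whitney's extension theorem on the line. -/

section Whitney

variable {E : Type*} [NormedAddCommGroup E] [NormedSpace ℝ E]

/-- The difference at `t` of the first order jets at `b` and at `a`. -/
def jetDiff (f g : ℝ → E) (a b t : ℝ) : E := f b + (t - b) • g b - f a - (t - a) • g a

/-- The interpolation of the first order jets of `f` (with derivative `g`) at `a` and `b`. -/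
noncomputable def jetInterp (f g : ℝ → E) (a b t : ℝ) : E :=
  f a + (t - a) • g a +
    (3 * ((t - a) / (b - a)) ^ 2 - 2 * ((t - a) / (b - a)) ^ 3) • jetDiff f g a b t

/-- The derivative of the interpolation `jetInterp`. -/
noncomputable def jetInterpDeriv (f g : ℝ → E) (a b t : ℝ) : E :=
  g a + (3 * ((t - a) / (b - a)) ^ 2 - 2 * ((t - a) / (b - a)) ^ 3) • (g b - g a) +
    (6 * ((t - a) / (b - a)) * (1 - (t - a) / (b - a)) / (b - a)) • jetDiff f g a b t

theorem hasDerivAt_jetInterp (f g : ℝ → E) (a b t : ℝ) :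
    HasDerivAt (jetInterp f g a b) (jetInterpDeriv f g a b t) t := by
  have h0 : ∀ c : ℝ, HasDerivAt (fun t : ℝ => t - c) 1 t := fun c => (hasDerivAt_id t).sub_const c
  have h1 : HasDerivAt (fun t : ℝ => (t - a) / (b - a)) (1 / (b - a)) t := (h0 a).div_const _
  have h2 := ((h1.pow 2).const_mul 3).sub ((h1.pow 3).const_mul 2)
  have h3 : HasDerivAt (jetDiff f g a b) (g b - g a) t := by
    have := ((((h0 b).smul_const (g b)).const_add (f b)).sub_const (f a)).sub
      ((h0 a).smul_const (g a))
    rw [one_smul, one_smul] at this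
    exact this
  have h4 := (((h0 a).smul_const (g a)).const_add (f a)).add (h2.smul h3)
  refine h4.congr_deriv ?_
  simp only [jetInterpDeriv, one_smul, add_assoc]
  congr 3
  norm_num
  ring

theorem continuous_jetInterpDeriv (f g : ℝ → E) (a b : ℝ) :
    Continuous (jetInterpDeriv f g a b) := by
  unfold jetInterpDeriv jetDiff
  fun_prop

/-- The cubic `θ(τ) = 3τ² - 2τ³` satisfies `θ(1 - τ) = 1 - θ(τ)`. Estimates relative to the left
endpoint of a gap therefore hold relative to the right one. -/
theorem jetInterp_symm (f g : ℝ → E) {a b : ℝ} (hab : a ≠ b) (t : ℝ) :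
    jetInterp f g a b t = jetInterp f g b a t ∧
      jetInterpDeriv f g a b t = jetInterpDeriv f g b a t := by
  have h1 : (t - b) / (a - b) = 1 - (t - a) / (b - a) := by
    have : a - b ≠ 0 := sub_ne_zero.2 hab
    have : b - a ≠ 0 := sub_ne_zero.2 hab.symm
    field_simp
    ring
  have h2 : jetDiff f g b a t = - jetDiff f g a b t := by
    simp only [jetDiff]; abel
  have h3 : f b + (t - b) • g b = f a + (t - a) • g a + jetDiff f g a b t := by
    simp only [jetDiff]; abel
  constructor
  · rw [jetInterp, jetInterp, h1, h2, h3]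
    module
  · rw [jetInterpDeriv, jetInterpDeriv, h1, h2, ← neg_sub b a, ← neg_sub (g b) (g a)]
    have : g b = g a + (g b - g a) := by abel
    rw [this, add_sub_cancel_left, div_neg]
    module

/-- Since `θ(τ) ≤ 3τ²` and `θ'(τ) ≤ 6τ`, both errors carry a factor `τ = (t - a)/(b - a)`. In a long
gap `κ` is merely bounded, and it is this factor that makes the errors small near `a`. -/
theorem norm_jetInterp_sub_le (f g : ℝ → E) {a b t κ : ℝ} (hab : a ≠ b)
    (h0 : 0 ≤ (t - a) / (b - a)) (h1 : (t - a) / (b - a) ≤ 1)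
    (hA : ‖f b - f a - (b - a) • g a‖ ≤ κ * |b - a|) (hB : ‖g b - g a‖ ≤ κ) :
    ‖jetInterp f g a b t - f a - (t - a) • g a‖ ≤ 6 * ((t - a) / (b - a) * κ) * |t - a| ∧
      ‖jetInterpDeriv f g a b t - g a‖ ≤ 15 * ((t - a) / (b - a) * κ) := by
  set τ := (t - a) / (b - a) with hτ
  have hba : b - a ≠ 0 := sub_ne_zero.2 hab.symm
  have hκ : 0 ≤ κ := (norm_nonneg _).trans hB
  have hpos : 0 < |b - a| := abs_pos.2 hba
  have hta : |t - a| = τ * |b - a| := by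
    rw [← abs_of_nonneg h0, hτ, abs_div, div_mul_cancel₀ _ hpos.ne']
  have htb : |t - b| ≤ |b - a| := by
    have : t - b = -((1 - τ) * (b - a)) := by
      rw [hτ, sub_mul, div_mul_cancel₀ _ hba]; ring
    rw [this, abs_neg, abs_mul, abs_of_nonneg (sub_nonneg.2 h1)]
    nlinarith
  have hD : ‖jetDiff f g a b t‖ ≤ 2 * κ * |b - a| := by
    have : jetDiff f g a b t = (f b - f a - (b - a) • g a) + (t - b) • (g b - g a) := by
      simp only [jetDiff]; module
    rw [this]
    refine (norm_add_le _ _).trans ?_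
    rw [norm_smul, Real.norm_eq_abs]
    have := mul_le_mul htb hB (norm_nonneg _) (abs_nonneg _)
    linarith
  have hθ0 : 0 ≤ 3 * τ ^ 2 - 2 * τ ^ 3 := by
    have : 3 * τ ^ 2 - 2 * τ ^ 3 = τ ^ 2 * (1 + 2 * (1 - τ)) := by ring
    rw [this]
    have := sub_nonneg.2 h1
    positivity
  have hτ2 : τ ^ 2 ≤ τ := by nlinarith
  have hθ1 : 3 * τ ^ 2 - 2 * τ ^ 3 ≤ 3 * τ ^ 2 := by
    have : 0 ≤ τ ^ 3 := by positivity
    linarith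
  constructor
  · have : jetInterp f g a b t - f a - (t - a) • g a =
        (3 * τ ^ 2 - 2 * τ ^ 3) • jetDiff f g a b t := by
      rw [jetInterp]; abel
    rw [this, norm_smul, Real.norm_of_nonneg hθ0, hta]
    calc (3 * τ ^ 2 - 2 * τ ^ 3) * ‖jetDiff f g a b t‖ ≤ 3 * τ ^ 2 * (2 * κ * |b - a|) :=
          mul_le_mul hθ1 hD (norm_nonneg _) (by positivity)
      _ = _ := by ring
  · have : jetInterpDeriv f g a b t - g a =
        (3 * τ ^ 2 - 2 * τ ^ 3) • (g b - g a) +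
          (6 * τ * (1 - τ) / (b - a)) • jetDiff f g a b t := by
      rw [jetInterpDeriv]; abel
    rw [this]
    refine (norm_add_le _ _).trans ?_
    rw [norm_smul, norm_smul, Real.norm_of_nonneg hθ0, norm_div, Real.norm_eq_abs (b - a),
      Real.norm_of_nonneg (by have := sub_nonneg.2 h1; positivity)]
    have e1 : (3 * τ ^ 2 - 2 * τ ^ 3) * ‖g b - g a‖ ≤ 3 * τ * κ :=
      mul_le_mul (by linarith) hB (norm_nonneg _) (by positivity)
    have e2 : 6 * τ * (1 - τ) / |b - a| * ‖jetDiff f g a b t‖ ≤ 12 * τ * κ := by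
      calc 6 * τ * (1 - τ) / |b - a| * ‖jetDiff f g a b t‖
          ≤ 6 * τ / |b - a| * (2 * κ * |b - a|) := by
            refine mul_le_mul (div_le_div_of_nonneg_right ?_ (abs_nonneg _)) hD (norm_nonneg _)
              (by positivity)
            exact mul_le_of_le_one_right (by positivity) (by linarith)
        _ = 12 * τ * κ := by field_simp; ring
    linarith

/-- A first order jet on `C` satisfies the hypotheses of Whitney's extension theorem, uniformly. -/
structure IsWhitneyJet (f g : ℝ → E) (C : Set ℝ) : Prop where
  taylor : ∀ η > 0, ∃ ρ > 0, ∀ c ∈ C, ∀ c' ∈ C, |c' - c| ≤ ρ →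
    ‖f c' - f c - (c' - c) • g c‖ ≤ η * |c' - c|
  bound : ∃ M : ℝ, ∀ c ∈ C, ‖g c‖ ≤ M ∧ ∀ c' ∈ C, ‖f c' - f c‖ ≤ M * |c' - c|

variable {f g : ℝ → E} {C : Set ℝ}

/-- Uniform continuity of `g` comes for free: adding the Taylor expansions from `c` to `c'` and back
leaves `(c' - c) • (g c' - g c)`. -/
theorem IsWhitneyJet.norm_sub_le (h : IsWhitneyJet f g C) {η : ℝ} (hη : 0 < η) :
    ∃ ρ > 0, ∀ c ∈ C, ∀ c' ∈ C, |c' - c| ≤ ρ →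
      ‖f c' - f c - (c' - c) • g c‖ ≤ η * |c' - c| ∧ ‖g c' - g c‖ ≤ η := by
  obtain ⟨ρ, hρ, H⟩ := h.taylor (η / 2) (by positivity)
  refine ⟨ρ, hρ, fun c hc c' hc' hcc' => ⟨(H c hc c' hc' hcc').trans ?_, ?_⟩⟩
  · gcongr; linarith
  · rcases eq_or_ne c' c with rfl | hne
    · simp [hη.le]
    have hpos : 0 < |c' - c| := abs_pos.2 (sub_ne_zero.2 hne)
    have h1 := H c hc c' hc' hcc'
    have h2 := H c' hc' c hc (by rwa [abs_sub_comm])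
    have h3 : (c' - c) • (g c' - g c) =
        (f c' - f c - (c' - c) • g c) + (f c - f c' - (c - c') • g c') := by module
    have h4 : |c' - c| * ‖g c' - g c‖ ≤ |c' - c| * η := by
      rw [← Real.norm_eq_abs, ← norm_smul, h3, Real.norm_eq_abs]
      refine (norm_add_le _ _).trans ?_
      rw [abs_sub_comm c c'] at h2
      linarith
    exact le_of_mul_le_mul_left h4 hpos

theorem IsWhitneyJet.norm_jetInterp_sub_le (h : IsWhitneyJet f g C) {η : ℝ} (hη : 0 < η) :
    ∃ ρ > 0, ∀ a ∈ C, ∀ b ∈ C, a ≠ b → ∀ t, 0 ≤ (t - a) / (b - a) → (t - a) / (b - a) ≤ 1 →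
      |t - a| ≤ ρ → ‖jetInterp f g a b t - f a - (t - a) • g a‖ ≤ η * |t - a| ∧
        ‖jetInterpDeriv f g a b t - g a‖ ≤ η := by
  obtain ⟨ρ, hρ, H⟩ := h.norm_sub_le (η := η / 15) (by positivity)
  obtain ⟨M, hM⟩ := h.bound
  have key : ∃ ρ' > 0, ∀ a ∈ C, ∀ b ∈ C, a ≠ b → ∀ t, 0 ≤ (t - a) / (b - a) →
      (t - a) / (b - a) ≤ 1 → |t - a| ≤ ρ' → ∃ κ, ‖f b - f a - (b - a) • g a‖ ≤ κ * |b - a| ∧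
        ‖g b - g a‖ ≤ κ ∧ (t - a) / (b - a) * κ ≤ η / 15 := by
    -- In a gap of length at most `ρ`, `κ = η/15` works. In a longer one `κ = 2M`, and `τ ≤ |t -
    -- a|/ρ` forces `2Mτ ≤ η/15`. The number `15` is the constant in the derivative estimate.
    refine ⟨η / 15 * ρ / (2 * |M| + 1), by positivity, fun a ha b hb hab t h0 h1 hta => ?_⟩
    rcases le_or_gt |b - a| ρ with hle | hgt
    · obtain ⟨e1, e2⟩ := H a ha b hb hle
      exact ⟨η / 15, e1, e2, mul_le_of_le_one_left (by positivity) h1⟩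
    · have hM0 : 0 ≤ M := (norm_nonneg _).trans (hM a ha).1
      rw [abs_of_nonneg hM0, le_div_iff₀ (by positivity)] at hta
      have hpos : 0 < |b - a| := hρ.trans hgt
      refine ⟨2 * M, ?_, ?_, ?_⟩
      · refine (_root_.norm_sub_le _ _).trans ?_
        rw [norm_smul, Real.norm_eq_abs]
        nlinarith [(hM a ha).1, (hM a ha).2 b hb]
      · refine (_root_.norm_sub_le _ _).trans ?_
        linarith [(hM a ha).1, (hM b hb).1]
      · rw [← abs_of_nonneg h0, abs_div, div_mul_eq_mul_div, div_le_iff₀ hpos]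
        nlinarith [abs_nonneg (t - a)]
  obtain ⟨ρ', hρ', H'⟩ := key
  refine ⟨ρ', hρ', fun a ha b hb hab t h0 h1 hta => ?_⟩
  obtain ⟨κ, e1, e2, e3⟩ := H' a ha b hb hab t h0 h1 hta
  obtain ⟨h2, h3⟩ := _root_.norm_jetInterp_sub_le f g hab h0 h1 e1 e2
  refine ⟨h2.trans ?_, h3.trans (by linarith)⟩
  gcongr
  linarith

/-- Unboundedness of `C` in both directions makes every gap bounded, with both endpoints in `C`, so
the extension needs no separate treatment of half-lines. -/
theorem exists_gap (hC : IsClosed C) (hup : ¬ BddAbove C) (hdown : ¬ BddBelow C) {t : ℝ}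
    (ht : t ∉ C) : sSup (C ∩ Iic t) ∈ C ∧ sInf (C ∩ Ici t) ∈ C ∧ sSup (C ∩ Iic t) < t ∧
      t < sInf (C ∩ Ici t) ∧ ∀ s ∈ Ioo (sSup (C ∩ Iic t)) (sInf (C ∩ Ici t)), s ∉ C ∧
        sSup (C ∩ Iic s) = sSup (C ∩ Iic t) ∧ sInf (C ∩ Ici s) = sInf (C ∩ Ici t) := by
  have hne1 : (C ∩ Iic t).Nonempty := by
    rw [not_bddBelow_iff] at hdown
    obtain ⟨y, hy, hyt⟩ := hdown t
    exact ⟨y, hy, hyt.le⟩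
  have hne2 : (C ∩ Ici t).Nonempty := by
    rw [not_bddAbove_iff] at hup
    obtain ⟨y, hy, hyt⟩ := hup t
    exact ⟨y, hy, hyt.le⟩
  have hb1 : BddAbove (C ∩ Iic t) := ⟨t, fun y hy => hy.2⟩
  have hb2 : BddBelow (C ∩ Ici t) := ⟨t, fun y hy => hy.2⟩
  obtain ⟨ha, hat⟩ := (hC.inter isClosed_Iic).csSup_mem hne1 hb1
  obtain ⟨hb, hbt⟩ := (hC.inter isClosed_Ici).csInf_mem hne2 hb2
  have hat' : sSup (C ∩ Iic t) < t := lt_of_le_of_ne hat fun h => ht (h ▸ ha)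
  have hbt' : t < sInf (C ∩ Ici t) := lt_of_le_of_ne hbt fun h => ht (h ▸ hb)
  refine ⟨ha, hb, hat', hbt', fun s hs => ?_⟩
  have hgap : ∀ y ∈ C, y ≤ sSup (C ∩ Iic t) ∨ sInf (C ∩ Ici t) ≤ y := by
    intro y hy
    rcases le_total y t with h | h
    · exact Or.inl (le_csSup hb1 ⟨hy, h⟩)
    · exact Or.inr (csInf_le hb2 ⟨hy, h⟩)
  have e1 : C ∩ Iic s = C ∩ Iic t := by
    ext y
    refine and_congr_right fun hy => ?_
    simp only [mem_Iic]
    rcases hgap y hy with h | h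
    · exact ⟨fun _ => h.trans hat, fun _ => h.trans hs.1.le⟩
    · exact ⟨fun h' => absurd (hs.2.trans_le h) (not_lt.2 h'),
        fun h' => absurd (hbt'.trans_le h) (not_lt.2 h')⟩
  have e2 : C ∩ Ici s = C ∩ Ici t := by
    ext y
    refine and_congr_right fun hy => ?_
    simp only [mem_Ici]
    rcases hgap y hy with h | h
    · exact ⟨fun h' => absurd (h.trans_lt hs.1) (not_lt.2 h'),
        fun h' => absurd (h.trans_lt hat') (not_lt.2 h')⟩
    · exact ⟨fun _ => hbt.trans h, fun _ => hs.2.le.trans h⟩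
  refine ⟨fun hsC => ?_, by rw [e1], by rw [e2]⟩
  rcases hgap s hsC with h | h
  · exact absurd hs.1 (not_lt.2 h)
  · exact absurd hs.2 (not_lt.2 h)

open Classical in
/-- **Whitney's extension theorem** for functions of class `C¹` of one variable. -/
theorem IsWhitneyJet.exists_contDiff (h : IsWhitneyJet f g C) (hC : IsClosed C)
    (hup : ¬ BddAbove C) (hdown : ¬ BddBelow C) :
    ∃ Γ : ℝ → E, ContDiff ℝ 1 Γ ∧ ∀ c ∈ C, Γ c = f c ∧ deriv Γ c = g c := by
  let α : ℝ → ℝ := fun t => sSup (C ∩ Iic t)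
  let β : ℝ → ℝ := fun t => sInf (C ∩ Ici t)
  let Γ : ℝ → E := fun t => if t ∈ C then f t else jetInterp f g (α t) (β t) t
  let D : ℝ → E := fun t => if t ∈ C then g t else jetInterpDeriv f g (α t) (β t) t
  have hΓC : ∀ c ∈ C, Γ c = f c := fun c hc => if_pos hc
  have hDC : ∀ c ∈ C, D c = g c := fun c hc => if_pos hc
  -- `p` is the endpoint of the gap on the side of `c`. It lies between `c` and `t`, so errors from
  -- `c` to `p` and from `p` to `t` add up without loss.
  have hsplit : ∀ t, t ∉ C → ∀ c ∈ C, ∃ p ∈ C, ∃ q ∈ C, p ≠ q ∧ 0 ≤ (t - p) / (q - p) ∧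
      (t - p) / (q - p) ≤ 1 ∧ |t - p| + |p - c| = |t - c| ∧ Γ t = jetInterp f g p q t ∧
      D t = jetInterpDeriv f g p q t := by
    intro t ht c hc
    obtain ⟨ha, hb, hat, htb, hgap⟩ := exists_gap hC hup hdown ht
    rcases le_total c t with hct | hct
    · have hca : c ≤ α t := le_csSup ⟨t, fun y hy => hy.2⟩ ⟨hc, hct⟩
      have hab : 0 < β t - α t := sub_pos.2 (hat.trans htb)
      refine ⟨α t, ha, β t, hb, (hat.trans htb).ne, div_nonneg (sub_pos.2 hat).le hab.le, ?_, ?_,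
        if_neg ht, if_neg ht⟩
      · rw [div_le_one hab]; linarith [htb.le]
      · rw [abs_of_pos (sub_pos.2 hat), abs_of_nonneg (sub_nonneg.2 hca),
          abs_of_nonneg (sub_nonneg.2 hct)]; ring
    · have hcb : β t ≤ c := csInf_le ⟨t, fun y hy => hy.2⟩ ⟨hc, hct⟩
      have hab : α t - β t < 0 := sub_neg.2 (hat.trans htb)
      refine ⟨β t, hb, α t, ha, (hat.trans htb).ne', div_nonneg_of_nonpos (sub_neg.2 htb).le hab.le,
        ?_, ?_, (if_neg ht).trans (jetInterp_symm f g (hat.trans htb).ne t).1,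
        (if_neg ht).trans (jetInterp_symm f g (hat.trans htb).ne t).2⟩
      · rw [div_le_one_of_neg hab]; linarith [hat.le]
      · rw [abs_of_neg (sub_neg.2 htb), abs_of_nonpos (sub_nonpos.2 hcb),
          abs_of_nonpos (sub_nonpos.2 hct)]; ring
  -- This gives, at points of `C`, both the derivative of `Γ` and the continuity of that derivative.
  have hnear : ∀ c ∈ C, ∀ η > 0, ∃ ρ > 0, ∀ t, |t - c| ≤ ρ →
      ‖Γ t - Γ c - (t - c) • g c‖ ≤ η * |t - c| ∧ ‖D t - g c‖ ≤ η := by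
    intro c hc η hη
    obtain ⟨ρ₁, hρ₁, H₁⟩ := h.norm_sub_le (η := η / 3) (by positivity)
    obtain ⟨ρ₂, hρ₂, H₂⟩ := h.norm_jetInterp_sub_le (η := η / 3) (by positivity)
    refine ⟨min ρ₁ ρ₂, lt_min hρ₁ hρ₂, fun t ht => ?_⟩
    rw [hΓC c hc]
    by_cases htC : t ∈ C
    · obtain ⟨e1, e2⟩ := H₁ c hc t htC (ht.trans (min_le_left _ _))
      rw [hΓC t htC, hDC t htC]
      exact ⟨e1.trans (by gcongr; linarith), e2.trans (by linarith)⟩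
    · obtain ⟨p, hp, q, hq, hpq, h0, h1, hsum, hΓt, hDt⟩ := hsplit t htC c hc
      obtain ⟨e1, e2⟩ := H₁ c hc p hp
        ((by linarith [abs_nonneg (t - p)] : |p - c| ≤ |t - c|).trans (ht.trans (min_le_left _ _)))
      obtain ⟨e3, e4⟩ := H₂ p hp q hq hpq t h0 h1
        ((by linarith [abs_nonneg (p - c)] : |t - p| ≤ |t - c|).trans (ht.trans (min_le_right _ _)))
      rw [hΓt, hDt]
      constructor
      · have hdec : jetInterp f g p q t - f c - (t - c) • g c =
            (jetInterp f g p q t - f p - (t - p) • g p) + (f p - f c - (p - c) • g c) +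
              (t - p) • (g p - g c) := by module
        have e5 : ‖(t - p) • (g p - g c)‖ ≤ |t - p| * (η / 3) := by
          rw [norm_smul, Real.norm_eq_abs]
          gcongr
        rw [hdec, ← hsum]
        refine (norm_add₃_le).trans ?_
        nlinarith [abs_nonneg (p - c), abs_nonneg (t - p)]
      · have hdec : jetInterpDeriv f g p q t - g c =
            (jetInterpDeriv f g p q t - g p) + (g p - g c) := by abel
        rw [hdec]
        refine (norm_add_le _ _).trans ?_
        linarith
  have hloc : ∀ t, t ∉ C → (Γ =ᶠ[𝓝 t] jetInterp f g (α t) (β t)) ∧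
      (D =ᶠ[𝓝 t] jetInterpDeriv f g (α t) (β t)) := by
    intro t ht
    obtain ⟨ha, hb, hat, htb, hgap⟩ := exists_gap hC hup hdown ht
    have hnhds := Ioo_mem_nhds hat htb
    constructor
    · filter_upwards [hnhds] with s hs
      obtain ⟨h1, h2, h3⟩ := hgap s hs
      change (if s ∈ C then f s else jetInterp f g (sSup (C ∩ Iic s)) (sInf (C ∩ Ici s)) s) = _
      rw [if_neg h1, h2, h3]
    · filter_upwards [hnhds] with s hs
      obtain ⟨h1, h2, h3⟩ := hgap s hs
      change (if s ∈ C then g s else jetInterpDeriv f g (sSup (C ∩ Iic s)) (sInf (C ∩ Ici s)) s) = _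
      rw [if_neg h1, h2, h3]
  have hderiv : ∀ t, HasDerivAt Γ (D t) t := by
    intro t
    by_cases ht : t ∈ C
    · rw [hasDerivAt_iff_isLittleO, Asymptotics.isLittleO_iff]
      intro η hη
      obtain ⟨ρ, hρ, H⟩ := hnear t ht η hη
      filter_upwards [Metric.closedBall_mem_nhds t hρ] with s hs
      rw [hDC t ht]
      exact (H s (by simpa [Real.dist_eq] using hs)).1
    · have := (hasDerivAt_jetInterp f g (α t) (β t) t).congr_of_eventuallyEq (hloc t ht).1
      rwa [(hloc t ht).2.eq_of_nhds]
  have hderiv' : deriv Γ = D := funext fun t => (hderiv t).deriv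
  refine ⟨Γ, contDiff_one_iff_deriv.2 ⟨fun t => (hderiv t).differentiableAt, ?_⟩,
    fun c hc => ⟨hΓC c hc, by rw [hderiv', hDC c hc]⟩⟩
  rw [hderiv', continuous_iff_continuousAt]
  intro t
  by_cases ht : t ∈ C
  · rw [Metric.continuousAt_iff']
    intro η hη
    obtain ⟨ρ, hρ, H⟩ := hnear t ht (η / 2) (by positivity)
    filter_upwards [Metric.closedBall_mem_nhds t hρ] with s hs
    rw [hDC t ht, dist_eq_norm]
    linarith [(H s (by simpa [Real.dist_eq] using hs)).2]
  · exact (continuous_jetInterpDeriv f g (α t) (β t)).continuousAt.congr (hloc t ht).2.symm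

end Whitney

/-! ### Covering Lipschitz curves by surfaces. -/

section LipschitzCurves

variable {n : ℕ}

theorem isC1Surface_empty (k : ℕ) : IsC1Surface k (∅ : Set (EuclideanSpace ℝ (Fin n))) :=
  fun _ hx => hx.elim

/-- Near a point with nonzero derivative, a curve of class `C¹` lies on a one-dimensional surface. -/
theorem exists_isC1Surface_preimage_mem_nhds {Γ : ℝ → EuclideanSpace ℝ (Fin n)}
    (hΓ : ContDiff ℝ 1 Γ) {t₀ : ℝ} (ht₀ : deriv Γ t₀ ≠ 0) :
    ∃ S, IsC1Surface 1 S ∧ Γ ⁻¹' S ∈ 𝓝 t₀ := by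
  set v := deriv Γ t₀ with hv
  let u : EuclideanSpace ℝ (Fin n) →L[ℝ] ℝ := (‖v‖ ^ 2)⁻¹ • innerSL ℝ v
  have huv : u v = 1 := by
    have : ‖v‖ ^ 2 ≠ 0 := by positivity
    simp [u, this]
  -- `G` sends the point `(t - t₀) • v` of the line `ℝv` to `Γ t`, and its derivative at `0` is the
  -- identity. The surface is the image of this line under a local inverse-function chart.
  let G : EuclideanSpace ℝ (Fin n) → EuclideanSpace ℝ (Fin n) := fun x =>
    Γ (t₀ + u x) + (x - u x • v)
  have hG : ContDiff ℝ 1 G := by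
    have hu : ContDiff ℝ 1 u := u.contDiff
    exact (hΓ.comp (contDiff_const.add hu)).add (contDiff_id.sub (hu.smul contDiff_const))
  have hG0 : HasFDerivAt G ((ContinuousLinearEquiv.refl ℝ (EuclideanSpace ℝ (Fin n)) :
      EuclideanSpace ℝ (Fin n) →L[ℝ] EuclideanSpace ℝ (Fin n))) 0 := by
    have h1 : HasFDerivAt (fun x => t₀ + u x) u 0 := u.hasFDerivAt.const_add t₀
    have h2 : HasDerivAt Γ v (t₀ + u 0) := by
      rw [map_zero, add_zero]
      exact (hΓ.differentiable one_ne_zero t₀).hasDerivAt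
    have h3 : HasFDerivAt (fun x => Γ (t₀ + u x)) (u.smulRight v) 0 :=
      (h2.hasFDerivAt.comp (0 : EuclideanSpace ℝ (Fin n)) h1).congr_fderiv (by ext1 x; simp)
    have h4 : HasFDerivAt (fun x => x - u x • v)
        (ContinuousLinearMap.id ℝ (EuclideanSpace ℝ (Fin n)) - u.smulRight v) 0 :=
      (hasFDerivAt_id (𝕜 := ℝ) (0 : EuclideanSpace ℝ (Fin n))).sub (u.hasFDerivAt.smul_const v)
    refine (h3.add h4).congr_fderiv ?_
    ext1 x
    simp
  let Φ := hG.contDiffAt.toOpenPartialHomeomorph G hG0 one_ne_zero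
  -- The chart is shrunk to where the derivative is invertible, so that its inverse is `C¹` on the
  -- whole target.
  let O : Set (EuclideanSpace ℝ (Fin n)) := fderiv ℝ G ⁻¹'
    range ((↑) : (EuclideanSpace ℝ (Fin n) ≃L[ℝ] EuclideanSpace ℝ (Fin n)) → _)
  have hO : IsOpen O := ContinuousLinearEquiv.isOpen.preimage (hG.continuous_fderiv one_ne_zero)
  let Ψ := Φ.restrOpen O hO
  have hΨs : Ψ.source = Φ.source ∩ O := rfl
  have hΨG : ∀ x, Ψ x = G x := fun x => rfl
  have h0 : (0 : EuclideanSpace ℝ (Fin n)) ∈ Ψ.source :=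
    ⟨hG.contDiffAt.mem_toOpenPartialHomeomorph_source hG0 one_ne_zero, _, hG0.fderiv.symm⟩
  let W : Submodule ℝ (EuclideanSpace ℝ (Fin n)) := Submodule.span ℝ {v}
  have hΨsymm : ContDiffOn ℝ 1 Ψ.symm Ψ.target := by
    intro y hy
    obtain ⟨-, e, he⟩ := Ψ.map_target hy
    refine (Ψ.contDiffAt_symm (f₀' := e) hy ?_ hG.contDiffAt).contDiffWithinAt
    rw [he]
    exact (hG.differentiable one_ne_zero _).hasFDerivAt
  refine ⟨Ψ '' (Ψ.source ∩ W), ?_, ?_⟩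
  · rintro _ ⟨x, ⟨hx, hxW⟩, rfl⟩
    refine ⟨Ψ.symm, W, Ψ.map_source hx, finrank_span_singleton ht₀, hΨsymm, ?_, fun y hy => ?_⟩
    · exact (hG.contDiffOn (s := Ψ.source))
    · constructor
      · rintro ⟨z, ⟨hz, hzW⟩, rfl⟩
        rw [Ψ.left_inv hz]; exact hzW
      · intro h
        exact ⟨Ψ.symm y, ⟨Ψ.map_target hy, h⟩, Ψ.right_inv hy⟩
  · have hc : Continuous fun t : ℝ => (t - t₀) • v := by fun_prop
    have := hc.continuousAt.preimage_mem_nhds (x := t₀)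
      (by simpa using Ψ.open_source.mem_nhds h0)
    filter_upwards [this] with t ht
    refine ⟨(t - t₀) • v, ⟨ht, W.smul_mem _ (Submodule.mem_span_singleton_self v)⟩, ?_⟩
    rw [hΨG]
    simp [G, huv]

/-- A curve of class `C¹` is covered, where its derivative does not vanish, by countably many
surfaces. -/
theorem exists_countable_isC1Surface_cover {Γ : ℝ → EuclideanSpace ℝ (Fin n)}
    (hΓ : ContDiff ℝ 1 Γ) : ∃ 𝒮 : Set (Set (EuclideanSpace ℝ (Fin n))), 𝒮.Countable ∧
      (∀ S ∈ 𝒮, IsC1Surface 1 S) ∧ ∀ t, deriv Γ t ≠ 0 → ∃ S ∈ 𝒮, Γ t ∈ S := by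
  have H : ∀ t, ∃ S, IsC1Surface 1 S ∧ (deriv Γ t ≠ 0 → Γ ⁻¹' S ∈ 𝓝 t) := by
    intro t
    by_cases ht : deriv Γ t = 0
    · exact ⟨∅, isC1Surface_empty 1, fun h => absurd ht h⟩
    · obtain ⟨S, h1, h2⟩ := exists_isC1Surface_preimage_mem_nhds hΓ ht
      exact ⟨S, h1, fun _ => h2⟩
  choose S hS hSn using H
  obtain ⟨T, -, hT, hcov⟩ := TopologicalSpace.countable_cover_nhdsWithin
    (s := {t | deriv Γ t ≠ 0}) (f := fun t => Γ ⁻¹' S t)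
    fun t ht => mem_nhdsWithin_of_mem_nhds (hSn t ht)
  refine ⟨S '' T, hT.image S, ?_, fun t ht => ?_⟩
  · rintro _ ⟨t, -, rfl⟩
    exact hS t
  · obtain ⟨s, hs, hts⟩ := mem_iUnion₂.1 (hcov ht)
    exact ⟨S s, mem_image_of_mem S hs, hts⟩

/-- A Lipschitz function of one variable is uniformly differentiable on compact sets of almost full
measure. -/
theorem LipschitzWith.exists_isCompact_uniform_differentiable {E : Type*} [NormedAddCommGroup E]
    [NormedSpace ℝ E] [FiniteDimensional ℝ E] [MeasurableSpace E] [BorelSpace E] {K : NNReal}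
    {f : ℝ → E} (hf : LipschitzWith K f) {ε : ℝ≥0∞} (hε : ε ≠ 0) :
    ∃ C ⊆ Icc (0 : ℝ) 1, IsCompact C ∧ volume (Icc (0 : ℝ) 1 \ C) < ε ∧
      ∀ η > 0, ∃ ρ > 0, ∀ c ∈ C, ∀ s, |s| < ρ → ‖f (c + s) - f c - s • deriv f c‖ ≤ η * |s| := by
  have : CompleteSpace E := FiniteDimensional.complete ℝ E
  have : ProperSpace E := FiniteDimensional.proper_real E
  -- Rational increments make `T i k` measurable; continuity extends the estimate to real ones. The
  -- sets `T i k` then give an argument in the style of Egorov.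
  let T : ℕ → ℕ → Set ℝ := fun i k => {t | ∀ q : ℚ, |(q : ℝ)| < 1 / (k + 1) →
    ‖f (t + q) - f t - (q : ℝ) • deriv f t‖ ≤ 1 / (i + 1) * |(q : ℝ)|}
  have hTm : ∀ i k, MeasurableSet (T i k) := by
    intro i k
    simp only [T, ofPred_forall]
    refine MeasurableSet.iInter fun q => MeasurableSet.iInter fun _ => ?_
    refine measurableSet_le ?_ measurable_const
    have h1 : Measurable fun t => f (t + q) := (hf.continuous.comp (by fun_prop)).measurable
    exact ((h1.sub hf.continuous.measurable).sub ((measurable_deriv f).const_smul _)).norm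
  have hTs : ∀ i k t, t ∈ T i k → ∀ s : ℝ, |s| < 1 / (k + 1) →
      ‖f (t + s) - f t - s • deriv f t‖ ≤ 1 / (i + 1) * |s| := by
    intro i k t ht s hs
    have hcl : IsClosed {s : ℝ | ‖f (t + s) - f t - s • deriv f t‖ ≤ 1 / (i + 1) * |s|} := by
      have := hf.continuous
      exact isClosed_le (by fun_prop) (by fun_prop)
    have hop : IsOpen {s : ℝ | |s| < 1 / ((k : ℝ) + 1)} :=
      isOpen_lt continuous_abs continuous_const
    refine closure_minimal ?_ hcl ((Rat.denseRange_cast (𝕜 := ℝ)).open_subset_closure_inter hop hs)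
    rintro _ ⟨hq, q, rfl⟩
    exact ht q hq
  have hanti : ∀ i, Antitone fun k => Icc (0 : ℝ) 1 \ T i k := by
    intro i k k' hkk'
    refine sdiff_subset_sdiff_right fun t ht q hq => ht q (hq.trans_le ?_)
    gcongr
  have hlim : ∀ i, Tendsto (fun k => volume (Icc (0 : ℝ) 1 \ T i k)) atTop (𝓝 0) := by
    intro i
    have h0 : volume (⋂ k, Icc (0 : ℝ) 1 \ T i k) = 0 := by
      rw [measure_eq_zero_iff_ae_notMem]
      filter_upwards [hf.ae_differentiableAt_real] with t ht hmem
      have h1 := ht.hasDerivAt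
      rw [hasDerivAt_iff_isLittleO_nhds_zero, Asymptotics.isLittleO_iff] at h1
      have h2 := h1 (show (0 : ℝ) < 1 / (i + 1) by positivity)
      rw [Metric.eventually_nhds_iff] at h2
      obtain ⟨ρ, hρ, H⟩ := h2
      obtain ⟨k, hk⟩ := exists_nat_one_div_lt hρ
      refine (mem_iInter.1 hmem k).2 fun q hq => ?_
      exact H (by rw [Real.dist_eq, sub_zero]; exact hq.trans hk)
    rw [← h0]
    exact tendsto_measure_iInter_atTop
      (fun k => (measurableSet_Icc.diff (hTm i k)).nullMeasurableSet) (hanti i)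
      ⟨0, ((measure_mono sdiff_subset).trans_lt (by simp : volume (Icc (0 : ℝ) 1) < ∞)).ne⟩
  -- Half of `ε` is spent on the sets `T i (k i)`, the other half on passing to a compact subset.
  obtain ⟨ε', hε', hsum⟩ := ENNReal.exists_pos_sum_of_countable' (ENNReal.half_pos hε).ne' ℕ
  choose k hk using fun i => ((hlim i).eventually_lt_const (hε' i)).exists
  let A : Set ℝ := Icc 0 1 ∩ ⋂ i, T i (k i)
  have hA : MeasurableSet A := measurableSet_Icc.inter (MeasurableSet.iInter fun i => hTm i _)
  have hAε : volume (Icc (0 : ℝ) 1 \ A) < ε / 2 := by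
    have : Icc (0 : ℝ) 1 \ A ⊆ ⋃ i, Icc (0 : ℝ) 1 \ T i (k i) := by
      rintro t ⟨ht, htA⟩
      by_contra hcon
      refine htA ⟨ht, mem_iInter.2 fun i => ?_⟩
      by_contra hti
      exact hcon (mem_iUnion.2 ⟨i, ht, hti⟩)
    exact (measure_mono this).trans_lt <| (measure_iUnion_le _).trans_lt <|
      (ENNReal.tsum_le_tsum fun i => (hk i).le).trans_lt hsum
  obtain ⟨C, hCA, hC, hCε⟩ := hA.exists_isCompact_sdiff_lt (μ := volume)
    ((measure_mono inter_subset_left).trans_lt (by simp : volume (Icc (0 : ℝ) 1) < ∞)).ne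
    (ENNReal.half_pos hε).ne'
  refine ⟨C, hCA.trans inter_subset_left, hC, ?_, fun η hη => ?_⟩
  · calc volume (Icc (0 : ℝ) 1 \ C) ≤ volume (Icc (0 : ℝ) 1 \ A ∪ A \ C) :=
          measure_mono fun t ht => by
            by_cases h : t ∈ A
            · exact Or.inr ⟨h, ht.2⟩
            · exact Or.inl ⟨ht.1, h⟩
      _ ≤ volume (Icc (0 : ℝ) 1 \ A) + volume (A \ C) := measure_union_le _ _
      _ < ε / 2 + ε / 2 := ENNReal.add_lt_add hAε hCε
      _ = ε := ENNReal.add_halves ε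
  · obtain ⟨i, hi⟩ := exists_nat_one_div_lt hη
    refine ⟨1 / (k i + 1), by positivity, fun c hc s hs => ?_⟩
    refine (hTs i (k i) c (mem_iInter.1 (hCA hc).2 i) s hs).trans ?_
    gcongr

/-- A Lipschitz function of one variable coincides with a function of class `C¹`, up to first order,
on a set of almost full measure. -/
theorem LipschitzWith.exists_contDiff_eq {E : Type*} [NormedAddCommGroup E]
    [NormedSpace ℝ E] [FiniteDimensional ℝ E] [MeasurableSpace E] [BorelSpace E] {K : NNReal}
    {f : ℝ → E} (hf : LipschitzWith K f) {ε : ℝ≥0∞} (hε : ε ≠ 0) :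
    ∃ Γ : ℝ → E, ContDiff ℝ 1 Γ ∧
      volume {t ∈ Icc (0 : ℝ) 1 | ¬ (Γ t = f t ∧ deriv Γ t = deriv f t)} < ε := by
  obtain ⟨C, hC01, hC, hCε, H⟩ := hf.exists_isCompact_uniform_differentiable hε
  -- Integers at distance at least `1` from `[0, 1]`, added to make the closed set unbounded both
  -- ways. Points of `Z` are so far from `C` and from each other that the Taylor condition on scales
  -- up to `1/2` is unaffected.
  let Z : Set ℝ := ((↑) : ℤ → ℝ) '' {k | k ≤ -1 ∨ 2 ≤ k}
  have hZ : IsClosed Z := Int.isClosedEmbedding_coe_real.isClosedMap _ (isClosed_discrete _)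
  have hfar : ∀ c ∈ C, ∀ z ∈ Z, 1 ≤ |z - c| := by
    rintro c hc _ ⟨z, hz, rfl⟩
    obtain ⟨h0, h1⟩ := hC01 hc
    rcases hz with hz | hz
    · have : (z : ℝ) ≤ -1 := by exact_mod_cast hz
      rw [abs_of_nonpos (by linarith)]; linarith
    · have : (2 : ℝ) ≤ z := by exact_mod_cast hz
      rw [abs_of_nonneg (by linarith)]; linarith
  have hW : IsWhitneyJet f (deriv f) (C ∪ Z) := by
    constructor
    · intro η hη
      obtain ⟨ρ, hρ, hT⟩ := H η hη
      refine ⟨min (ρ / 2) (1 / 2), by positivity, ?_⟩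
      rintro c (hc | hc) c' (hc' | hc') hcc'
      · have := hT c hc (c' - c) (hcc'.trans_lt ((min_le_left _ _).trans_lt (by linarith)))
        simpa using this
      · linarith [hfar c hc c' hc', hcc'.trans (min_le_right _ _)]
      · have := hfar c' hc' c hc
        rw [abs_sub_comm] at this
        linarith [hcc'.trans (min_le_right _ _)]
      · obtain ⟨z, -, rfl⟩ := hc
        obtain ⟨z', -, rfl⟩ := hc'
        have h1 : |((z' - z : ℤ) : ℝ)| < 1 := by
          push_cast
          linarith [hcc'.trans (min_le_right _ _)]
        have h2 : |z' - z| < 1 := by exact_mod_cast h1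
        have h3 : z' = z := by rw [Int.abs_lt_one_iff] at h2; omega
        simp [h3]
    · exact ⟨K, fun c _ => ⟨norm_deriv_le_of_lipschitz hf, fun c' _ => by
        simpa [dist_eq_norm] using hf.dist_le_mul c' c⟩⟩
  obtain ⟨Γ, hΓ, hΓC⟩ := hW.exists_contDiff (hC.isClosed.union hZ) (by
      rw [not_bddAbove_iff]
      intro x
      obtain ⟨m, hm⟩ := exists_nat_gt (max x 2)
      refine ⟨(m : ℤ), Or.inr ⟨m, Or.inr ?_, rfl⟩, ?_⟩
      · exact_mod_cast ((le_max_right _ _).trans hm.le)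
      · exact_mod_cast (le_max_left _ _).trans_lt hm) (by
      rw [not_bddBelow_iff]
      intro x
      obtain ⟨m, hm⟩ := exists_nat_gt (max (-x) 2)
      refine ⟨((-m : ℤ) : ℝ), Or.inr ⟨-m, Or.inl ?_, rfl⟩, ?_⟩
      · have : (2 : ℝ) < m := (le_max_right _ _).trans_lt hm
        have : 2 < m := by exact_mod_cast this
        omega
      · push_cast
        linarith [(le_max_left _ _).trans_lt hm])
  refine ⟨Γ, hΓ, (measure_mono ?_).trans_lt hCε⟩
  rintro t ⟨ht, hne⟩
  exact ⟨ht, fun htC => hne (hΓC t (Or.inl htC))⟩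

/-- Lipschitz curves are rectifiable in the sense of surfaces of class `C¹`. -/
theorem LipschitzWith.exists_isC1Surface_ae_mem {K : NNReal} {f : ℝ → EuclideanSpace ℝ (Fin n)}
    (hf : LipschitzWith K f) :
    ∃ S : ℕ → Set (EuclideanSpace ℝ (Fin n)), (∀ i, IsC1Surface 1 (S i)) ∧
      ∀ᵐ t : ℝ, t ∈ Icc (0 : ℝ) 1 → deriv f t ≠ 0 → ∃ i, f t ∈ S i := by
  choose Γ hΓ hΓf using fun j : ℕ => hf.exists_contDiff_eq (ε := ((j : ℝ≥0∞) + 1)⁻¹) (by simp)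
  choose 𝒮 h𝒮 h𝒮1 h𝒮cov using fun j => exists_countable_isC1Surface_cover (hΓ j)
  obtain ⟨S, hS⟩ := ((countable_iUnion h𝒮).union (countable_singleton ∅)).exists_eq_range
    ⟨∅, Or.inr rfl⟩
  refine ⟨S, fun i => ?_, ?_⟩
  · have : S i ∈ (⋃ j, 𝒮 j) ∪ {∅} := hS ▸ mem_range_self i
    rcases this with h | h
    · obtain ⟨j, hj⟩ := mem_iUnion.1 h
      exact h𝒮1 j _ hj
    · rw [mem_singleton_iff.1 h]
      exact isC1Surface_empty 1
  · have hae : ∀ᵐ t : ℝ, t ∉ {t ∈ Icc (0 : ℝ) 1 | ∀ j, ¬ (Γ j t = f t ∧ deriv (Γ j) t = deriv f t)} := by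
      rw [← measure_eq_zero_iff_ae_notMem]
      refine le_antisymm (ENNReal.le_of_forall_pos_le_add fun δ hδ _ => ?_) zero_le
      obtain ⟨j, hj⟩ := ENNReal.exists_inv_nat_lt (ENNReal.coe_pos.2 hδ).ne'
      rw [zero_add]
      refine (measure_mono ?_).trans ((hΓf j).le.trans (le_trans ?_ hj.le))
      · exact fun t ht => ⟨ht.1, ht.2 j⟩
      · exact ENNReal.inv_le_inv.2 le_self_add
    filter_upwards [hae] with t ht ht01 hne
    by_contra hcon
    refine ht ⟨ht01, fun j hj => hcon ?_⟩
    obtain ⟨R, hR, hΓR⟩ := h𝒮cov j t (by rw [hj.2]; exact hne)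
    have : R ∈ (⋃ j, 𝒮 j) ∪ {∅} := Or.inl (mem_iUnion.2 ⟨j, hR⟩)
    rw [hS] at this
    obtain ⟨i, rfl⟩ := this
    exact ⟨i, hj.1 ▸ hΓR⟩

end LipschitzCurves

/-! ### Measurable dependence of `ℋ¹` on the set. -/

section HausdorffMeasurability

variable {X : Type*} [MetricSpace X]

/-- The one-dimensional Hausdorff premeasure computed with open coverings by sets of diameter at most
`r`. -/
noncomputable def openHausdorffContent (r : ℝ≥0∞) (s : Set X) : ℝ≥0∞ :=
  ⨅ U : {U : ℕ → Set X // (∀ i, IsOpen (U i)) ∧ (∀ i, Metric.ediam (U i) ≤ r) ∧ s ⊆ ⋃ i, U i},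
    ∑' i, Metric.ediam (U.1 i)

/-- Thickening each set of a covering slightly makes it open at arbitrarily small cost. Open
coverings are wanted because they still cover nearby compact sets. -/
theorem hausdorffMeasure_one_eq_iSup [MeasurableSpace X] [BorelSpace X] (s : Set X) :
    (μH[1] : Measure X) s = ⨆ k : ℕ, openHausdorffContent ((k : ℝ≥0∞) + 1)⁻¹ s := by
  have hsimp : ∀ t : Set X, ⨆ _ : t.Nonempty, Metric.ediam t ^ (1 : ℝ) = Metric.ediam t := by
    intro t
    rcases t.eq_empty_or_nonempty with rfl | ht
    · simp
    · simp [ht]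
  rw [Measure.hausdorffMeasure_apply]
  simp only [hsimp]
  refine le_antisymm (iSup₂_le fun r hr => ?_) (iSup_le fun k => ?_)
  · obtain ⟨k, hk⟩ := ENNReal.exists_inv_nat_lt hr.ne'
    refine le_trans ?_ (le_iSup _ k)
    refine le_iInf fun U => ?_
    refine (iInf_le _ U.1).trans ((iInf_le _ U.2.2.2).trans (iInf_le _ fun i => ?_))
    exact (U.2.2.1 i).trans ((ENNReal.inv_le_inv.2 le_self_add).trans hk.le)
  · have hr : (0 : ℝ≥0∞) < ((k : ℝ≥0∞) + 1)⁻¹ / 2 := ENNReal.half_pos (by simp)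
    refine le_trans ?_ (le_iSup₂ (((k : ℝ≥0∞) + 1)⁻¹ / 2) hr)
    refine le_iInf fun t => le_iInf fun hst => le_iInf fun ht => ?_
    refine ENNReal.le_of_forall_pos_le_add fun ε hε _ => ?_
    obtain ⟨ε', hε', hsum⟩ := ENNReal.exists_pos_sum_of_countable (ENNReal.coe_pos.2 hε).ne' ℕ
    have hδ : ∀ i, ∃ δ : NNReal, 0 < δ ∧ 2 * (δ : ℝ≥0∞) ≤ ε' i ∧
        2 * (δ : ℝ≥0∞) ≤ ((k : ℝ≥0∞) + 1)⁻¹ / 2 := by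
      intro i
      have hpos : (0 : ℝ≥0∞) < min (ε' i : ℝ≥0∞) (((k : ℝ≥0∞) + 1)⁻¹ / 2) / 2 :=
        ENNReal.half_pos (lt_min (ENNReal.coe_pos.2 (hε' i)) hr).ne'
      obtain ⟨δ, h0, hδ⟩ := ENNReal.lt_iff_exists_nnreal_btwn.1 hpos
      have h2 : 2 * (δ : ℝ≥0∞) ≤ min (ε' i : ℝ≥0∞) (((k : ℝ≥0∞) + 1)⁻¹ / 2) := by
        calc 2 * (δ : ℝ≥0∞) ≤ 2 * (min (ε' i : ℝ≥0∞) (((k : ℝ≥0∞) + 1)⁻¹ / 2) / 2) := by gcongr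
          _ = _ := ENNReal.mul_div_cancel (by simp) (by simp)
      exact ⟨δ, ENNReal.coe_pos.1 h0, h2.trans (min_le_left _ _), h2.trans (min_le_right _ _)⟩
    choose δ hδ0 hδ1 hδ2 using hδ
    have hdiam : ∀ i, Metric.ediam (Metric.thickening (δ i) (t i)) ≤ Metric.ediam (t i) + 2 * δ i :=
      fun i => Metric.ediam_thickening_le (δ i)
    have hr' : ∀ i, Metric.ediam (Metric.thickening (δ i) (t i)) ≤ ((k : ℝ≥0∞) + 1)⁻¹ := fun i =>
      calc Metric.ediam (Metric.thickening (δ i) (t i)) ≤ Metric.ediam (t i) + 2 * δ i := hdiam i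
        _ ≤ ((k : ℝ≥0∞) + 1)⁻¹ / 2 + ((k : ℝ≥0∞) + 1)⁻¹ / 2 := add_le_add (ht i) (hδ2 i)
        _ = _ := ENNReal.add_halves _
    refine (iInf_le _ ⟨fun i => Metric.thickening (δ i) (t i), fun i => Metric.isOpen_thickening,
      hr', hst.trans (iUnion_mono fun i =>
        Metric.self_subset_thickening (NNReal.coe_pos.2 (hδ0 i)) _)⟩).trans ?_
    calc ∑' i, Metric.ediam (Metric.thickening (δ i) (t i))
        ≤ ∑' i, (Metric.ediam (t i) + ε' i) :=
          ENNReal.tsum_le_tsum fun i => (hdiam i).trans (by gcongr; exact hδ1 i)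
      _ = ∑' i, Metric.ediam (t i) + ∑' i, (ε' i : ℝ≥0∞) := ENNReal.tsum_add
      _ ≤ _ := by gcongr

/-- The one-dimensional Hausdorff measure is a Borel function of a compact set, or of any family of
sets which is upper semicontinuous. -/
theorem measurable_hausdorffMeasure_one_of_isOpen [MeasurableSpace X] [BorelSpace X] {K : Type*}
    [TopologicalSpace K] [MeasurableSpace K] [OpensMeasurableSpace K] {A : K → Set X}
    (hA : ∀ V, IsOpen V → IsOpen {g | A g ⊆ V}) :
    Measurable fun g => (μH[1] : Measure X) (A g) := by
  simp_rw [hausdorffMeasure_one_eq_iSup]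
  refine Measurable.iSup fun k => measurable_of_Iio fun c => IsOpen.measurableSet ?_
  rw [isOpen_iff_mem_nhds]
  intro g hg
  -- A nearly optimal open covering of `A g` also covers `A g'` for `g'` near `g`: the premeasure is
  -- upper semicontinuous.
  obtain ⟨⟨U, hU1, hU2, hU3⟩, hUc⟩ := iInf_lt_iff.1 (show openHausdorffContent _ (A g) < c from hg)
  refine mem_of_superset ((hA _ (isOpen_iUnion hU1)).mem_nhds hU3) fun g' hg' => ?_
  change openHausdorffContent _ (A g') < c
  exact (iInf_le _ ⟨U, hU1, hU2, hg'⟩).trans_lt hUc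

/-- For closed `C`, the sets `C ∩ range (Φ g)` are upper semicontinuous in `g`, because projection
along the compact space `T` is a closed map. Closed sets form a π-system generating the Borel sets,
and finiteness of the measures extends measurability to all of these. -/
theorem measurable_restrict_hausdorffMeasure_range [MeasurableSpace X] [BorelSpace X] {K T : Type*}
    [TopologicalSpace K] [MeasurableSpace K] [OpensMeasurableSpace K] [TopologicalSpace T]
    [CompactSpace T] {Φ : K → T → X} (hΦ : Continuous (Function.uncurry Φ))
    (hfin : ∀ g, (μH[1] : Measure X) (range (Φ g)) < ∞) :
    Measurable fun g => (μH[1] : Measure X).restrict (range (Φ g)) := by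
  have hclosed : ∀ C : Set X, IsClosed C →
      Measurable fun g => (μH[1] : Measure X) (C ∩ range (Φ g)) := by
    intro C hC
    refine measurable_hausdorffMeasure_one_of_isOpen fun V hV => ?_
    have : {g | C ∩ range (Φ g) ⊆ V} =
        (Prod.fst '' (Function.uncurry Φ ⁻¹' (C ∩ Vᶜ)))ᶜ := by
      ext g
      simp only [mem_ofPred_eq, mem_compl_iff, mem_image, not_exists]
      constructor
      · rintro h ⟨g', t⟩ ⟨⟨hC, hV⟩, rfl⟩
        exact hV (h ⟨hC, t, rfl⟩)
      · rintro h _ ⟨hC, t, rfl⟩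
        by_contra hV
        exact h (g, t) ⟨⟨hC, hV⟩, rfl⟩
    rw [this]
    exact (isClosedMap_fst_of_compactSpace _
      ((hC.inter hV.isClosed_compl).preimage hΦ)).isOpen_compl
  have : ∀ g, IsFiniteMeasure ((μH[1] : Measure X).restrict (range (Φ g))) := fun g =>
    ⟨by rw [Measure.restrict_apply_univ]; exact hfin g⟩
  refine Measurable.measure_of_isPiSystem
    (BorelSpace.measurable_eq.trans borel_eq_generateFrom_isClosed) isPiSystem_isClosed
    (fun C hC => ?_) ?_
  · simp_rw [Measure.restrict_apply (IsClosed.measurableSet hC)]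
    exact hclosed C hC
  · simp_rw [Measure.restrict_apply MeasurableSet.univ]
    exact hclosed univ isClosed_univ

end HausdorffMeasurability

/-! ### The compact set of curves with prescribed slope, and their rectifiability. -/

section SlopeCurves

variable {E : Type*} [NormedAddCommGroup E] [NormedSpace ℝ E]

/-- The curves in a ball whose difference quotients lie in the ball with center `e` and radius
`δ`. -/
def slopeCurves (e : E) (δ R : ℝ) : Set C(unitInterval, E) :=
  {γ | ‖γ 0‖ ≤ R ∧ ∀ s t : unitInterval,
    ‖γ t - γ s - ((t : ℝ) - s) • e‖ ≤ δ * |(t : ℝ) - s|}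

variable {e : E} {δ R : ℝ}

/-- Stated for bare functions, since compactness is checked on pointwise limits before their
continuity is known. -/
theorem lipschitzWith_of_slope {F : unitInterval → E} (hδ : 0 ≤ δ) (hF : ∀ s t : unitInterval,
    ‖F t - F s - ((t : ℝ) - s) • e‖ ≤ δ * |(t : ℝ) - s|) :
    LipschitzWith (Real.toNNReal (‖e‖ + δ)) F := by
  refine LipschitzWith.of_dist_le_mul fun t s => ?_
  rw [Real.coe_toNNReal _ (by positivity), dist_eq_norm, Subtype.dist_eq, Real.dist_eq]
  calc ‖F t - F s‖ = ‖(F t - F s - ((t : ℝ) - s) • e) + ((t : ℝ) - s) • e‖ := by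
        rw [sub_add_cancel]
    _ ≤ δ * |(t : ℝ) - s| + |(t : ℝ) - s| * ‖e‖ := by
        refine (norm_add_le _ _).trans (add_le_add (hF s t) ?_)
        rw [norm_smul, Real.norm_eq_abs]
    _ = _ := by ring

theorem antilipschitzWith_of_slope {F : unitInterval → E} (hδ : δ < ‖e‖)
    (hF : ∀ s t : unitInterval, ‖F t - F s - ((t : ℝ) - s) • e‖ ≤ δ * |(t : ℝ) - s|) :
    AntilipschitzWith (Real.toNNReal (‖e‖ - δ)⁻¹) F := by
  have hpos : 0 < ‖e‖ - δ := sub_pos.2 hδ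
  refine AntilipschitzWith.of_le_mul_dist fun t s => ?_
  rw [Real.coe_toNNReal _ (by positivity), dist_eq_norm, Subtype.dist_eq, Real.dist_eq,
    inv_mul_eq_div, le_div_iff₀ hpos]
  have h1 : ‖((t : ℝ) - s) • e‖ ≤ ‖F t - F s‖ + ‖F t - F s - ((t : ℝ) - s) • e‖ := by
    have := norm_sub_le (F t - F s) (F t - F s - ((t : ℝ) - s) • e)
    rwa [sub_sub_cancel] at this
  rw [norm_smul, Real.norm_eq_abs] at h1
  linarith [hF s t]

/-- Arzelà–Ascoli: the conditions are closed under pointwise convergence, and they bound the curves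
and their Lipschitz constants uniformly. -/
theorem isCompact_slopeCurves [FiniteDimensional ℝ E] (hδ : 0 ≤ δ) :
    IsCompact (slopeCurves e δ R) := by
  have : ProperSpace E := FiniteDimensional.proper_real E
  refine ArzelaAscoli.isCompact_of_equicontinuous _ ?_ ?_
  · have himg : ContinuousMap.toFun '' slopeCurves e δ R = {F : unitInterval → E | ‖F 0‖ ≤ R ∧
        ∀ s t : unitInterval, ‖F t - F s - ((t : ℝ) - s) • e‖ ≤ δ * |(t : ℝ) - s|} := by
      ext F
      constructor
      · rintro ⟨γ, hγ, rfl⟩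
        exact hγ
      · intro hF
        exact ⟨⟨F, (lipschitzWith_of_slope hδ hF.2).continuous⟩, hF, rfl⟩
    rw [himg]
    refine IsCompact.of_isClosed_subset
      (isCompact_univ_pi fun _ : unitInterval => isCompact_closedBall (0 : E) (R + (‖e‖ + δ))) ?_ ?_
    · simp only [ofPred_and, ofPred_forall]
      refine IsClosed.inter (isClosed_le (by fun_prop) continuous_const) ?_
      exact isClosed_iInter fun s => isClosed_iInter fun t =>
        isClosed_le (by fun_prop) continuous_const
    · intro F hF t _
      rw [mem_closedBall_zero_iff]
      have h1 := (lipschitzWith_of_slope hδ hF.2).dist_le_mul t 0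
      rw [Real.coe_toNNReal _ (by positivity), dist_eq_norm, Subtype.dist_eq, Real.dist_eq] at h1
      have h2 : |(t : ℝ) - (0 : unitInterval)| ≤ 1 := by
        rw [Set.Icc.coe_zero, sub_zero, abs_of_nonneg t.2.1]
        exact t.2.2
      have h3 : ‖F t‖ ≤ ‖F 0‖ + ‖F t - F 0‖ := by
        simpa using norm_add_le (F 0) (F t - F 0)
      have h4 : (‖e‖ + δ) * |(t : ℝ) - (0 : unitInterval)| ≤ ‖e‖ + δ :=
        mul_le_of_le_one_right (by positivity) h2
      linarith [hF.1]
  · exact (LipschitzWith.uniformEquicontinuous _ (Real.toNNReal (‖e‖ + δ))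
      fun γ : slopeCurves e δ R => lipschitzWith_of_slope hδ γ.2.2).equicontinuous

end SlopeCurves

section SlopeCurveRectifiability

variable {n : ℕ} {e : EuclideanSpace ℝ (Fin n)} {δ R : ℝ}
  {γ : C(unitInterval, EuclideanSpace ℝ (Fin n))}

theorem hausdorffMeasure_one_unitInterval : (μH[1] : Measure unitInterval) = volume := by
  ext s _
  have hiso : Isometry ((↑) : unitInterval → ℝ) := isometry_subtype_coe
  rw [unitInterval.volume_apply, ← hausdorffMeasure_real,
    hiso.hausdorffMeasure_image (Or.inl zero_le_one)]

theorem hausdorffMeasure_range_lt_top (hδ : 0 ≤ δ) (hγ : γ ∈ slopeCurves e δ R) :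
    (μH[1] : Measure (EuclideanSpace ℝ (Fin n))) (range γ) ≤ Real.toNNReal (‖e‖ + δ) := by
  have h := (lipschitzWith_of_slope hδ hγ.2).hausdorffMeasure_image_le zero_le_one univ
  rwa [image_univ, hausdorffMeasure_one_unitInterval, measure_univ, mul_one, ENNReal.rpow_one] at h

/-- For `δ < ‖e‖` the curve is bi-Lipschitz onto its image. So `ℋ¹` on the image and the
push-forward of Lebesgue measure have the same null sets, and the latter, which is continuous in the
curve, can be used in Rainwater's lemma. -/
theorem hausdorffMeasure_inter_range_eq_zero_iff (hδ : 0 ≤ δ) (hδe : δ < ‖e‖)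
    (hγ : γ ∈ slopeCurves e δ R) (B : Set (EuclideanSpace ℝ (Fin n))) :
    (μH[1] : Measure (EuclideanSpace ℝ (Fin n))) (B ∩ range γ) = 0 ↔ volume (γ ⁻¹' B) = 0 := by
  rw [← hausdorffMeasure_one_unitInterval]
  constructor
  · intro h
    have h1 := (antilipschitzWith_of_slope hδe hγ.2).hausdorffMeasure_preimage_le zero_le_one
      (B ∩ range γ)
    rw [h, mul_zero, preimage_inter_range] at h1
    exact le_antisymm h1 zero_le
  · intro h
    have h1 := (lipschitzWith_of_slope hδ hγ.2).hausdorffMeasure_image_le zero_le_one (γ ⁻¹' B)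
    rw [h, mul_zero, image_preimage_eq_inter_range] at h1
    exact le_antisymm h1 zero_le

/-- The vector is the velocity `γ'(t)`: it lies within `δ` of `e`, hence does not vanish, and it is
tangent to each covering surface at almost every parameter where the curve meets it. -/
theorem exists_isC1Surface_of_mem_slopeCurves (hδ : 0 ≤ δ) (hδe : δ < ‖e‖)
    (hγ : γ ∈ slopeCurves e δ R) :
    ∃ S : ℕ → Set (EuclideanSpace ℝ (Fin n)), (∀ i, IsC1Surface 1 (S i)) ∧
      ∀ᵐ x ∂(μH[1] : Measure (EuclideanSpace ℝ (Fin n))), x ∈ range γ →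
        ∃ v, ‖v - e‖ ≤ δ ∧ (∃ i, x ∈ S i) ∧ ∀ i, x ∈ S i → v ∈ tangentConeAt ℝ (S i) x := by
  -- The curve is extended by constants; the endpoints, where the derivative may be spoiled, are
  -- discarded as null.
  let f : ℝ → EuclideanSpace ℝ (Fin n) := fun t => γ (projIcc 0 1 zero_le_one t)
  have hfeq : ∀ t : unitInterval, f t = γ t := fun t => by simp only [f, projIcc_val]
  have hf := (lipschitzWith_of_slope hδ hγ.2).comp (LipschitzWith.projIcc zero_le_one)
  change LipschitzWith _ f at hf
  have hfs : ∀ t ∈ Icc (0 : ℝ) 1, ∀ s ∈ Icc (0 : ℝ) 1,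
      ‖f t - f s - (t - s) • e‖ ≤ δ * |t - s| := by
    intro t ht s hs
    have := hγ.2 ⟨s, hs⟩ ⟨t, ht⟩
    rwa [← hfeq, ← hfeq] at this
  obtain ⟨S, hS, hcov⟩ := hf.exists_isC1Surface_ae_mem
  refine ⟨S, hS, ?_⟩
  have hae : ∀ᵐ t : ℝ, t ∈ Icc (0 : ℝ) 1 → ∃ v, ‖v - e‖ ≤ δ ∧ (∃ i, f t ∈ S i) ∧
      ∀ i, f t ∈ S i → v ∈ tangentConeAt ℝ (S i) (f t) := by
    have hne : ∀ a : ℝ, ∀ᵐ t : ℝ, t ≠ a := fun a => by simp [ae_iff]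
    filter_upwards [hcov, hf.ae_differentiableAt_real, hne 0, hne 1,
      ae_all_iff.2 fun i => ae_deriv_mem_tangentConeAt f (S i)] with t h1 h2 h3 h4 h5 ht
    have hIoo : t ∈ Ioo (0 : ℝ) 1 := ⟨lt_of_le_of_ne ht.1 h3.symm, lt_of_le_of_ne ht.2 h4⟩
    have hd : ‖deriv f t - e‖ ≤ δ := by
      have h6 : HasDerivAt (fun s => f s - s • e) (deriv f t - e) t := by
        have h := h2.hasDerivAt.sub ((hasDerivAt_id t).smul_const e)
        rw [one_smul] at h
        exact h
      rw [← h6.deriv]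
      refine norm_deriv_le_of_lip' hδ ?_
      filter_upwards [Icc_mem_nhds hIoo.1 hIoo.2] with s hs
      have := hfs s hs t ht
      rw [Real.norm_eq_abs, show f s - s • e - (f t - t • e) = f s - f t - (s - t) • e by module]
      exact this
    have hd0 : deriv f t ≠ 0 := by
      intro h0
      rw [h0, zero_sub, norm_neg] at hd
      exact absurd hδe (not_lt.2 hd)
    exact ⟨deriv f t, hd, h1 ht hd0, fun i hi => h5 i hi h2⟩
  rw [ae_iff] at hae ⊢
  refine measure_mono_null ?_ (le_antisymm ((hf.hausdorffMeasure_image_le zero_le_one _).trans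
    (by rw [hausdorffMeasure_real, hae, mul_zero])) zero_le)
  intro x hx
  simp only [mem_ofPred_eq, Classical.not_imp] at hx
  obtain ⟨⟨t, rfl⟩, hx⟩ := hx
  refine ⟨t, ?_, hfeq t⟩
  simp only [mem_ofPred_eq, Classical.not_imp]
  rw [hfeq]
  exact ⟨t.2, hx⟩

theorem isRectifiable_inter_range (hδ : 0 ≤ δ) (hδe : δ < ‖e‖) (hγ : γ ∈ slopeCurves e δ R)
    {B : Set (EuclideanSpace ℝ (Fin n))} (hB : MeasurableSet B) :
    IsRectifiable 1 (B ∩ range γ) := by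
  obtain ⟨S, hS, hae⟩ := exists_isC1Surface_of_mem_slopeCurves hδ hδe hγ
  refine ⟨hB.inter (isCompact_range γ.continuous).measurableSet, ?_, S, hS, ?_⟩
  · rw [Nat.cast_one]
    exact (measure_mono inter_subset_right).trans_lt
      ((hausdorffMeasure_range_lt_top hδ hγ).trans_lt ENNReal.coe_lt_top)
  · rw [Nat.cast_one, measure_eq_zero_iff_ae_notMem]
    filter_upwards [hae] with x hx
    rintro ⟨hxB, hxS⟩
    obtain ⟨v, -, ⟨i, hi⟩, -⟩ := hx hxB.2
    exact hxS (mem_iUnion.2 ⟨i, hi⟩)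

theorem ae_exists_mem_approxTan_inter_range (hδ : 0 ≤ δ) (hδe : δ < ‖e‖)
    (hγ : γ ∈ slopeCurves e δ R) {B : Set (EuclideanSpace ℝ (Fin n))}
    (hE : IsRectifiable 1 (B ∩ range γ)) :
    ∀ᵐ x ∂(μH[1] : Measure (EuclideanSpace ℝ (Fin n))), x ∈ B ∩ range γ →
      ∃ v ∈ approxTan hE x, ‖v - e‖ ≤ δ := by
  obtain ⟨S, hS, hae⟩ := exists_isC1Surface_of_mem_slopeCurves hδ hδe hγ
  have h := ae_all_iff.2 fun i => isTangentBundle_approxTan hE _ (hS i)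
  rw [Nat.cast_one] at h
  filter_upwards [hae, h] with x hx1 hx2 hx
  obtain ⟨v, hv, ⟨i, hi⟩, hvi⟩ := hx1 hx.2
  refine ⟨v, ?_, hv⟩
  rw [hx2 i hx hi]
  exact Submodule.subset_span (hvi i hi)

end SlopeCurveRectifiability

/-! ### Bundles of `𝒢_μ` pass the test on curves. -/

theorem exists_measurableSet_restrict_absolutelyContinuous {X : Type*} [MeasurableSpace X]
    (σ μ : Measure X) [IsFiniteMeasure σ] [IsFiniteMeasure μ] :
    ∃ s, MeasurableSet s ∧ μ sᶜ = 0 ∧ σ.restrict s ≪ μ := by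
  obtain ⟨s, hs, h1, h2⟩ := Measure.mutuallySingular_singularPart σ μ
  -- `s` carries `μ` and is null for the singular part of `σ`, so only the absolutely continuous
  -- part survives on `s`.
  refine ⟨s, hs, h2, ?_⟩
  have h := Measure.haveLebesgueDecomposition_add σ μ
  rw [h, Measure.restrict_add, Measure.restrict_eq_zero.2 h1, zero_add]
  exact Measure.absolutelyContinuous_of_le Measure.restrict_le_self |>.trans
    (withDensity_absolutelyContinuous _ _)

section CompatibleBundles

variable {n : ℕ} {μ : Measure (EuclideanSpace ℝ (Fin n))}
  {V : EuclideanSpace ℝ (Fin n) → Submodule ℝ (EuclideanSpace ℝ (Fin n))}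
  {e : EuclideanSpace ℝ (Fin n)} {δ R : ℝ}

theorem IsBorelBundle.measurableSet_lt_norm (hV : IsBorelBundle V)
    (e : EuclideanSpace ℝ (Fin n)) (δ : ℝ) :
    MeasurableSet {x | δ < ‖(V x)ᗮ.starProjection e‖} :=
  measurableSet_lt measurable_const (isBorelBundle_iff.1 hV.orthogonal e).norm

/-- A measurable family of curves parametrized by the unit interval, with directions which do not
belong to a bundle of `𝒢_μ`, charges `μ`-absolutely continuous parts only trivially. -/
theorem ae_volume_preimage_eq_zero_of_mem_compatibleBundles (hV : V ∈ compatibleBundles μ)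
    (hδ : 0 ≤ δ) (hδe : δ < ‖e‖) [MeasurableSpace (slopeCurves e δ R)]
    [BorelSpace (slopeCurves e δ R)] {τ : unitInterval → slopeCurves e δ R} (hτ : Measurable τ)
    {B : Set (EuclideanSpace ℝ (Fin n))} (hB : MeasurableSet B)
    (hBV : ∀ x ∈ B, δ < ‖(V x)ᗮ.starProjection e‖)
    (hac : ∀ D, MeasurableSet D → μ D = 0 →
      ∀ᵐ t : unitInterval, volume ((τ t).1 ⁻¹' (D ∩ B)) = 0) :
    ∀ᵐ t : unitInterval, volume ((τ t).1 ⁻¹' B) = 0 := by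
  have hrange : ∀ t, MeasurableSet (range (τ t).1) := fun t =>
    (isCompact_range (τ t).1.continuous).measurableSet
  have hfin : ∀ g : slopeCurves e δ R,
      (μH[1] : Measure (EuclideanSpace ℝ (Fin n))) (range g.1) ≤ Real.toNNReal (‖e‖ + δ) :=
    fun g => hausdorffMeasure_range_lt_top hδ g.2
  have hmeas : Measurable fun t => (μH[1] : Measure (EuclideanSpace ℝ (Fin n))).restrict
      (B ∩ range (τ t).1) := by
    have h1 := measurable_restrict_hausdorffMeasure_range (K := slopeCurves e δ R)
      (T := unitInterval) (Φ := fun g t => g.1 t) (by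
        unfold Function.uncurry
        fun_prop) fun g => (hfin g).trans_lt ENNReal.coe_lt_top
    refine Measure.measurable_of_measurable_coe _ fun D hD => ?_
    simp_rw [Measure.restrict_apply hD, ← inter_assoc, ← Measure.restrict_apply (hD.inter hB)]
    exact (Measure.measurable_coe (hD.inter hB)).comp (h1.comp hτ)
  -- The pieces of the curves in `B` form a family in `ℱ_μ`, so their tangents belong to `V`,
  -- against the choice of `B`.
  have hF : IsDecompFamily μ fun t => B ∩ range (τ t).1 := by
    refine ⟨fun t => isRectifiable_inter_range hδ hδe (τ t).2 hB, hmeas, ?_, ?_⟩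
    · refine (lintegral_mono fun t =>
        (measure_mono inter_subset_right).trans (hfin (τ t))).trans_lt ?_
      rw [lintegral_const, measure_univ, mul_one]
      exact ENNReal.coe_lt_top
    · refine Measure.AbsolutelyContinuous.mk fun D hD hμD => ?_
      rw [Measure.bind_apply hD hmeas.aemeasurable]
      refine (lintegral_congr_ae (g := fun _ => 0) ?_).trans lintegral_zero
      filter_upwards [hac D hD hμD] with t ht
      rw [Measure.restrict_apply hD, ← inter_assoc]
      exact (hausdorffMeasure_inter_range_eq_zero_iff hδ hδe (τ t).2 _).2 ht
  filter_upwards [hV.2 _ hF] with t ht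
  rw [← hausdorffMeasure_inter_range_eq_zero_iff hδ hδe (τ t).2, ← Measure.restrict_eq_zero,
    ← ae_eq_bot, ← eventually_false_iff_eq_bot]
  filter_upwards [ht, ae_restrict_mem (hB.inter (hrange t)),
    ae_restrict_of_ae (ae_exists_mem_approxTan_inter_range hδ hδe (τ t).2 (hF.rect t))]
    with x hx1 hx2 hx3
  obtain ⟨v, hv, hve⟩ := hx3 hx2
  have h1 := hBV x hx2.1
  have h2 : (V x)ᗮ.starProjection v = 0 := by
    rw [Submodule.starProjection_apply_eq_zero_iff, Submodule.orthogonal_orthogonal]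
    exact hx1 hv
  -- As `v ∈ V x`, the component of `e` orthogonal to `V x` is that of `e - v`, of norm at most `δ`.
  have h3 := (V x)ᗮ.norm_starProjection_apply_le (v - e)
  rw [map_sub, h2, zero_sub, norm_neg] at h3
  exact absurd h1 (not_lt.2 (h3.trans hve))

variable [IsFiniteMeasure μ]

/-- Rainwater's lemma is applied to `μ` on the bad set `A` and to the occupation measures of all the
curves. This is where a property of almost every member of each family becomes one exceptional set
for every curve. -/
theorem exists_null_of_mem_compatibleBundles_of_slope (hV : V ∈ compatibleBundles μ)
    (hδ : 0 ≤ δ) (hδe : δ < ‖e‖) (R : ℝ) :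
    ∃ N, MeasurableSet N ∧ μ N = 0 ∧ ∀ γ ∈ slopeCurves e δ R, ∀ᵐ t : unitInterval,
      δ < ‖(V (γ t))ᗮ.starProjection e‖ → γ t ∈ N := by
  let A : Set (EuclideanSpace ℝ (Fin n)) := {x | δ < ‖(V x)ᗮ.starProjection e‖}
  have hA : MeasurableSet A := hV.1.measurableSet_lt_norm e δ
  let _ : MeasurableSpace (slopeCurves e δ R) := borel _
  have : BorelSpace (slopeCurves e δ R) := ⟨rfl⟩
  have hcpt : IsCompact (slopeCurves e δ R) := isCompact_slopeCurves hδ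
  have : CompactSpace (slopeCurves e δ R) := isCompact_iff_compactSpace.1 hcpt
  have : PolishSpace (slopeCurves e δ R) := hcpt.isClosed.polishSpace
  let κ : slopeCurves e δ R → Measure (EuclideanSpace ℝ (Fin n)) := fun g =>
    (volume : Measure unitInterval).map g.1
  have hgm : ∀ g : slopeCurves e δ R, Measurable g.1 := fun g => g.1.continuous.measurable
  have : ∀ g, IsProbabilityMeasure (κ g) := fun g =>
    Measure.isProbabilityMeasure_map (hgm g).aemeasurable
  have heval : Continuous fun p : slopeCurves e δ R × unitInterval => p.1.1 p.2 := by fun_prop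
  have hκm : Measurable κ := by
    refine Measure.measurable_of_measurable_coe _ fun B hB => ?_
    simp_rw [κ, Measure.map_apply (hgm _) hB]
    exact measurable_measure_prodMk_left (ν := (volume : Measure unitInterval))
      (heval.measurable hB)
  have hκ : ∀ f : EuclideanSpace ℝ (Fin n) → ℝ, Continuous f → (∀ x, f x ∈ Icc (0 : ℝ) 1) →
      Continuous fun g => ∫ x, f x ∂κ g := by
    intro f hf hf1
    have : (fun g => ∫ x, f x ∂κ g) = fun g => ∫ t, f (g.1 t) := funext fun g =>
      integral_map (hgm g).aemeasurable hf.measurable.aestronglyMeasurable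
    rw [this]
    refine continuous_of_dominated (bound := fun _ => 1)
      (fun g => (hf.comp g.1.continuous).measurable.aestronglyMeasurable)
      (fun g => Eventually.of_forall fun t => ?_) (integrable_const 1)
      (Eventually.of_forall fun t => ?_)
    · rw [Real.norm_of_nonneg (hf1 _).1]
      exact (hf1 _).2
    · exact hf.comp (heval.comp (continuous_id.prodMk continuous_const))
  have hsing : ∀ P : Measure (slopeCurves e δ R), IsFiniteMeasure P →
      P.bind κ ⟂ₘ μ.restrict A := by
    intro P hP
    rcases eq_or_ne P 0 with rfl | hP0
    · rw [Measure.bind_zero_left]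
      exact Measure.MutuallySingular.zero_left
    have : NeZero P := ⟨hP0⟩
    have : Nonempty (slopeCurves e δ R) := by
      by_contra hempty
      rw [not_nonempty_iff] at hempty
      exact hP0 (Measure.eq_zero_of_isEmpty P)
    have hfin : IsFiniteMeasure (P.bind κ) := by
      constructor
      rw [Measure.bind_apply .univ hκm.aemeasurable]
      simp
    have hPu : (P univ)⁻¹ ≠ 0 := ENNReal.inv_ne_zero.2 (measure_ne_top P univ)
    -- A Borel probability measure on a Polish space is an image of Lebesgue measure on `[0, 1]`,
    -- which is the parameter space prescribed in `ℱ_μ`.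
    obtain ⟨τ, hτ, hτP⟩ := Measure.exists_measurable_map_eq ((P univ)⁻¹ • P)
    have hbind : ∀ D, MeasurableSet D → (P.bind κ D = 0 ↔
        ∀ᵐ t : unitInterval, volume ((τ t).1 ⁻¹' D) = 0) := by
      intro D hD
      have hDm : Measurable fun g => κ g D := (Measure.measurable_coe hD).comp hκm
      rw [Measure.bind_apply hD hκm.aemeasurable, lintegral_eq_zero_iff hDm]
      have h1 : (∀ᵐ g ∂P, κ g D = 0) ↔ ∀ᵐ g ∂((P univ)⁻¹ • P), κ g D = 0 := by
        rw [Measure.ae_ennreal_smul_measure_iff hPu]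
      have h2 : ∀ g, κ g D = volume (g.1 ⁻¹' D) := fun g => Measure.map_apply (hgm g) hD
      change (∀ᵐ g ∂P, κ g D = 0) ↔ _
      rw [h1, ← hτP, ae_map_iff hτ.aemeasurable (p := fun g => κ g D = 0)
        (hDm (measurableSet_singleton 0))]
      simp_rw [h2]
    obtain ⟨s, hs, hs1, hs2⟩ :=
      exists_measurableSet_restrict_absolutelyContinuous (P.bind κ) (μ.restrict A)
    refine ⟨s ∩ A, hs.inter hA, ?_, ?_⟩
    · rw [hbind _ (hs.inter hA)]
      refine ae_volume_preimage_eq_zero_of_mem_compatibleBundles hV hδ hδe hτ (hs.inter hA)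
        (fun x hx => hx.2) fun D hD hμD => ?_
      rw [← hbind _ (hD.inter (hs.inter hA))]
      have h1 : (P.bind κ).restrict s D = 0 :=
        hs2 (le_antisymm ((Measure.restrict_apply_le _ _).trans hμD.le) zero_le)
      rw [Measure.restrict_apply hD] at h1
      exact measure_mono_null (inter_subset_inter_right D inter_subset_left) h1
    · rw [compl_inter]
      refine measure_union_null hs1 ?_
      rw [Measure.restrict_apply hA.compl, compl_inter_self, measure_empty]
  obtain ⟨E, hE, hE1, hE2⟩ :=
    exists_measurableSet_forall_eq_zero_of_mutuallySingular hκm hκ hsing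
  refine ⟨A \ E, hA.diff hE, ?_, fun γ hγ => ?_⟩
  · rw [Measure.restrict_apply hE.compl] at hE1
    rwa [sdiff_eq, inter_comm]
  · have h1 : volume (γ ⁻¹' E) = 0 := by
      have := hE2 ⟨γ, hγ⟩
      rwa [Measure.map_apply (hgm ⟨γ, hγ⟩) hE] at this
    filter_upwards [measure_eq_zero_iff_ae_notMem.1 h1] with t ht htA
    exact ⟨htA, ht⟩

/-- A piece of a curve of class `C¹` extends to a curve with controlled slope. -/
theorem exists_mem_slopeCurves_of_contDiffOn {E : Type*} [NormedAddCommGroup E] [NormedSpace ℝ E]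
    {ψ : ℝ → E} {O : Set ℝ} (hO : IsOpen O) (hψ : ContDiffOn ℝ 1 ψ O) {t₀ : ℝ} (ht₀ : t₀ ∈ O)
    {e : E} {δ : ℝ} (hδ : ‖deriv ψ t₀ - e‖ < δ) :
    ∃ m : ℕ, ∃ γ ∈ slopeCurves e δ m, ∃ r > 0, ∀ t, |t - t₀| < r →
      ∃ s : unitInterval, (s : ℝ) = t + (1 / 2 - t₀) ∧ γ s = ψ t := by
  have hδ0 : 0 ≤ δ := (norm_nonneg _).trans hδ.le
  have hcont : ContinuousAt (deriv ψ) t₀ :=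
    (hψ.continuousOn_deriv_of_isOpen hO le_rfl).continuousAt (hO.mem_nhds ht₀)
  have hev : ∀ᶠ t in 𝓝 t₀, t ∈ O ∧ ‖deriv ψ t - e‖ < δ :=
    (hO.eventually_mem ht₀).and
      ((hcont.sub continuousAt_const).norm.eventually_lt_const hδ)
  obtain ⟨r₀, hr₀, hr₀b⟩ := Metric.eventually_nhds_iff.1 hev
  obtain ⟨r, hr, hrb⟩ : ∃ r : ℝ, 0 < r ∧ r < min r₀ (1 / 2) :=
    exists_between (lt_min hr₀ (by norm_num))
  have hI : ∀ t ∈ Icc (t₀ - r) (t₀ + r), t ∈ O ∧ ‖deriv ψ t - e‖ < δ := by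
    intro t ht
    refine hr₀b ?_
    rw [Real.dist_eq]
    refine lt_of_le_of_lt ?_ (hrb.trans_le (min_le_left _ _))
    rw [abs_le]
    constructor <;> linarith [ht.1, ht.2]
  have hmvt : ∀ x ∈ Icc (t₀ - r) (t₀ + r), ∀ y ∈ Icc (t₀ - r) (t₀ + r),
      ‖ψ y - ψ x - (y - x) • e‖ ≤ δ * |y - x| := by
    intro x hx y hy
    have h1 := (convex_Icc (t₀ - r) (t₀ + r)).norm_image_sub_le_of_norm_hasDerivWithin_le
      (f := fun t => ψ t - t • e) (f' := fun t => deriv ψ t - e) (C := δ) (x := x) (y := y)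
      (fun t ht => by
        have h2 : HasDerivAt ψ (deriv ψ t) t :=
          ((hψ.contDiffAt (hO.mem_nhds (hI t ht).1)).differentiableAt one_ne_zero).hasDerivAt
        have h3 : HasDerivAt (fun t => ψ t - t • e) (deriv ψ t - e) t := by
          have h := h2.sub ((hasDerivAt_id t).smul_const e)
          rw [one_smul] at h
          exact h
        exact h3.hasDerivWithinAt)
      (fun t ht => (hI t ht).2.le) hx hy
    rwa [Real.norm_eq_abs,
      show ψ y - y • e - (ψ x - x • e) = ψ y - ψ x - (y - x) • e by module] at h1
  -- The parameter is clamped to an interval around `t₀`, and the curve continues outside it along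
  -- straight lines of direction `e`. The shift `1/2 - t₀` moves `t₀` to the middle of `[0, 1]`, and
  -- `r < 1/2` keeps the interval inside.
  let c : ℝ → ℝ := fun t => projIcc (t₀ - r) (t₀ + r) (by linarith) (t - (1 / 2 - t₀))
  have hcI : ∀ t, c t ∈ Icc (t₀ - r) (t₀ + r) := fun t => Subtype.prop _
  have hclip : ∀ s t, |c t - c s| ≤ |t - s| := by
    intro s t
    have := (LipschitzWith.projIcc (show t₀ - r ≤ t₀ + r by linarith)).dist_le_mul
      (t - (1 / 2 - t₀)) (s - (1 / 2 - t₀))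
    rwa [Subtype.dist_eq, Real.dist_eq, Real.dist_eq, sub_sub_sub_cancel_right, NNReal.coe_one,
      one_mul] at this
  let F : unitInterval → E := fun t => ψ (c t) + ((t : ℝ) - (1 / 2 - t₀) - c t) • e
  have hF : ∀ s t : unitInterval, ‖F t - F s - ((t : ℝ) - s) • e‖ ≤ δ * |(t : ℝ) - s| := by
    intro s t
    have h1 := hmvt (c s) (hcI s) (c t) (hcI t)
    have h2 : F t - F s - ((t : ℝ) - s) • e = ψ (c t) - ψ (c s) - (c t - c s) • e := by
      simp only [F]
      module
    rw [h2]
    exact h1.trans (mul_le_mul_of_nonneg_left (hclip s t) hδ0)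
  obtain ⟨m, hm⟩ := exists_nat_ge ‖F 0‖
  refine ⟨m, ⟨F, (lipschitzWith_of_slope hδ0 hF).continuous⟩, ⟨hm, hF⟩, r, hr, fun t ht => ?_⟩
  rw [abs_lt] at ht
  have hr2 := hrb.trans_le (min_le_right _ _)
  refine ⟨⟨t + (1 / 2 - t₀), by linarith, by linarith⟩, rfl, ?_⟩
  have hct : c (t + (1 / 2 - t₀)) = t := by
    simp only [c, add_sub_cancel_right]
    rw [projIcc_of_mem _ ⟨by linarith, by linarith⟩]
  change ψ (c (t + (1 / 2 - t₀))) +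
    (t + (1 / 2 - t₀) - (1 / 2 - t₀) - c (t + (1 / 2 - t₀))) • e = ψ t
  rw [hct, add_sub_cancel_right, sub_self, zero_smul, add_zero]

/-- Every bundle of `𝒢_μ` contains, off a `μ`-null Borel set, almost every tangent vector of every
curve of class `C¹`. -/
theorem exists_containsCurveTangents (hV : V ∈ compatibleBundles μ) :
    ∃ N, MeasurableSet N ∧ μ N = 0 ∧ ContainsCurveTangents N V := by
  have H : ∀ (e : EuclideanSpace ℝ (Fin n)) (δ R : ℝ), ∃ N, MeasurableSet N ∧ μ N = 0 ∧
      (0 ≤ δ → δ < ‖e‖ → ∀ γ ∈ slopeCurves e δ R, ∀ᵐ t : unitInterval,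
        δ < ‖(V (γ t))ᗮ.starProjection e‖ → γ t ∈ N) := by
    intro e δ R
    by_cases h : 0 ≤ δ ∧ δ < ‖e‖
    · obtain ⟨N, h1, h2, h3⟩ := exists_null_of_mem_compatibleBundles_of_slope hV h.1 h.2 R
      exact ⟨N, h1, h2, fun _ _ => h3⟩
    · exact ⟨∅, .empty, measure_empty, fun h1 h2 => absurd ⟨h1, h2⟩ h⟩
  choose N hN hμN hNγ using H
  let d := TopologicalSpace.denseSeq (EuclideanSpace ℝ (Fin n))
  refine ⟨⋃ (i : ℕ) (q : ℚ) (m : ℕ), N (d i) q m,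
    .iUnion fun i => .iUnion fun q => .iUnion fun m => hN _ _ _,
    measure_iUnion_null fun i => measure_iUnion_null fun q => measure_iUnion_null fun m =>
      hμN _ _ _, ?_⟩
  intro ψ O hO hψ
  have hnull : ∀ (i : ℕ) (q : ℚ), volume {t | t ∈ O ∧ ‖deriv ψ t - d i‖ < q ∧
      (q : ℝ) < ‖(V (ψ t))ᗮ.starProjection (d i)‖ ∧ ∀ m : ℕ, ψ t ∉ N (d i) q m} = 0 := by
    intro i q
    refine measure_null_of_locally_null _ fun t₀ ht₀ => ?_
    obtain ⟨ht₀O, hδ, hlt, -⟩ := ht₀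
    obtain ⟨m, γ, hγ, r, hr, hγψ⟩ := exists_mem_slopeCurves_of_contDiffOn hO hψ ht₀O hδ
    have hae := hNγ (d i) q m ((norm_nonneg _).trans hδ.le)
      (hlt.trans_le ((V (ψ t₀))ᗮ.norm_starProjection_apply_le _)) γ hγ
    rw [ae_iff, unitInterval.volume_apply] at hae
    refine ⟨_, inter_mem_nhdsWithin _ (Metric.ball_mem_nhds t₀ hr), ?_⟩
    refine measure_mono_null ?_ ((measure_preimage_add_right volume (1 / 2 - t₀) _).trans hae)
    rintro t ⟨⟨-, -, h1, h2⟩, ht⟩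
    obtain ⟨s, hs, hst⟩ := hγψ t (by simpa [Real.dist_eq] using ht)
    refine ⟨s, ?_, hs⟩
    simp only [mem_ofPred_eq, hst]
    exact fun h => h2 m (h h1)
  have hall := ae_all_iff.2 fun i => ae_all_iff.2 fun q =>
    measure_eq_zero_iff_ae_notMem.1 (hnull i q)
  filter_upwards [hall] with t ht htO htN
  by_contra hmem
  set v := deriv ψ t with hv
  have hpos : 0 < ‖(V (ψ t))ᗮ.starProjection v‖ := by
    rw [norm_pos_iff]
    intro h0
    rw [Submodule.starProjection_apply_eq_zero_iff, Submodule.orthogonal_orthogonal] at h0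
    exact hmem h0
  -- With `q` below half the normal component of `v` and `d i` within `q` of `v`, the normal
  -- component of `d i` still exceeds `q`.
  obtain ⟨q, hq0, hq⟩ := exists_rat_btwn (half_pos hpos)
  obtain ⟨i, hi⟩ := (TopologicalSpace.denseRange_denseSeq (EuclideanSpace ℝ (Fin n))).exists_dist_lt
    v hq0
  rw [dist_eq_norm] at hi
  refine ht i q ⟨htO, hi, ?_, fun m hm => htN (mem_iUnion.2 ⟨i, mem_iUnion.2 ⟨q,
    mem_iUnion.2 ⟨m, hm⟩⟩⟩)⟩
  have h1 := (V (ψ t))ᗮ.norm_starProjection_apply_le (v - d i)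
  rw [map_sub] at h1
  have h2 := norm_sub_norm_le ((V (ψ t))ᗮ.starProjection v) ((V (ψ t))ᗮ.starProjection (d i))
  have hi' : ‖v - d i‖ < q := hi
  linarith

end CompatibleBundles

/-! ### Properties of the decomposability bundle. -/

section DecompBundle

variable {n : ℕ} {μ μ' : Measure (EuclideanSpace ℝ (Fin n))} [IsFiniteMeasure μ]
  [IsFiniteMeasure μ']

theorem exists_containsCurveTangents_decompBundle (μ : Measure (EuclideanSpace ℝ (Fin n)))
    [IsFiniteMeasure μ] :
    ∃ N, MeasurableSet N ∧ μ N = 0 ∧ ContainsCurveTangents N (decompBundle μ) :=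
  exists_containsCurveTangents (decompBundle_mem μ)

theorem isBorelBundle_decompBundle (μ : Measure (EuclideanSpace ℝ (Fin n)))
    [IsFiniteMeasure μ] : IsBorelBundle (decompBundle μ) :=
  (decompBundle_mem μ).1

/-- One inclusion holds because the exceptional set of `V(μ, ·)` is also `μ'`-null. For the other,
`V(μ', ·)` is kept on a set carrying `μ'` on which `μ ≪ μ'`, and enlarged to the whole space
elsewhere; the result belongs to `𝒢_μ`. -/
theorem decompBundle_ae_eq_of_absolutelyContinuous (h : μ' ≪ μ) :
    ∀ᵐ x ∂μ', decompBundle μ' x = decompBundle μ x := by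
  classical
  have hle : ∀ᵐ x ∂μ', decompBundle μ' x ≤ decompBundle μ x := by
    obtain ⟨N, hN, hμN, hc⟩ := exists_containsCurveTangents_decompBundle μ
    exact decompBundle_ae_le μ'
      (hc.mem_compatibleBundles (isBorelBundle_decompBundle μ) hN (h hμN))
  obtain ⟨N, hN, hμN, hc⟩ := exists_containsCurveTangents_decompBundle μ'
  obtain ⟨A, hA, hA1, hA2⟩ := exists_measurableSet_restrict_absolutelyContinuous μ μ'
  have hcA : ContainsCurveTangents (A ∩ N)
      fun x => if x ∈ A then decompBundle μ' x else ⊤ := by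
    intro ψ O hO hψ
    filter_upwards [hc ψ O hO hψ] with t ht htO htN
    split_ifs with hA
    · exact ht htO fun hmem => htN ⟨hA, hmem⟩
    · trivial
  have hmem := hcA.mem_compatibleBundles (μ := μ)
    ((isBorelBundle_decompBundle μ').ite (isBorelBundle_const ⊤) hA) (hA.inter hN) (by
      rw [inter_comm, ← Measure.restrict_apply hN]; exact hA2 hμN)
  filter_upwards [hle, h (decompBundle_ae_le μ hmem), measure_eq_zero_iff_ae_notMem.1 hA1]
    with x h1 h2 h3
  rw [if_pos (by simpa using h3)] at h2
  exact le_antisymm h1 h2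

/-- A `C¹` curve is tangent to `S` at almost every time it spends in `S`. So the bundle equal to the
tangent space on `S` and to the whole space elsewhere passes the test with no exceptional set. -/
theorem decompBundle_ae_le_tanSpace (μ : Measure (EuclideanSpace ℝ (Fin n))) [IsFiniteMeasure μ]
    {k : ℕ} {S : Set (EuclideanSpace ℝ (Fin n))} (hS : IsC1Surface k S) :
    ∀ᵐ x ∂μ, x ∈ S → decompBundle μ x ≤ tanSpace S x := by
  classical
  rw [ae_iff]
  refine measure_null_of_locally_null _ fun x hx => ?_
  simp only [mem_ofPred_eq, not_forall] at hx
  obtain ⟨hxS, -⟩ := hx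
  obtain ⟨φ, W, hxs, hk, h1, h2, h3⟩ := hS x hxS
  refine ⟨{x | ¬ (x ∈ S → decompBundle μ x ≤ tanSpace S x)} ∩ φ.source,
    inter_mem_nhdsWithin _ (φ.open_source.mem_nhds hxs), ?_⟩
  -- `S` need not be known to be Borel; its part in a chart is, and there the tangent space is the
  -- kernel of a Borel field of linear maps.
  let A : Set (EuclideanSpace ℝ (Fin n)) := φ.source ∩ φ ⁻¹' W
  have hA : MeasurableSet A := by
    have hW : IsClosed (W : Set (EuclideanSpace ℝ (Fin n))) := W.closed_of_finiteDimensional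
    obtain ⟨u, hu, hu2⟩ := continuousOn_iff_isClosed.1 φ.continuousOn _ hW
    have : A = φ.source ∩ u := by
      rw [inter_comm, ← hu2, inter_comm]
    rw [this]
    exact φ.open_source.measurableSet.inter hu.measurableSet
  have hAS : ∀ y ∈ φ.source, y ∈ A ↔ y ∈ S := fun y hy => by
    rw [h3 y hy]; exact ⟨fun h => h.2, fun h => ⟨hy, h⟩⟩
  let B : EuclideanSpace ℝ (Fin n) → EuclideanSpace ℝ (Fin n) →L[ℝ] EuclideanSpace ℝ (Fin n) :=
    fun x => Wᗮ.starProjection.comp (fderiv ℝ φ x)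
  have hB : Measurable B :=
    ((ContinuousLinearMap.compL ℝ _ _ _ Wᗮ.starProjection).continuous.measurable).comp
      (measurable_fderiv ℝ φ)
  have hBker : ∀ y ∈ A, LinearMap.ker (B y : EuclideanSpace ℝ (Fin n) →ₗ[ℝ] EuclideanSpace ℝ (Fin n)) = tanSpace S y := by
    intro y hy
    rw [(hS.tanSpace_eq hk h1 h2 h3 hy.1 ((hAS y hy.1).1 hy)).1]
    ext v
    rw [LinearMap.mem_ker, Submodule.mem_comap]
    change Wᗮ.starProjection (fderiv ℝ φ y v) = 0 ↔ _
    rw [Submodule.starProjection_apply_eq_zero_iff, Submodule.orthogonal_orthogonal]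
    rfl
  have hc : ContainsCurveTangents ∅ fun x =>
      if x ∈ A then LinearMap.ker (B x : EuclideanSpace ℝ (Fin n) →ₗ[ℝ] EuclideanSpace ℝ (Fin n)) else ⊤ := by
    intro ψ O hO hψ
    filter_upwards [ae_deriv_mem_tangentConeAt ψ S] with t ht htO _
    split_ifs with hmem
    · rw [hBker _ hmem]
      refine Submodule.subset_span (ht ((hAS _ hmem.1).1 hmem) ?_)
      exact (hψ.contDiffAt (hO.mem_nhds htO)).differentiableAt one_ne_zero
    · trivial
  have hae := decompBundle_ae_le μ (hc.mem_compatibleBundles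
    ((isBorelBundle_ker hB).ite (isBorelBundle_const ⊤) hA) .empty (measure_empty (μ := μ)))
  refine measure_mono_null ?_ (ae_iff.1 hae)
  rintro y ⟨hy, hys⟩ hle
  refine hy fun hyS => ?_
  rw [if_pos ((hAS y hys).2 hyS), hBker y ((hAS y hys).2 hyS)] at hle
  exact hle

theorem decompBundle_ae_eq_approxTan {k : ℕ} {E : Set (EuclideanSpace ℝ (Fin n))}
    (hE : IsRectifiable k E)
    (h : μ ≪ (μH[k] : Measure (EuclideanSpace ℝ (Fin n))).restrict E) :
    ∀ᵐ x ∂μ, decompBundle μ x = approxTan hE x := by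
  obtain ⟨S, hS, hES⟩ := hE.ae_exists_mem_surface
  obtain ⟨N, hN, hμN, hc⟩ := exists_containsCurveTangents_decompBundle μ
  have h1 := hc.ae_approxTan_le (isBorelBundle_decompBundle μ) hN hE
  filter_upwards [h (ae_restrict_of_ae h1), h (ae_restrict_of_ae hES), h (ae_restrict_mem hE.1),
    measure_eq_zero_iff_ae_notMem.1 hμN, ae_all_iff.2 fun i => decompBundle_ae_le_tanSpace μ (hS i)]
    with x hx1 hx2 hxE hxN hx3
  refine le_antisymm ?_ (hx1 hxE hxN)
  obtain ⟨i, hi, hi2⟩ := hx2 hxE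
  rw [hi2]
  exact hx3 i hi

theorem isC1Surface_univ : IsC1Surface n (univ : Set (EuclideanSpace ℝ (Fin n))) := by
  intro x _
  refine ⟨OpenPartialHomeomorph.refl _, ⊤, trivial, ?_, contDiffOn_id, contDiffOn_id, ?_⟩
  · rw [finrank_top, finrank_euclideanSpace_fin]
  · intro y _
    simp

theorem decompBundle_ae_eq_top (h : μ ≪ volume) : ∀ᵐ x ∂μ, decompBundle μ x = ⊤ := by
  obtain ⟨N, hN, hμN, hc⟩ := exists_containsCurveTangents_decompBundle μ
  have h1 := hc.ae_tanSpace_le (isBorelBundle_decompBundle μ) hN isC1Surface_univ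
  have hac : (volume : Measure (EuclideanSpace ℝ (Fin n))) ≪ μH[n] := by
    have : ((n : ℝ)) = Module.finrank ℝ (EuclideanSpace ℝ (Fin n)) := by
      rw [finrank_euclideanSpace_fin]
    rw [this]
    exact Measure.absolutelyContinuous_isAddHaarMeasure _ _
  filter_upwards [h (hac h1), measure_eq_zero_iff_ae_notMem.1 hμN] with x hx hxN
  have h2 : tanSpace univ x = (⊤ : Submodule ℝ (EuclideanSpace ℝ (Fin n))) := by
    refine Submodule.eq_top_of_finrank_eq ?_
    rw [isC1Surface_univ.finrank_tanSpace (mem_univ x), finrank_euclideanSpace_fin]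
  rw [← top_le_iff, ← h2]
  exact hx (mem_univ x) hxN

/-- Where the bundle vanishes, off the exceptional set, a `1`-rectifiable set would have a zero
tangent space instead of a line. Conversely, if `μ` lives on a purely unrectifiable set, almost all
members of a family in `ℱ_μ` are null both on and off that set, so the zero bundle is compatible. -/
theorem decompBundle_ae_eq_bot_iff : (∀ᵐ x ∂μ, decompBundle μ x = ⊥) ↔
    ∃ E : Set (EuclideanSpace ℝ (Fin n)),
      MeasurableSet E ∧ IsPurelyUnrectifiable E ∧ μ Eᶜ = 0 := by
  constructor
  · intro h
    obtain ⟨N, hN, hμN, hc⟩ := exists_containsCurveTangents_decompBundle μ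
    have hZ : MeasurableSet {x | decompBundle μ x = ⊥} := by
      have := (isBorelBundle_decompBundle μ) (measurableSet_singleton
        ((⊥ : Submodule ℝ (EuclideanSpace ℝ (Fin n))).starProjection))
      convert this using 1
      ext x
      constructor
      · intro hx
        have hx : decompBundle μ x = ⊥ := hx
        simp [hx]
      · intro hx
        exact Submodule.starProjection_inj.1 hx
    refine ⟨{x | decompBundle μ x = ⊥} \ N, hZ.diff hN, fun S hS => ?_, ?_⟩
    · have h1 := hc.ae_approxTan_le (isBorelBundle_decompBundle μ) hN hS
      have h2 := hS.ae_finrank_approxTan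
      rw [Nat.cast_one] at h1 h2
      rw [measure_eq_zero_iff_ae_notMem]
      filter_upwards [h1, h2] with x hx1 hx2
      rintro ⟨⟨hx0, hxN⟩, hxS⟩
      have hx0 : decompBundle μ x = ⊥ := hx0
      have h3 := hx1 hxS hxN
      rw [hx0, le_bot_iff] at h3
      have h4 := hx2 hxS
      rw [h3, finrank_bot] at h4
      exact zero_ne_one h4
    · rw [compl_sdiff]
      refine measure_union_null hμN ?_
      exact h
  · rintro ⟨E, hE, hpu, hμE⟩
    have hmem : (fun _ => ⊥) ∈ compatibleBundles μ := by
      refine ⟨isBorelBundle_const ⊥, fun F hF => ?_⟩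
      filter_upwards [hF.ae_ae_notMem hμE] with t ht
      have h0 : (μH[1] : Measure (EuclideanSpace ℝ (Fin n))).restrict (F t) E = 0 := by
        rw [Measure.restrict_apply hE]
        exact hpu _ (hF.rect t)
      filter_upwards [ht, measure_eq_zero_iff_ae_notMem.1 h0] with x hx1 hx2
      exact absurd (not_not.1 hx1) hx2
    filter_upwards [decompBundle_ae_le μ hmem] with x hx
    exact le_bot_iff.1 hx

theorem decompBundle_ae_le_of_bind {I : Type*} [MeasurableSpace I] {ds : Measure I}
    {ν : I → Measure (EuclideanSpace ℝ (Fin n))} [∀ s, IsFiniteMeasure (ν s)] (hν : Measurable ν)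
    (h : ds.bind ν ≪ μ) : ∀ᵐ s ∂ds, ∀ᵐ x ∂ν s, decompBundle (ν s) x ≤ decompBundle μ x := by
  obtain ⟨N, hN, hμN, hc⟩ := exists_containsCurveTangents_decompBundle μ
  filter_upwards [Measure.ae_ae_of_ae_bind hν.aemeasurable
    (measure_eq_zero_iff_ae_notMem.1 (h hμN))] with s hs
  exact decompBundle_ae_le (ν s) (hc.mem_compatibleBundles (isBorelBundle_decompBundle μ) hN
    (measure_eq_zero_iff_ae_notMem.2 hs))

/-- Almost every `ν s` gives no mass to the points off `N` where the dimension is below `k`, since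
there the bundle would contain a `k`-dimensional tangent space. -/
theorem le_finrank_decompBundle_of_bind {I : Type*} [MeasurableSpace I] {ds : Measure I}
    {ν : I → Measure (EuclideanSpace ℝ (Fin n))} (hν : Measurable ν) {k : ℕ}
    (h : μ ≪ ds.bind ν)
    (hk : ∀ᵐ s ∂ds, ∃ E : Set (EuclideanSpace ℝ (Fin n)), IsRectifiable k E ∧
      ν s = (μH[k] : Measure (EuclideanSpace ℝ (Fin n))).restrict E) :
    ∀ᵐ x ∂μ, k ≤ Module.finrank ℝ (decompBundle μ x) := by
  obtain ⟨N, hN, hμN, hc⟩ := exists_containsCurveTangents_decompBundle μ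
  let B : Set (EuclideanSpace ℝ (Fin n)) :=
    {x | (Module.finrank ℝ (decompBundle μ x) : ℝ≥0∞) < k} \ N
  have hB : MeasurableSet B :=
    (measurableSet_lt (isBorelBundle_decompBundle μ).measurable_finrank measurable_const).diff hN
  have h0 : ds.bind ν B = 0 := by
    rw [Measure.bind_apply hB hν.aemeasurable]
    refine (lintegral_congr_ae (g := fun _ => 0) ?_).trans lintegral_zero
    filter_upwards [hk] with s hs
    obtain ⟨E, hE, hνE⟩ := hs
    rw [hνE, measure_eq_zero_iff_ae_notMem]
    filter_upwards [ae_restrict_of_ae (hc.ae_approxTan_le (isBorelBundle_decompBundle μ) hN hE),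
      ae_restrict_of_ae hE.ae_finrank_approxTan, ae_restrict_mem hE.1] with x hx1 hx2 hxE
    rintro ⟨hlt, hxN⟩
    have h3 := Submodule.finrank_mono (hx1 hxE hxN)
    rw [hx2 hxE] at h3
    have h4 : Module.finrank ℝ (decompBundle μ x) < k := by exact_mod_cast hlt
    omega
  filter_upwards [measure_eq_zero_iff_ae_notMem.1 (h h0), measure_eq_zero_iff_ae_notMem.1 hμN]
    with x hx hxN
  by_contra hlt
  refine hx ⟨?_, hxN⟩
  rw [not_le] at hlt
  change (Module.finrank ℝ (decompBundle μ x) : ℝ≥0∞) < k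
  exact_mod_cast hlt

end DecompBundle

theorem mainTheorem2 {n : ℕ} (μ μ' : Measure (EuclideanSpace ℝ (Fin n)))
    [IsFiniteMeasure μ] [IsFiniteMeasure μ'] :
    -- (i) strong locality, and its localized form
    (μ' ≪ μ → ∀ᵐ x ∂μ', decompBundle μ' x = decompBundle μ x) ∧
    (∀ E : Set (EuclideanSpace ℝ (Fin n)), MeasurableSet E → μ'.restrict E ≪ μ →
      ∀ᵐ x ∂μ'.restrict E, decompBundle μ' x = decompBundle μ x) ∧
    -- (ii) measures supported on a surface
    (∀ (k : ℕ) (S : Set (EuclideanSpace ℝ (Fin n))), IsC1Surface k S → μ Sᶜ = 0 →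
      ∀ᵐ x ∂μ, decompBundle μ x ≤ tanSpace S x) ∧
    -- (iii) measures absolutely continuous with respect to a rectifiable set, or to Lebesgue
    (∀ (k : ℕ), 1 ≤ k → ∀ (E : Set (EuclideanSpace ℝ (Fin n))) (hE : IsRectifiable k E),
      μ ≪ (μH[k] : Measure (EuclideanSpace ℝ (Fin n))).restrict E →
      ∀ᵐ x ∂μ, decompBundle μ x = approxTan hE x) ∧
    (μ ≪ volume → ∀ᵐ x ∂μ, decompBundle μ x = ⊤) ∧
    -- (iv) measures with trivial bundle
    ((∀ᵐ x ∂μ, decompBundle μ x = ⊥) ↔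
      ∃ E : Set (EuclideanSpace ℝ (Fin n)),
        MeasurableSet E ∧ IsPurelyUnrectifiable E ∧ μ Eᶜ = 0) ∧
    -- (v), (vi) integrals of families of measures
    (∀ (I : Type*) [MetricSpace I] [LocallyCompactSpace I] [TopologicalSpace.SeparableSpace I]
      [MeasurableSpace I] [BorelSpace I] (ds : Measure I) [IsFiniteMeasure ds]
      (ν : I → Measure (EuclideanSpace ℝ (Fin n))) [∀ s, IsFiniteMeasure (ν s)],
      Measurable ν → ∫⁻ s, ν s univ ∂ds < ∞ →
      (ds.bind ν ≪ μ → ∀ᵐ s ∂ds, ∀ᵐ x ∂ν s, decompBundle (ν s) x ≤ decompBundle μ x) ∧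
      (∀ k : ℕ, 1 ≤ k → μ ≪ ds.bind ν →
        (∀ᵐ s ∂ds, ∃ E : Set (EuclideanSpace ℝ (Fin n)), IsRectifiable k E ∧
          ν s = (μH[k] : Measure (EuclideanSpace ℝ (Fin n))).restrict E) →
        ∀ᵐ x ∂μ, k ≤ Module.finrank ℝ (decompBundle μ x)))
 := by
  refine ⟨decompBundle_ae_eq_of_absolutelyContinuous, fun E hE h => ?_,
    fun k S hS hμS => ?_, fun k _ E hE h => decompBundle_ae_eq_approxTan hE h,
    decompBundle_ae_eq_top, decompBundle_ae_eq_bot_iff,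
    fun I _ _ _ _ _ ds _ ν _ hν _ => ⟨decompBundle_ae_le_of_bind hν,
      fun k _ h hk => le_finrank_decompBundle_of_bind hν h hk⟩⟩
  -- The measure `μ'.restrict E` is absolutely continuous with respect to both `μ` and `μ'`, so its
  -- bundle agrees with each of theirs.
  · filter_upwards [decompBundle_ae_eq_of_absolutelyContinuous h,
      decompBundle_ae_eq_of_absolutelyContinuous
        (Measure.absolutelyContinuous_of_le (Measure.restrict_le_self (μ := μ') (s := E)))]
      with x h1 h2
    rw [← h1, h2]
  · filter_upwards [decompBundle_ae_le_tanSpace μ hS, measure_eq_zero_iff_ae_notMem.1 hμS]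
      with x h1 h2
    exact h1 (not_not.1 h2)
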